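/- **Setting.** Let $(e_j)$ be the canonical basis of $l^2(\mathbb N)$ and $P_m$ the orthogonal projection onto the span of the first $m$ basis vectors. Let $\mathcal M$ be the set of nonempty compact subsets of $\mathbb C$ with the Hausdorff metric. A computational problem consists of a set $\Omega$, a set $\Lambda$ of functions $\Omega\to\mathbb C$ (the evaluations) and a map $\Xi:\Omega\to\mathcal M$. A *general algorithm* is a map $\Gamma:\Omega\to\mathcal M$ such that each $A\in\Omega$ has a finite set $\Lambda_\Gamma(A)\subset\Lambda$ with the following property: if $B\in\Omega$ and $\varphi(B)=\varphi(A)$ for all $\varphi\in\Lambda_\Gamma(A)$, then $\Gamma(B)=\Gamma(A)$ and $\Lambda_\Gamma(B)=\Lambda_\Gamma(A)$. A general algorithm is *arithmetic* if, for each $A$, $\Gamma(A)$ is a finite set whose points are computed from evaluations of $A$, rational numbers and $\mathrm i$ by finitely many operations $+,-,\cdot,/$, taking of real and imaginary parts, and comparisons of real numbers, where the steps taken may depend on the results of the earlier comparisons. A *tower of height $k$* is a family of maps $\Gamma_{n_k},\ \Gamma_{n_k,n_{k-1}},\ \dots,\ \Gamma_{n_k,\dots,n_1}:\Omega\to\mathcal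 M$ ($n_i\in\mathbb N$) such that, for every $A\in\Omega$, $\Xi(A)=\lim_{n_k\to\infty}\Gamma_{n_k}(A)$ and $\Gamma_{n_k,\dots,n_{j+1}}(A)=\lim_{n_j\to\infty}\Gamma_{n_k,\dots,n_j}(A)$ for $1\le j<k$. It is a general (arithmetic) tower if all maps $\Gamma_{n_k,\dots,n_1}$ are general (arithmetic) algorithms. $\mathrm{SCI}(\Xi,\Omega)_{\mathrm G}$ and $\mathrm{SCI}(\Xi,\Omega)_{\mathrm A}$ denote the least height $k\ge 1$ of a general, respectively arithmetic, tower ($\infty$ if there is none), except that the value is $0$ if there is such a tower of height one with $\Xi=\Gamma_{n_1}$ for some $n_1$. The dispersion of a bounded operator $A$ is *bounded by* $f:\mathbb N\to\mathbb N$ if $$\max\{\|(I-P_{f(m)})AP_m\|,\ \|P_mA(I-P_{f(m)})\|\}\to 0\quad (m\to\infty).$$ For $N\in\{0,1,2,\dots\}$ and $\epsilon>0$ put $\mathrm{sp}_{N,\epsilon}(A)=\{z\in\mathbb C:\|(A-zI)^{-2^N}\|^{2^{-N}}\ge 1/\epsilon\}$, where the norm is $\infty$ if $A-zI$ is not invertible.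 **Theorem (General, compact and dispersion operators).** Let $f:\mathbb N\to\mathbb N$ satisfy $f(m)\to\infty$ as $m\to\infty$, let $\epsilon>0$ and $N\in\{0,1,2,\dots\}$. Let $\Omega_1=\mathcal B(l^2(\mathbb N))$, let $\Omega_2$ be the set of bounded operators on $l^2(\mathbb N)$ whose dispersion is bounded by $f$, and let $\Omega_3$ be the set of compact operators on $l^2(\mathbb N)$. The evaluations are the matrix entries $A\mapsto\langle Ae_j,e_i\rangle$ ($i,j\in\mathbb N$) and, for $\Omega_2$ only, in addition the constant functions $A\mapsto f(m)$ ($m\in\mathbb N$). Let $\Xi_1(A)=\mathrm{sp}(A)$ be the spectrum and $\Xi_2(A)=\mathrm{sp}_{N,\epsilon}(A)$. Then $$\mathrm{SCI}(\Xi_1,\Omega_1)_{\mathrm G}=\mathrm{SCI}(\Xi_1,\Omega_1)_{\mathrm A}=3,\qquad \mathrm{SCI}(\Xi_2,\Omega_1)_{\mathrm G}=\mathrm{SCI}(\Xi_2,\Omega_1)_{\mathrm A}=2,$$ $$\mathrm{SCI}(\Xi_1,\Omega_2)_{\mathrm G}=\mathrm{SCI}(\Xi_1,\Omega_2)_{\mathrm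 A}=2,\qquad \mathrm{SCI}(\Xi_2,\Omega_2)_{\mathrm G}=\mathrm{SCI}(\Xi_2,\Omega_2)_{\mathrm A}=1,$$ $$\mathrm{SCI}(\Xi_1,\Omega_3)_{\mathrm G}=\mathrm{SCI}(\Xi_1,\Omega_3)_{\mathrm A}=1,\qquad \mathrm{SCI}(\Xi_2,\Omega_3)_{\mathrm G}=\mathrm{SCI}(\Xi_2,\Omega_3)_{\mathrm A}=1.$$ Moreover, for every $M>0$ all these equalities remain true if each $\Omega_i$ is replaced by $\Omega_i^M=\{A\in\Omega_i:\|A\|\le M\}$ (with the same evaluations, restricted to $\Omega_i^M$). -/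

import Mathlib

open Filter Topology

namespace TowerSCI

noncomputable section

universe u v

/-! ### Computational problems, algorithms, towers, and the SCI -/

/-- A computational problem: a primary set `Ω`, an evaluation set `Λ` of complex valued functions
on `Ω`, and a problem function `Ξ` from `Ω` to the space `M`. -/
structure ComputationalProblem (Ω : Type u) (M : Type v) where
  Λ : Set (Ω → ℂ)
  Ξ : Ω → M

/-- `Γ` is a general algorithm with respect to the evaluation set `Λ`: for each input `A` there is
a finite set `ΛΓ A ⊆ Λ` of evaluations such that every input `B` with the same values of these
evaluations has the same output and the same set of evaluations. -/
def IsGeneralAlgorithm {Ω : Type u} {M : Type v} (Λ : Set (Ω → ℂ)) (Γ : Ω → M) : Prop :=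
  ∃ ΛΓ : Ω → Set (Ω → ℂ), ∀ A : Ω,
    (ΛΓ A).Finite ∧ ΛΓ A ⊆ Λ ∧
      ∀ B : Ω, (∀ φ ∈ ΛΓ A, φ B = φ A) → Γ B = Γ A ∧ ΛΓ B = ΛΓ A

/-- `Γ` is a tower of height `k` for the problem function `Ξ` whose lowest functions belong to the
class `Alg`. The function `Γ_{n_k, …, n_j}` is `Γ [n_k, …, n_j]`, and the empty list of indices
stands for `Ξ` itself. -/
structure IsTower {Ω : Type u} {M : Type v} [PseudoMetricSpace M] (Alg : (Ω → M) → Prop)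
    (Ξ : Ω → M) (k : ℕ) (Γ : List ℕ → Ω → M) : Prop where
  top : Γ [] = Ξ
  lowest : ∀ l : List ℕ, l.length = k → Alg (Γ l)
  limit : ∀ l : List ℕ, l.length < k → ∀ A : Ω,
    Tendsto (fun n : ℕ => Γ (l ++ [n]) A) atTop (𝓝 (Γ l A))

open scoped Classical in
/-- The Solvability Complexity Index with respect to towers whose lowest functions belong to the
class `Alg`: it is `0` if there is a tower of height one some function of which already equals the
problem function, otherwise the least height `k ≥ 1` of a tower, and `∞` if there is no tower. -/
def solvabilityIndex {Ω : Type u} {M : Type v} [PseudoMetricSpace M] (Alg : (Ω → M) → Prop)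
    (Ξ : Ω → M) : ℕ∞ :=
  if ∃ Γ : List ℕ → Ω → M, IsTower Alg Ξ 1 Γ ∧ ∃ n₁ : ℕ, Ξ = Γ [n₁] then 0
  else sInf {h : ℕ∞ | ∃ k : ℕ, 1 ≤ k ∧ (∃ Γ : List ℕ → Ω → M, IsTower Alg Ξ k Γ) ∧ h = k}

/-! ### Arithmetic algorithms with values in the nonempty compact subsets of the plane -/

/-- Arithmetic terms over the evaluations: finitely many arithmetic operations on evaluations of
the input, together with rational numbers, and passing between a complex number and its real and
imaginary part. -/
inductive ArithTerm {Ω : Type u} (Λ : Set (Ω → ℂ)) : Type u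
  | eval (φ : Λ) : ArithTerm Λ
  | rat (q : ℚ) : ArithTerm Λ
  | imUnit : ArithTerm Λ
  | add (s t : ArithTerm Λ) : ArithTerm Λ
  | sub (s t : ArithTerm Λ) : ArithTerm Λ
  | mul (s t : ArithTerm Λ) : ArithTerm Λ
  | div (s t : ArithTerm Λ) : ArithTerm Λ
  | re (t : ArithTerm Λ) : ArithTerm Λ
  | im (t : ArithTerm Λ) : ArithTerm Λ

/-- The value of a term on the input `A`. Division by zero returns `0`; since a divisor can be
tested for being zero, this adds nothing to what can be computed. -/
def ArithTerm.value {Ω : Type u} {Λ : Set (Ω → ℂ)} (A : Ω) : ArithTerm Λ → ℂ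
  | .eval φ => φ.1 A
  | .rat q => (q : ℂ)
  | .imUnit => Complex.I
  | .add s t => s.value A + t.value A
  | .sub s t => s.value A - t.value A
  | .mul s t => s.value A * t.value A
  | .div s t => s.value A / t.value A
  | .re t => ((t.value A).re : ℂ)
  | .im t => ((t.value A).im : ℂ)

/-- What an arithmetic procedure does next: decide for two real numbers (the real parts of the
values of `s` and `t`) whether the first is larger, or stop and return a finite list of numbers. -/
inductive ArithStep {Ω : Type u} (Λ : Set (Ω → ℂ)) : Type u
  | compare (s t : ArithTerm Λ) : ArithStep Λ
  | output (out : List (ArithTerm Λ)) : ArithStep Λ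

/-- `ArithRun S A h out`: the arithmetic procedure `S`, whose next step is a function of the list
of answers to the comparisons made so far (latest answer first), when it is run on the input `A`
from the state `h`, stops after finitely many steps and returns the values of the terms `out`. -/
inductive ArithRun {Ω : Type u} {Λ : Set (Ω → ℂ)} (S : List Bool → ArithStep Λ) (A : Ω) :
    List Bool → List (ArithTerm Λ) → Prop
  | halt {h : List Bool} {out : List (ArithTerm Λ)} (hS : S h = .output out) :
      ArithRun S A h out
  | step {h : List Bool} {s t : ArithTerm Λ} {out : List (ArithTerm Λ)}
      (hS : S h = .compare s t)
      (hrun : ArithRun S A (decide ((s.value A).re > (t.value A).re) :: h) out) :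
      ArithRun S A h out

/-- `Γ` is an arithmetic algorithm: a general algorithm whose output is obtained, for each input
`A`, by an arithmetic procedure that stops on `A` and returns the finitely many points of the
set `Γ A`. -/
def IsArithmeticAlgorithm {Ω : Type u} (Λ : Set (Ω → ℂ))
    (Γ : Ω → TopologicalSpace.NonemptyCompacts ℂ) : Prop :=
  IsGeneralAlgorithm Λ Γ ∧
    ∃ S : List Bool → ArithStep Λ, ∀ A : Ω, ∃ out : List (ArithTerm Λ),
      ArithRun S A [] out ∧ (Γ A : Set ℂ) = {z : ℂ | ∃ t ∈ out, t.value A = z}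

/-- The SCI with respect to general towers. -/
def SCIG {Ω : Type u} {M : Type v} [PseudoMetricSpace M] (P : ComputationalProblem Ω M) : ℕ∞ :=
  solvabilityIndex (IsGeneralAlgorithm P.Λ) P.Ξ

/-- The SCI with respect to arithmetic towers. -/
def SCIA {Ω : Type u} (P : ComputationalProblem Ω (TopologicalSpace.NonemptyCompacts ℂ)) : ℕ∞ :=
  solvabilityIndex (IsArithmeticAlgorithm P.Λ) P.Ξ

/-! ### Operators on `l²(ℕ)`, spectra, pseudospectra and dispersion -/

/-- The Hilbert space `l²(ℕ)`. -/
abbrev L2 : Type := lp (fun _ : ℕ => ℂ) 2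

/-- The bounded linear operators on `l²(ℕ)`. -/
abbrev Op : Type := L2 →L[ℂ] L2

/-- The canonical basis of `l²(ℕ)`, indexed from `0`. -/
def basisVec (i : ℕ) : L2 := lp.single 2 i (1 : ℂ)

/-- The orthogonal projection onto the span of the first `m` basis vectors. -/
def proj (m : ℕ) : Op := ∑ i ∈ Finset.range m, (innerSL ℂ (basisVec i)).smulRight (basisVec i)

/-- The dispersion of `A` is bounded by `f`. -/
def DispersionBoundedBy (f : ℕ → ℕ) (A : Op) : Prop :=
  Tendsto (fun m : ℕ => max ‖(1 - proj (f m)) * A * proj m‖ ‖proj m * A * (1 - proj (f m))‖)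
    atTop (𝓝 0)

/-- The `(N, ε)`-pseudospectrum, with the convention that the norm of the inverse of an operator
without bounded inverse is infinite. -/
def pseudospectrum (N : ℕ) (ε : ℝ) (A : Op) : Set ℂ :=
  {z : ℂ | ¬ IsUnit (A - algebraMap ℂ Op z) ∨
    1 / ε ≤ ‖Ring.inverse (A - algebraMap ℂ Op z) ^ 2 ^ N‖ ^ (1 / (2 : ℝ) ^ N)}

instance : Nontrivial L2 :=
  ⟨⟨basisVec 0, 0, fun h => by
    have h2 : (basisVec 0 : L2) 0 = (0 : L2) 0 := by rw [h]
    simp [basisVec] at h2⟩⟩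

theorem spectrum_subset_pseudospectrum (N : ℕ) (ε : ℝ) (A : Op) :
    spectrum ℂ A ⊆ pseudospectrum N ε A := by
  intro z hz
  left
  rw [spectrum.mem_iff] at hz
  rwa [← IsUnit.sub_iff]

theorem isCompact_pseudospectrum (N : ℕ) {ε : ℝ} (hε : 0 < ε) (A : Op) :
    IsCompact (pseudospectrum N ε A) := by
  have hp : (0 : ℝ) < 1 / (2 : ℝ) ^ N := by positivity
  have hε' : (0 : ℝ) < 1 / ε := by positivity
  have hcompl : (pseudospectrum N ε A)ᶜ = {z : ℂ | IsUnit (A - algebraMap ℂ Op z) ∧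
      ‖Ring.inverse (A - algebraMap ℂ Op z) ^ 2 ^ N‖ ^ (1 / (2 : ℝ) ^ N) < 1 / ε} := by
    ext z
    simp only [pseudospectrum, Set.mem_compl_iff, Set.mem_ofPred_eq, not_or, not_not, not_le]
  have hsub : Continuous fun z : ℂ => A - algebraMap ℂ Op z :=
    continuous_const.sub (continuous_algebraMap ℂ Op)
  have hclosed : IsClosed (pseudospectrum N ε A) := by
    rw [← isOpen_compl_iff, hcompl, isOpen_iff_mem_nhds]
    rintro z ⟨hu, hz⟩
    have hunits : ∀ᶠ w in 𝓝 z, IsUnit (A - algebraMap ℂ Op w) :=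
      hsub.continuousAt.eventually (Units.isOpen.mem_nhds hu)
    have hinv : ContinuousAt (fun w : ℂ => Ring.inverse (A - algebraMap ℂ Op w)) z := by
      obtain ⟨u, hu'⟩ := hu
      have h := NormedRing.inverse_continuousAt u
      rw [hu'] at h
      exact ContinuousAt.comp (f := fun w : ℂ => A - algebraMap ℂ Op w) h hsub.continuousAt
    have hcont := ((hinv.pow (2 ^ N)).norm).rpow_const (p := 1 / (2 : ℝ) ^ N) (Or.inr hp.le)
    filter_upwards [hunits, hcont.eventually (gt_mem_nhds hz)] with w h1 h2 using ⟨h1, h2⟩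
  have hneg : ∀ z : ℂ, A - algebraMap ℂ Op z = -(algebraMap ℂ Op z - A) := fun z => by abel
  have hlim : Tendsto (fun z : ℂ =>
      ‖Ring.inverse (A - algebraMap ℂ Op z) ^ 2 ^ N‖ ^ (1 / (2 : ℝ) ^ N))
      (Bornology.cobounded ℂ) (𝓝 0) := by
    have h1 : Tendsto (fun z : ℂ => Ring.inverse (A - algebraMap ℂ Op z))
        (Bornology.cobounded ℂ) (𝓝 0) := by
      have h := (spectrum.resolvent_tendsto_cobounded (𝕜 := ℂ) A).neg
      rw [neg_zero] at h
      refine h.congr fun z => ?_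
      rw [hneg]
      by_cases hu : IsUnit (algebraMap ℂ Op z - A)
      · obtain ⟨u, hu'⟩ := hu
        rw [resolvent, ← hu', ← Units.val_neg, Ring.inverse_unit, Ring.inverse_unit, inv_neg,
          Units.val_neg]
      · rw [resolvent, Ring.inverse_non_unit _ hu, Ring.inverse_non_unit _ (fun h => hu (by simpa only [neg_neg] using h.neg)),
          neg_zero]
    have h2 := ((h1.pow (2 ^ N)).norm).rpow_const (p := 1 / (2 : ℝ) ^ N) (Or.inr hp.le)
    have h3 : ‖(0 : Op) ^ 2 ^ N‖ ^ (1 / (2 : ℝ) ^ N) = 0 := by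
      rw [zero_pow (by positivity), norm_zero, Real.zero_rpow hp.ne']
    rwa [h3] at h2
  have hunits : ∀ᶠ z in Bornology.cobounded ℂ, IsUnit (A - algebraMap ℂ Op z) := by
    filter_upwards [spectrum.eventually_isUnit_resolvent (𝕜 := ℂ) A] with z hz
    rw [hneg]
    exact (spectrum.isUnit_resolvent.mpr hz).neg
  refine Metric.isCompact_of_isClosed_isBounded hclosed ?_
  rw [Bornology.isBounded_def, hcompl]
  filter_upwards [hunits, hlim.eventually (gt_mem_nhds hε')] with w h1 h2 using ⟨h1, h2⟩

/-- The spectrum as a point of the space of nonempty compact subsets of `ℂ`, which carries the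
Hausdorff metric. -/
def specMap (A : Op) : TopologicalSpace.NonemptyCompacts ℂ :=
  ⟨⟨spectrum ℂ A, spectrum.isCompact A⟩, spectrum.nonempty A⟩

/-- The `(N, ε)`-pseudospectrum as a point of the space of nonempty compact subsets of `ℂ`. -/
def pseudospecMap (N : ℕ) {ε : ℝ} (hε : 0 < ε) (A : Op) : TopologicalSpace.NonemptyCompacts ℂ :=
  ⟨⟨pseudospectrum N ε A, isCompact_pseudospectrum N hε A⟩,
    (spectrum.nonempty A).mono (spectrum_subset_pseudospectrum N ε A)⟩

/-! ### The primary sets and the evaluation sets -/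

/-- All bounded operators. -/
def boundedOps : Set Op := Set.univ

/-- The bounded operators whose dispersion is bounded by `f`. -/
def dispersionOps (f : ℕ → ℕ) : Set Op := {A | DispersionBoundedBy f A}

/-- The compact operators. -/
def compactOps : Set Op := {A | IsCompactOperator A}

/-- The operators in `Ω` of norm at most `M`. -/
def normBounded (Ω : Set Op) (M : ℝ) : Set Op := {A | A ∈ Ω ∧ ‖A‖ ≤ M}

/-- The evaluations of the matrix entries `⟨A e_j, e_i⟩` (the inner product of Mathlib is linear in
its second argument). -/
def matrixEvals (Ω : Set Op) : Set (Ω → ℂ) :=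
  {φ | ∃ i j : ℕ, φ = fun A : Ω => inner ℂ (basisVec i) (A.1 (basisVec j))}

/-- The constant evaluations with the values of `f`. -/
def constEvals (Ω : Set Op) (f : ℕ → ℕ) : Set (Ω → ℂ) :=
  {φ | ∃ m : ℕ, φ = fun _ : Ω => (f m : ℂ)}

/-- The problem of computing `Ξ` on `Ω` from matrix entries. -/
def matrixProblem (Ω : Set Op) (Ξ : Op → TopologicalSpace.NonemptyCompacts ℂ) :
    ComputationalProblem Ω (TopologicalSpace.NonemptyCompacts ℂ) :=
  ⟨matrixEvals Ω, fun A => Ξ A.1⟩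

/-- The problem of computing `Ξ` on `Ω` from matrix entries when the values of `f` are known. -/
def matrixProblemWith (f : ℕ → ℕ) (Ω : Set Op)
    (Ξ : Op → TopologicalSpace.NonemptyCompacts ℂ) :
    ComputationalProblem Ω (TopologicalSpace.NonemptyCompacts ℂ) :=
  ⟨matrixEvals Ω ∪ constEvals Ω f, fun A => Ξ A.1⟩

end

end TowerSCI

open TowerSCI

namespace TowerSCI

/-! ### Towers and the index -/

/-! Upper bounds. On a Hilbert space the norm of a power of the resolvent has no local maximum
(`exists_norm_inverse_pow_gt`). So sp_{N,ε}(A) is the closure of the set of z at which (A - z)^(2^N)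
or its adjoint maps some unit vector to a vector of norm < ε^(2^N). Such strict inequalities survive
the passage to grid points z, rational vectors and large finite sections, and the squared norms
involved are polynomials in the matrix entries and their conjugates, so each test is an arithmetic
comparison. For general A the size of the sections goes to infinity before the grid is refined,
which costs two limits; a switch with hysteresis makes every test stabilise although the limit of
its values cannot be compared exactly. If the dispersion is bounded by f, a section whose size is
computed from f is uniformly accurate on the test vectors, and the two limits merge into one
(`norm_compression_pow_sub_le`). The spectrum is the limit of sp_{0,1/(k+1)}, at the price of one
more limit. For compact A the sections converge in norm, the nonzero spectral points are isolated
and 0 is always in the spectrum, so one limit is enough.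

Lower bounds. A general algorithm reads finitely many entries. Along a family of operators with
locally constant entries, indexed by 0-1 sequences or arrays, the lowest maps of a tower are
therefore continuous in the index, and a tower of height one or two writes the distance of a fixed
point from Ξ as a simple or iterated limit of continuous functions. By Baire's theorem a simple
limit cannot separate the eventually zero sequences from the others (`not_separated_of_tendsto`),
and an iterated limit cannot separate the arrays with all columns eventually zero from the others
(`not_separated_of_tendsto_tendsto`). Three families encode these questions: for sp_{N,ε} on all
operators, the selfadjoint operator with off-diagonal blocks V and V*, where V is an isometry that
is onto exactly for sequences with infinitely many ones; for sp on all operators, the triangular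
operator with diagonal blocks V and V* and a diagonal corner D whose weights 1/(k+1) depend on the
column k, so that 0 is spectral when V misses a basis vector in every column, but not when only
finitely many columns are incomplete; for sp with bounded dispersion, a direct sum of normalised
logarithmic Toeplitz blocks, nilpotent if finitely many are switched on and having the approximate
eigenvalue 1 otherwise. The value 0 of the index is excluded since finitely many entries do not
distinguish 0 from a small multiple of a far basis projection. -/

theorem IsTower.succ {Ω : Type*} {M : Type*} [PseudoMetricSpace M] {Alg : (Ω → M) → Prop}
    {Ξ : Ω → M} {k : ℕ} {Γ : List ℕ → Ω → M} (h : IsTower Alg Ξ k Γ) :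
    IsTower Alg Ξ (k + 1) fun l => Γ (l.take k) where
  top := by simpa using h.top
  lowest l hl := h.lowest _ (by simp [hl])
  limit l hl A := by
    rcases Nat.lt_succ_iff_lt_or_eq.1 hl with hl | hl
    · have : ∀ n, (l ++ [n]).take k = l ++ [n] := fun n => List.take_of_length_le (by simp; omega)
      simpa only [this, List.take_of_length_le hl.le] using h.limit l hl A
    · have : ∀ n, (l ++ [n]).take k = l.take k := fun n => List.take_append_of_le_length hl.ge
      simpa only [this] using tendsto_const_nhds

theorem IsTower.mono {Ω : Type*} {M : Type*} [PseudoMetricSpace M] {Alg : (Ω → M) → Prop}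
    {Ξ : Ω → M} {k j : ℕ} (hkj : k ≤ j) {Γ : List ℕ → Ω → M} (h : IsTower Alg Ξ k Γ) :
    ∃ Γ', IsTower Alg Ξ j Γ' := by
  induction j, hkj using Nat.le_induction with
  | base => exact ⟨Γ, h⟩
  | succ j _ ih => obtain ⟨Γ', h'⟩ := ih; exact ⟨_, h'.succ⟩

theorem IsTower.of_imp {Ω : Type*} {M : Type*} [PseudoMetricSpace M] {Alg Alg' : (Ω → M) → Prop}
    (himp : ∀ Γ, Alg Γ → Alg' Γ)
    {Ξ : Ω → M} {k : ℕ} {Γ : List ℕ → Ω → M} (h : IsTower Alg Ξ k Γ) : IsTower Alg' Ξ k Γ :=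
  ⟨h.top, fun l hl => himp _ (h.lowest l hl), h.limit⟩

/-- A tower can be lengthened by ignoring additional indices, so the absence of height `k` excludes
all smaller heights. As `1 ≤ k`, it also excludes the value 0, which presupposes a tower of height
one. -/
theorem solvabilityIndex_eq_of_no_tower {Ω : Type*} {M : Type*} [PseudoMetricSpace M]
    {Alg : (Ω → M) → Prop} {Ξ : Ω → M} {k : ℕ} (hk : 1 ≤ k)
    (hex : ∃ Γ, IsTower Alg Ξ (k + 1) Γ) (hno : ∀ Γ, ¬ IsTower Alg Ξ k Γ) :
    solvabilityIndex Alg Ξ = (k + 1 : ℕ) := by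
  have hlow : ∀ j ≤ k, ∀ Γ, ¬ IsTower Alg Ξ j Γ := fun j hj Γ h => by
    obtain ⟨Γ', h'⟩ := h.mono hj
    exact hno Γ' h'
  rw [solvabilityIndex, if_neg fun ⟨Γ, h, _⟩ => hlow 1 hk Γ h]
  apply le_antisymm
  · exact sInf_le ⟨k + 1, by omega, hex, rfl⟩
  · refine le_sInf ?_
    rintro _ ⟨j, _, ⟨Γ, h⟩, rfl⟩
    by_contra hlt
    have hlt : (j : ℕ∞) < (k + 1 : ℕ) := not_le.1 hlt
    exact hlow j (Nat.lt_succ_iff.1 (by exact_mod_cast hlt)) Γ h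

theorem solvabilityIndex_eq_one {Ω : Type*} {M : Type*} [PseudoMetricSpace M]
    {Alg : (Ω → M) → Prop} {Ξ : Ω → M}
    (hex : ∃ Γ, IsTower Alg Ξ 1 Γ) (hno : ¬ Alg Ξ) : solvabilityIndex Alg Ξ = 1 := by
  rw [solvabilityIndex, if_neg]
  · apply le_antisymm
    · exact sInf_le ⟨1, le_rfl, hex, rfl⟩
    · refine le_sInf ?_
      rintro _ ⟨j, hj, _, rfl⟩
      exact_mod_cast hj
  · rintro ⟨Γ, h, n, hn⟩
    exact hno (hn ▸ h.lowest [n] rfl)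

/-- Arithmetic algorithms are general, so an upper bound by arithmetic towers and a lower bound
against general ones settle both indices at once. -/
theorem sci_eq_of_no_tower {Ω : Type*}
    {P : ComputationalProblem Ω (TopologicalSpace.NonemptyCompacts ℂ)} {k : ℕ} (hk : 1 ≤ k)
    (hex : ∃ Γ, IsTower (IsArithmeticAlgorithm P.Λ) P.Ξ (k + 1) Γ)
    (hno : ∀ Γ, ¬ IsTower (IsGeneralAlgorithm P.Λ) P.Ξ k Γ) :
    SCIG P = (k + 1 : ℕ) ∧ SCIA P = (k + 1 : ℕ) := by
  have himp : ∀ Γ, IsArithmeticAlgorithm P.Λ Γ → IsGeneralAlgorithm P.Λ Γ := fun _ h => h.1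
  exact ⟨solvabilityIndex_eq_of_no_tower hk (hex.imp fun _ h => h.of_imp himp) hno,
    solvabilityIndex_eq_of_no_tower hk hex fun Γ h => hno Γ (h.of_imp himp)⟩

theorem sci_eq_one {Ω : Type*}
    {P : ComputationalProblem Ω (TopologicalSpace.NonemptyCompacts ℂ)}
    (hex : ∃ Γ, IsTower (IsArithmeticAlgorithm P.Λ) P.Ξ 1 Γ)
    (hno : ¬ IsGeneralAlgorithm P.Λ P.Ξ) :
    SCIG P = 1 ∧ SCIA P = 1 :=
  ⟨solvabilityIndex_eq_one (hex.imp fun _ h => h.of_imp fun _ h => h.1) hno,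
    solvabilityIndex_eq_one hex fun h => hno h.1⟩

/-! ### Computable functions of the input and arithmetic algorithms -/

section Computable

variable {Ω : Type*} {Λ : Set (Ω → ℂ)}

/-- The functions of the input that are given by an arithmetic term. -/
def TermComputable (Λ : Set (Ω → ℂ)) (g : Ω → ℂ) : Prop :=
  ∃ t : ArithTerm Λ, ∀ A, t.value A = g A

theorem TermComputable.of_mem {φ : Ω → ℂ} (h : φ ∈ Λ) : TermComputable Λ φ :=
  ⟨.eval ⟨φ, h⟩, fun _ => rfl⟩

theorem TermComputable.rat (q : ℚ) : TermComputable Λ fun _ => (q : ℂ) := ⟨.rat q, fun _ => rfl⟩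

theorem TermComputable.add {g h : Ω → ℂ} (hg : TermComputable Λ g) (hh : TermComputable Λ h) :
    TermComputable Λ fun A => g A + h A := by
  obtain ⟨s, hs⟩ := hg
  obtain ⟨t, ht⟩ := hh
  exact ⟨s.add t, fun A => by simp [ArithTerm.value, hs, ht]⟩

theorem TermComputable.sub {g h : Ω → ℂ} (hg : TermComputable Λ g) (hh : TermComputable Λ h) :
    TermComputable Λ fun A => g A - h A := by
  obtain ⟨s, hs⟩ := hg
  obtain ⟨t, ht⟩ := hh
  exact ⟨s.sub t, fun A => by simp [ArithTerm.value, hs, ht]⟩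

theorem TermComputable.mul {g h : Ω → ℂ} (hg : TermComputable Λ g) (hh : TermComputable Λ h) :
    TermComputable Λ fun A => g A * h A := by
  obtain ⟨s, hs⟩ := hg
  obtain ⟨t, ht⟩ := hh
  exact ⟨s.mul t, fun A => by simp [ArithTerm.value, hs, ht]⟩

theorem TermComputable.conj {g : Ω → ℂ} (hg : TermComputable Λ g) :
    TermComputable Λ fun A => (starRingEnd ℂ) (g A) := by
  obtain ⟨s, hs⟩ := hg
  refine ⟨.sub (.re s) (.mul (.im s) .imUnit), fun A => ?_⟩
  simp only [ArithTerm.value, hs]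
  apply Complex.ext <;> simp

theorem TermComputable.const {z : ℂ} (hz : ∃ p q : ℚ, z = p + q * Complex.I) :
    TermComputable Λ fun _ => z := by
  obtain ⟨p, q, rfl⟩ := hz
  exact (TermComputable.rat p).add ((TermComputable.rat q).mul ⟨.imUnit, fun _ => rfl⟩)

theorem TermComputable.sum {ι : Type*} (s : Finset ι) {g : ι → Ω → ℂ}
    (hg : ∀ i ∈ s, TermComputable Λ (g i)) : TermComputable Λ fun A => ∑ i ∈ s, g i A := by
  classical
  induction s using Finset.induction_on with
  | empty => simpa using TermComputable.rat (Λ := Λ) 0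
  | insert i s hi ih =>
    simp only [Finset.sum_insert hi]
    exact (hg i (by simp)).add (ih fun j hj => hg j (by simp [hj]))

/-- The evaluations that occur in a term. -/
def ArithTerm.evals : ArithTerm Λ → Set (Ω → ℂ)
  | .eval φ => {φ.1}
  | .rat _ => ∅
  | .imUnit => ∅
  | .add s t => s.evals ∪ t.evals
  | .sub s t => s.evals ∪ t.evals
  | .mul s t => s.evals ∪ t.evals
  | .div s t => s.evals ∪ t.evals
  | .re t => t.evals
  | .im t => t.evals

theorem ArithTerm.finite_evals (t : ArithTerm Λ) : t.evals.Finite := by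
  induction t <;> simp_all [ArithTerm.evals]

theorem ArithTerm.evals_subset (t : ArithTerm Λ) : t.evals ⊆ Λ := by
  induction t <;> simp_all [ArithTerm.evals]

theorem ArithTerm.value_congr (t : ArithTerm Λ) {A B : Ω} (h : ∀ φ ∈ t.evals, φ B = φ A) :
    t.value B = t.value A := by
  induction t <;>
    simp_all [ArithTerm.evals, ArithTerm.value, or_imp, forall_and]

/-- The list of the first `k` answers, latest first, of the comparisons with zero of the values of
the terms `t 0, t 1, …` at `A`. -/
noncomputable def answers (t : ℕ → ArithTerm Λ) (A : Ω) : ℕ → List Bool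
  | 0 => []
  | k + 1 => decide (((t k).value A).re > ((ArithTerm.rat (Λ := Λ) 0).value A).re) :: answers t A k

theorem length_answers (t : ℕ → ArithTerm Λ) (A : Ω) (k : ℕ) : (answers t A k).length = k := by
  induction k with
  | zero => rfl
  | succ k ih => simp [answers, ih]

theorem answers_inj {t : ℕ → ArithTerm Λ} {A B : Ω} {m : ℕ}
    (h : answers t A m = answers t B m) :
    ∀ k < m, 0 < ((t k).value A).re ↔ 0 < ((t k).value B).re := by
  induction m with
  | zero => simp
  | succ m ih =>
    simp only [answers, ArithTerm.value, List.cons.injEq] at h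
    intro k hk
    rcases Nat.lt_succ_iff_lt_or_eq.1 hk with hk | rfl
    · exact ih h.2 k hk
    · simpa using h.1

/-- The complex numbers with rational real and imaginary part. -/
def IsRatComplex (z : ℂ) : Prop := ∃ p q : ℚ, z = p + q * Complex.I

/-- The procedure asks for all signs in a fixed order. The list of answers determines `Γ A`, and
since its points are rational complex numbers the output can be stored as constant terms, one list
per list of answers. The evaluations occurring in the finitely many terms serve every input alike.
-/
theorem isArithmeticAlgorithm_of_signs {ι : Type*} (s : Finset ι) {u : ι → Ω → ℂ}
    (hu : ∀ i ∈ s, TermComputable Λ (u i)) {Γ : Ω → TopologicalSpace.NonemptyCompacts ℂ}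
    (hΓ : ∀ A B, (∀ i ∈ s, 0 < (u i A).re ↔ 0 < (u i B).re) → Γ A = Γ B)
    (hfin : ∀ A, (Γ A : Set ℂ).Finite) (hrat : ∀ A, ∀ z ∈ (Γ A : Set ℂ), IsRatComplex z) :
    IsArithmeticAlgorithm Λ Γ := by
  classical
  have hu' : ∀ i : s, ∃ t : ArithTerm Λ, ∀ A, t.value A = u i A := fun i => hu i i.2
  choose t ht using hu'
  let e := s.equivFin
  let m := s.card
  let T : ℕ → ArithTerm Λ := fun k => if h : k < m then t (e.symm ⟨k, h⟩) else .rat 0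
  have hT : ∀ i : s, T (e i) = t i := fun i => by
    have h : ((e i : Fin s.card) : ℕ) < m := (e i).2
    simp only [T, h, dif_pos, Fin.eta, Equiv.symm_apply_apply]
  have hansw : ∀ A B, answers T A m = answers T B m → Γ A = Γ B := fun A B h =>
    hΓ A B fun i hi => by
      have := answers_inj h (e ⟨i, hi⟩) (e ⟨i, hi⟩).2
      rwa [hT, ht, ht] at this
  have hL : ∀ A, ∃ L : List (ArithTerm Λ), ∀ B, (Γ A : Set ℂ) = {z | ∃ t ∈ L, t.value B = z} := by
    intro A
    have hc : ∀ z : (hfin A).toFinset, ∃ t : ArithTerm Λ, ∀ B, t.value B = z := fun z =>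
      TermComputable.const (hrat A z ((hfin A).mem_toFinset.1 z.2))
    choose c hc using hc
    refine ⟨(hfin A).toFinset.attach.toList.map c, fun B => ?_⟩
    ext z
    simp only [List.mem_map, Finset.mem_toList, Finset.mem_attach, true_and, Set.mem_ofPred_eq]
    constructor
    · exact fun hz => ⟨_, ⟨⟨z, (hfin A).mem_toFinset.2 hz⟩, rfl⟩, hc _ B⟩
    · rintro ⟨_, ⟨w, rfl⟩, rfl⟩
      rw [hc]
      exact (hfin A).mem_toFinset.1 w.2
  choose L hL using hL
  refine ⟨⟨fun _ => ⋃ i : s, (t i).evals, fun A => ⟨Set.finite_iUnion fun i => (t i).finite_evals,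
    Set.iUnion_subset fun i => (t i).evals_subset, fun B hB => ⟨?_, rfl⟩⟩⟩, ?_⟩
  · refine hΓ B A fun i hi => ?_
    rw [← ht ⟨i, hi⟩, ← ht ⟨i, hi⟩,
      (t ⟨i, hi⟩).value_congr fun φ hφ => hB φ (Set.mem_iUnion.2 ⟨_, hφ⟩)]
  -- A full list of answers is matched with an arbitrary input that produces it; lists that no input
  -- produces are irrelevant.
  · let S : List Bool → ArithStep Λ := fun h =>
      if h.length < m then .compare (T h.length) (.rat 0)
      else if hA : ∃ A, answers T A m = h then .output (L hA.choose) else .output []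
    refine ⟨S, fun A => ?_⟩
    have hex : ∃ B, answers T B m = answers T A m := ⟨A, rfl⟩
    refine ⟨L hex.choose, ?_, ?_⟩
    -- Induction on the number `j` of questions still to be asked, hence backwards from the halting
    -- state.
    · have hrun : ∀ j, j ≤ m → ArithRun S A (answers T A (m - j)) (L hex.choose) := by
        intro j
        induction j with
        | zero =>
          intro _
          refine .halt ?_
          simp only [S, Nat.sub_zero, length_answers, lt_irrefl, if_false]
          rw [dif_pos hex]
        | succ j ih =>
          intro hj
          refine .step (s := T (m - (j + 1))) (t := .rat 0) ?_ ?_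
          · simp only [S, length_answers]
            rw [if_pos (by omega)]
          · have h := ih (by omega)
            rwa [show m - j = m - (j + 1) + 1 by omega, answers] at h
      simpa [answers] using hrun m le_rfl
    · rw [← hansw _ _ hex.choose_spec]
      exact hL _ A

end Computable

/-! ### Convergence in the Hausdorff metric -/

/-- Compactness turns the two pointwise conditions into uniform ones: the lower condition is covered
on `K`, the upper one on the part of the ball of radius `R` outside the open `δ / 2`-neighbourhood
of `K`. -/
theorem tendsto_nonemptyCompacts {K : TopologicalSpace.NonemptyCompacts ℂ}
    {L : ℕ → TopologicalSpace.NonemptyCompacts ℂ} {R : ℝ}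
    (hbdd : ∀ᶠ n in atTop, ∀ w ∈ L n, ‖w‖ ≤ R)
    (hlow : ∀ z ∈ K, ∀ δ > 0, ∀ᶠ n in atTop, ∃ w ∈ L n, dist w z < δ)
    (hupp : ∀ z ∉ K, ∃ ρ > 0, ∀ᶠ n in atTop, ∀ w ∈ L n, ρ ≤ dist w z) :
    Tendsto L atTop (𝓝 K) := by
  rw [Metric.tendsto_nhds]
  intro δ hδ
  have h1 : ∀ᶠ n in atTop, ∀ z ∈ (K : Set ℂ), ∃ w ∈ (L n : Set ℂ), dist z w ≤ δ / 2 := by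
    refine K.isCompact.induction_on (p := fun s => ∀ᶠ n in atTop, ∀ z ∈ s,
      ∃ w ∈ (L n : Set ℂ), dist z w ≤ δ / 2) (by simp) ?_ ?_ ?_
    · exact fun s t hst h => h.mono fun n hn z hz => hn z (hst hz)
    · intro s t hs ht
      filter_upwards [hs, ht] with n h1 h2 z hz
      exact hz.elim (h1 z) (h2 z)
    · intro z hz
      refine ⟨Metric.ball z (δ / 4), mem_nhdsWithin_of_mem_nhds
        (Metric.ball_mem_nhds _ (by positivity)), ?_⟩
      filter_upwards [hlow z hz (δ / 4) (by positivity)] with n ⟨w, hw, hwz⟩ y hy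
      refine ⟨w, hw, (dist_triangle y z w).trans ?_⟩
      rw [dist_comm z w]
      have := Metric.mem_ball.1 hy
      linarith
  have h2 : ∀ᶠ n in atTop, ∀ w ∈ (L n : Set ℂ), ∃ z ∈ (K : Set ℂ), dist w z ≤ δ / 2 := by
    have hC : IsCompact (Metric.closedBall (0 : ℂ) R \ Metric.thickening (δ / 2) (K : Set ℂ)) :=
      (isCompact_closedBall _ _).diff Metric.isOpen_thickening
    have h3 : ∀ᶠ n in atTop, ∀ w ∈ Metric.closedBall (0 : ℂ) R \
        Metric.thickening (δ / 2) (K : Set ℂ), w ∉ (L n : Set ℂ) := by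
      refine hC.induction_on (p := fun s => ∀ᶠ n in atTop, ∀ w ∈ s, w ∉ (L n : Set ℂ))
        (by simp) ?_ ?_ ?_
      · exact fun s t hst h => h.mono fun n hn z hz => hn z (hst hz)
      · intro s t hs ht
        filter_upwards [hs, ht] with n h1 h2 z hz
        exact hz.elim (h1 z) (h2 z)
      · intro z hz
        have hzK : z ∉ K := fun h => hz.2 (Metric.self_subset_thickening (by positivity) _ h)
        obtain ⟨ρ, hρ, h⟩ := hupp z hzK
        refine ⟨Metric.ball z ρ, mem_nhdsWithin_of_mem_nhds (Metric.ball_mem_nhds _ hρ), ?_⟩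
        filter_upwards [h] with n hn w hw hwL
        exact absurd (Metric.mem_ball.1 hw) (not_lt.2 (hn w hwL))
    filter_upwards [h3, hbdd] with n hn hb w hw
    by_contra hcon
    push Not at hcon
    refine hn w ⟨by simpa using hb w hw, fun hth => ?_⟩ hw
    obtain ⟨z, hz, hwz⟩ := Metric.mem_thickening_iff.1 hth
    exact absurd hwz (not_lt.2 (hcon z hz).le)
  filter_upwards [h1, h2] with n h1 h2
  rw [Metric.NonemptyCompacts.dist_eq]
  exact (Metric.hausdorffDist_le_of_mem_dist (by positivity) h2 h1).trans_lt (by linarith)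

/-! ### Invertibility and the norm of the resolvent in a Hilbert space -/

section Hilbert

variable {E : Type*} [NormedAddCommGroup E] [InnerProductSpace ℂ E]

/-- The mean of ‖a + w b + w² d‖² over w = ±r, ±ir equals ‖a‖² + r²‖b‖² + r⁴‖d‖², because the
exponents 0, 1, 2 differ modulo 4. The last term is dropped. Here the Hilbert space norm is
essential. -/
theorem norm_four_points (a b d : E) (r : ℝ) {K : ℝ}
    (h : ∀ w : ℂ, ‖w‖ = |r| → ‖a + w • b + w ^ 2 • d‖ ≤ K) :
    ‖a‖ ^ 2 + r ^ 2 * ‖b‖ ^ 2 ≤ K ^ 2 := by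
  have h1 := h r (by simp)
  have h2 := h (-r) (by simp)
  have h3 := h (Complex.I * r) (by simp)
  have h4 := h (-(Complex.I * r)) (by simp)
  have p1 := parallelogram_law_with_norm ℂ (a + (r ^ 2 : ℂ) • d) ((r : ℂ) • b)
  have p2 := parallelogram_law_with_norm ℂ (a - (r ^ 2 : ℂ) • d) ((Complex.I * r : ℂ) • b)
  have p3 := parallelogram_law_with_norm ℂ a ((r ^ 2 : ℂ) • d)
  have e1 : a + (r ^ 2 : ℂ) • d + (r : ℂ) • b = a + (r : ℂ) • b + (r : ℂ) ^ 2 • d := by abel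
  have e2 : a + (r ^ 2 : ℂ) • d - (r : ℂ) • b = a + (-r : ℂ) • b + (-r : ℂ) ^ 2 • d := by
    rw [neg_sq, neg_smul]; abel
  have e3 : a - (r ^ 2 : ℂ) • d + (Complex.I * r : ℂ) • b =
      a + (Complex.I * r : ℂ) • b + (Complex.I * r : ℂ) ^ 2 • d := by
    rw [mul_pow, Complex.I_sq, neg_one_mul, neg_smul]; abel
  have e4 : a - (r ^ 2 : ℂ) • d - (Complex.I * r : ℂ) • b =
      a + (-(Complex.I * r) : ℂ) • b + (-(Complex.I * r) : ℂ) ^ 2 • d := by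
    rw [neg_sq, mul_pow, Complex.I_sq, neg_one_mul, neg_smul, neg_smul]; abel
  rw [e1, e2] at p1
  rw [e3, e4] at p2
  have n1 : ‖(r : ℂ) • b‖ ^ 2 = r ^ 2 * ‖b‖ ^ 2 := by
    rw [norm_smul, mul_pow]; simp
  have n2 : ‖(Complex.I * r : ℂ) • b‖ ^ 2 = r ^ 2 * ‖b‖ ^ 2 := by
    rw [norm_smul, mul_pow]; simp
  rw [n1] at p1
  rw [n2] at p2
  have q1 := pow_le_pow_left₀ (norm_nonneg _) h1 2
  have q2 := pow_le_pow_left₀ (norm_nonneg _) h2 2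
  have q3 := pow_le_pow_left₀ (norm_nonneg _) h3 2
  have q4 := pow_le_pow_left₀ (norm_nonneg _) h4 2
  have := sq_nonneg ‖(r ^ 2 : ℂ) • d‖
  linarith

theorem resolvent_eq_neg_inverse (A : E →L[ℂ] E) (z : ℂ) :
    resolvent A z = -Ring.inverse (A - algebraMap ℂ (E →L[ℂ] E) z) := by
  have hneg : algebraMap ℂ (E →L[ℂ] E) z - A = -(A - algebraMap ℂ (E →L[ℂ] E) z) := by abel
  rw [resolvent, hneg]
  by_cases hu : IsUnit (A - algebraMap ℂ (E →L[ℂ] E) z)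
  · obtain ⟨u, hu'⟩ := hu
    rw [← hu', ← Units.val_neg, Ring.inverse_unit, Ring.inverse_unit, inv_neg, Units.val_neg]
  · rw [Ring.inverse_non_unit _ hu, Ring.inverse_non_unit _ (fun h => hu (by simpa using h.neg)),
      neg_zero]

theorem norm_resolvent_pow (A : E →L[ℂ] E) (z : ℂ) (n : ℕ) :
    ‖resolvent A z ^ n‖ = ‖Ring.inverse (A - algebraMap ℂ (E →L[ℂ] E) z) ^ n‖ := by
  rw [resolvent_eq_neg_inverse, neg_pow]
  rcases neg_one_pow_eq_or (E →L[ℂ] E) n with h | h <;> simp [h]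

theorem isUnit_sub_algebraMap_iff {A : E →L[ℂ] E} {z : ℂ} :
    IsUnit (A - algebraMap ℂ (E →L[ℂ] E) z) ↔ z ∈ resolventSet ℂ A := by
  rw [spectrum.mem_resolventSet_iff, IsUnit.sub_iff]

variable [CompleteSpace E]

theorem isUnit_of_bounded_below {T : E →L[ℂ] E} {c : ℝ} (hc : 0 < c)
    (h1 : ∀ x, c * ‖x‖ ≤ ‖T x‖) (h2 : ∀ x, c * ‖x‖ ≤ ‖ContinuousLinearMap.adjoint T x‖) :
    IsUnit T := by
  rw [ContinuousLinearMap.isUnit_iff_bijective,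
    ContinuousLinearMap.bijective_iff_dense_range_and_antilipschitz]
  constructor
  · rw [Submodule.topologicalClosure_eq_top_iff, ContinuousLinearMap.orthogonal_range,
      eq_bot_iff]
    intro x hx
    have hx : ContinuousLinearMap.adjoint T x = 0 := hx
    have := h2 x
    rw [hx, norm_zero] at this
    have h3 : ‖x‖ ≤ 0 := by
      by_contra hlt
      push Not at hlt
      nlinarith
    simpa using h3
  · refine ⟨c⁻¹.toNNReal, ?_⟩
    apply AddMonoidHomClass.antilipschitz_of_bound T
    intro x
    rw [Real.coe_toNNReal _ (by positivity), inv_mul_eq_div, le_div_iff₀ hc, mul_comm]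
    exact h1 x

theorem exists_norm_lt_of_not_isUnit {T : E →L[ℂ] E} (hT : ¬ IsUnit T) {c : ℝ} (hc : 0 < c) :
    ∃ x, ‖T x‖ < c * ‖x‖ ∨ ‖ContinuousLinearMap.adjoint T x‖ < c * ‖x‖ := by
  by_contra hcon
  push Not at hcon
  exact hT (isUnit_of_bounded_below hc (fun x => (hcon x).1) fun x => (hcon x).2)

/-- An analytic operator function whose derivative is bounded below has no local maximum of the
norm. -/
theorem exists_norm_gt_of_hasDerivAt [Nontrivial E] {F : ℂ → E →L[ℂ] E} {z₀ : ℂ}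
    (hF : AnalyticAt ℂ F z₀)
    {F' : E →L[ℂ] E} (hF' : HasDerivAt F F' z₀) {κ : ℝ} (hκ : 0 < κ)
    (hbelow : ∀ x, κ * ‖x‖ ≤ ‖F' x‖) {ρ : ℝ} (hρ : 0 < ρ) :
    ∃ z, dist z z₀ < ρ ∧ ‖F z₀‖ < ‖F z‖ := by
  by_contra hcon
  push Not at hcon
  set M := ‖F z₀‖ with hM
  obtain ⟨p, hp⟩ := hF
  obtain ⟨C, hC⟩ := (hp.isBigO_sub_partialSum_pow 3).bound
  obtain ⟨r₀, hr₀, hball⟩ := Metric.eventually_nhds_iff.1 hC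
  set a := F z₀
  set d := p.coeff 2
  have hsum : ∀ w : ℂ, p.partialSum 3 w = a + w • F' + w ^ 2 • d := by
    intro w
    have h1 : p.coeff 1 = F' := hp.hasDerivAt.unique hF'
    have h0 : p.coeff 0 = a := hp.coeff_zero _
    simp only [FormalMultilinearSeries.partialSum, Finset.sum_range_succ, Finset.sum_range_zero,
      FormalMultilinearSeries.apply_eq_pow_smul_coeff, zero_add, pow_zero, one_smul, pow_one, h1,
      h0, d]
  -- The second Taylor polynomial misses `F` by at most C r³ on the circle of radius r, so at the
  -- four points its norm is at most M + C r³. A bound on ‖F(z₀)x‖ for all x follows which, compared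
  -- with M itself, leaves no room for the derivative.
  have hineq : ∀ r : ℝ, 0 < r → r < min ρ r₀ → r ^ 2 * κ ^ 2 ≤ 2 * M * C * r ^ 3 + C ^ 2 * r ^ 6 := by
    intro r hr hrmin
    have hbd : ∀ w : ℂ, ‖w‖ = |r| → ‖a + w • F' + w ^ 2 • d‖ ≤ M + C * r ^ 3 := by
      intro w hw
      rw [abs_of_pos hr] at hw
      have h1 := hball (y := w) (by rw [dist_zero_right, hw]; exact hrmin.trans_le (min_le_right _ _))
      have h2 := hcon (z₀ + w) (by simpa [hw] using hrmin.trans_le (min_le_left _ _))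
      rw [hsum, hw, norm_pow, Real.norm_of_nonneg hr.le] at h1
      rw [← norm_neg] at h1
      calc _ = ‖F (z₀ + w) + -(F (z₀ + w) - (a + w • F' + w ^ 2 • d))‖ := by congr 1; abel
        _ ≤ _ := (norm_add_le _ _).trans (add_le_add h2 h1)
    set K := M + C * r ^ 3
    have hvec : ∀ x : E, ‖a x‖ ^ 2 + r ^ 2 * (κ * ‖x‖) ^ 2 ≤ (K * ‖x‖) ^ 2 := by
      intro x
      have := norm_four_points (a x) (F' x) (d x) r (K := K * ‖x‖) fun w hw => by
        have := (a + w • F' + w ^ 2 • d).le_of_opNorm_le (hbd w hw) x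
        simpa using this
      refine le_trans ?_ this
      have := hbelow x
      gcongr
    have hS : 0 ≤ K ^ 2 - r ^ 2 * κ ^ 2 := by
      obtain ⟨x, hx⟩ := exists_ne (0 : E)
      have hx' : 0 < ‖x‖ ^ 2 := by positivity
      have h := hvec x
      have h0 := sq_nonneg ‖a x‖
      by_contra hneg
      push Not at hneg
      nlinarith
    have hMle : M ≤ √(K ^ 2 - r ^ 2 * κ ^ 2) := by
      refine a.opNorm_le_bound (Real.sqrt_nonneg _) fun x => ?_
      rw [← Real.sqrt_sq (norm_nonneg x), ← Real.sqrt_mul hS]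
      apply Real.le_sqrt_of_sq_le
      have := hvec x
      nlinarith
    have h2 := (Real.le_sqrt (norm_nonneg _) hS).1 hMle
    simp only [K] at h2
    nlinarith
  -- After division by r² the right-hand side vanishes as r → 0, which contradicts κ > 0.
  have hlim : Tendsto (fun r : ℝ => 2 * M * C * r + C ^ 2 * r ^ 4) (𝓝[>] 0) (𝓝 0) := by
    have : Continuous fun r : ℝ => 2 * M * C * r + C ^ 2 * r ^ 4 := by fun_prop
    have h := this.tendsto 0
    simp only [mul_zero, zero_pow (four_ne_zero), add_zero] at h
    exact h.mono_left nhdsWithin_le_nhds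
  have hev : ∀ᶠ r : ℝ in 𝓝[>] 0, κ ^ 2 ≤ 2 * M * C * r + C ^ 2 * r ^ 4 := by
    have hm : 0 < min ρ r₀ := lt_min hρ hr₀
    filter_upwards [Ioo_mem_nhdsGT hm] with r hr
    have h := hineq r hr.1 hr.2
    have h' : r ^ 2 * κ ^ 2 ≤ r ^ 2 * (2 * M * C * r + C ^ 2 * r ^ 4) := by
      calc _ ≤ _ := h
        _ = _ := by ring
    exact le_of_mul_le_mul_left h' (by have := hr.1; positivity)
  have := ge_of_tendsto hlim hev
  have : 0 < κ ^ 2 := by positivity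
  linarith

theorem hasDerivAt_resolvent_pow {A : E →L[ℂ] E} {z : ℂ} (hz : z ∈ resolventSet ℂ A) (n : ℕ) :
    HasDerivAt (fun w => resolvent A w ^ n) (-(n : ℂ) • resolvent A z ^ (n + 1)) z := by
  induction n with
  | zero => simpa using hasDerivAt_const z (1 : E →L[ℂ] E)
  | succ n ih =>
    have h := ih.fun_mul (spectrum.hasDerivAt_resolvent_const_left hz)
    simp only [pow_succ] at h ⊢
    refine h.congr_deriv ?_
    push_cast
    simp only [smul_mul_assoc, neg_mul, mul_neg, pow_zero, one_mul, neg_add, add_smul, neg_smul,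
      one_smul, mul_assoc]

/-- The derivative of R(z)^n is -n R(z)^(n+1), an invertible operator because n ≠ 0, hence bounded
below; so the norm has no local maximum at z₀. -/
theorem exists_norm_inverse_pow_gt [Nontrivial E] {A : E →L[ℂ] E} {z₀ : ℂ}
    (hz₀ : IsUnit (A - algebraMap ℂ (E →L[ℂ] E) z₀)) {n : ℕ} (hn : n ≠ 0) {ρ : ℝ} (hρ : 0 < ρ) :
    ∃ z, dist z z₀ < ρ ∧ IsUnit (A - algebraMap ℂ (E →L[ℂ] E) z) ∧
      ‖Ring.inverse (A - algebraMap ℂ (E →L[ℂ] E) z₀) ^ n‖ <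
        ‖Ring.inverse (A - algebraMap ℂ (E →L[ℂ] E) z) ^ n‖ := by
  have hz₀' := isUnit_sub_algebraMap_iff.1 hz₀
  have hmem := (spectrum.isOpen_resolventSet A).mem_nhds hz₀'
  obtain ⟨ρ', hρ', hsub⟩ := Metric.mem_nhds_iff.1 hmem
  have han : AnalyticAt ℂ (fun w => resolvent A w ^ n) z₀ := by
    refine DifferentiableOn.analyticAt (s := resolventSet ℂ A) (fun w hw => ?_) hmem
    exact (hasDerivAt_resolvent_pow hw n).differentiableAt.differentiableWithinAt
  have hunit : IsUnit (resolvent A z₀ ^ (n + 1)) := (spectrum.isUnit_resolvent.1 hz₀').pow _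
  obtain ⟨u, hu⟩ := hunit
  have hupos : 0 < ‖((u⁻¹ : (E →L[ℂ] E)ˣ) : E →L[ℂ] E)‖ := Units.norm_pos _
  obtain ⟨z, hz, hlt⟩ := exists_norm_gt_of_hasDerivAt han (hasDerivAt_resolvent_pow hz₀' n)
    (κ := n * ‖((u⁻¹ : (E →L[ℂ] E)ˣ) : E →L[ℂ] E)‖⁻¹) (by positivity) (fun x => by
      have h1 : ‖x‖ ≤ ‖((u⁻¹ : (E →L[ℂ] E)ˣ) : E →L[ℂ] E)‖ * ‖(u : E →L[ℂ] E) x‖ := by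
        calc ‖x‖ = ‖((u⁻¹ : (E →L[ℂ] E)ˣ) : E →L[ℂ] E) ((u : E →L[ℂ] E) x)‖ := by
              rw [← mul_apply_eq_comp, Units.inv_mul, one_apply_eq_self]
          _ ≤ _ := ContinuousLinearMap.le_opNorm _ _
      rw [← hu, smul_apply, norm_smul, norm_neg, Complex.norm_natCast, mul_assoc,
        inv_mul_eq_div]
      gcongr
      rwa [div_le_iff₀' hupos]) (lt_min hρ hρ')
  refine ⟨z, hz.trans_le (min_le_left _ _), isUnit_sub_algebraMap_iff.2
    (hsub (hz.trans_le (min_le_right _ _))), ?_⟩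
  simpa only [norm_resolvent_pow] using hlt

end Hilbert

/-! ### Pseudospectra -/

theorem mem_pseudospectrum_iff {N : ℕ} {ε : ℝ} (hε : 0 < ε) {A : Op} {z : ℂ} :
    z ∈ pseudospectrum N ε A ↔ ¬ IsUnit (A - algebraMap ℂ Op z) ∨
      (1 / ε) ^ 2 ^ N ≤ ‖Ring.inverse (A - algebraMap ℂ Op z) ^ 2 ^ N‖ := by
  have h := Real.le_rpow_inv_iff_of_pos (x := 1 / ε)
    (y := ‖Ring.inverse (A - algebraMap ℂ Op z) ^ 2 ^ N‖) (z := ((2 ^ N : ℕ) : ℝ))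
    (by positivity) (norm_nonneg _) (by positivity)
  rw [Real.rpow_natCast] at h
  rw [← h, pseudospectrum, Set.mem_ofPred_eq, one_div (2 ^ N : ℝ)]
  push_cast
  rfl

theorem not_mem_pseudospectrum_iff {N : ℕ} {ε : ℝ} (hε : 0 < ε) {A : Op} {z : ℂ} :
    z ∉ pseudospectrum N ε A ↔ IsUnit (A - algebraMap ℂ Op z) ∧
      ‖Ring.inverse (A - algebraMap ℂ Op z) ^ 2 ^ N‖ < (1 / ε) ^ 2 ^ N := by
  rw [mem_pseudospectrum_iff hε, not_or, not_not, not_le]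

theorem inverse_pow_mul_pow {R : Type*} [Ring R] {T : R} (hT : IsUnit T) (n : ℕ) :
    Ring.inverse T ^ n * T ^ n = 1 ∧ T ^ n * Ring.inverse T ^ n = 1 := by
  have hc : Commute (Ring.inverse T) T := by
    rw [Commute, SemiconjBy, Ring.mul_inverse_cancel _ hT, Ring.inverse_mul_cancel _ hT]
  rw [← hc.mul_pow, ← hc.symm.mul_pow, Ring.mul_inverse_cancel _ hT, Ring.inverse_mul_cancel _ hT,
    one_pow]
  exact ⟨rfl, rfl⟩

theorem norm_le_inverse_pow {T : Op} (hT : IsUnit T) (n : ℕ) (x : L2) :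
    ‖x‖ ≤ ‖Ring.inverse T ^ n‖ * ‖(T ^ n) x‖ := by
  calc ‖x‖ = ‖(Ring.inverse T ^ n) ((T ^ n) x)‖ := by
        rw [← mul_apply_eq_comp, (inverse_pow_mul_pow hT n).1, one_apply_eq_self]
    _ ≤ _ := ContinuousLinearMap.le_opNorm _ _

theorem norm_le_adjoint_inverse_pow {T : Op} (hT : IsUnit T) (n : ℕ) (x : L2) :
    ‖x‖ ≤ ‖Ring.inverse T ^ n‖ * ‖ContinuousLinearMap.adjoint (T ^ n) x‖ := by
  rw [← norm_star (Ring.inverse T ^ n), ← ContinuousLinearMap.star_eq_adjoint]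
  calc ‖x‖ = ‖star (Ring.inverse T ^ n) (star (T ^ n) x)‖ := by
        rw [← mul_apply_eq_comp, ← star_mul, (inverse_pow_mul_pow hT n).2, star_one,
          one_apply_eq_self]
    _ ≤ _ := ContinuousLinearMap.le_opNorm _ _

/-- Invertibility and a strict bound on the norm of the inverse power are open conditions. A number
k strictly between this norm and (1/ε)^(2^N) bounds the norm near z₀, and 1/k exceeds ε^(2^N) by the
δ of the conclusion. -/
theorem exists_nhds_bounded_below_of_not_mem_pseudospectrum {N : ℕ} {ε : ℝ} (hε : 0 < ε) {A : Op}
    {z₀ : ℂ} (hz₀ : z₀ ∉ pseudospectrum N ε A) :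
    ∃ ρ > 0, ∃ δ > 0, ∀ z, dist z z₀ < ρ → ∀ x : L2,
      (ε ^ 2 ^ N + δ) * ‖x‖ ≤ ‖((A - algebraMap ℂ Op z) ^ 2 ^ N) x‖ ∧
      (ε ^ 2 ^ N + δ) * ‖x‖ ≤ ‖ContinuousLinearMap.adjoint ((A - algebraMap ℂ Op z) ^ 2 ^ N) x‖ := by
  obtain ⟨hu, hlt⟩ := (not_mem_pseudospectrum_iff hε).1 hz₀
  obtain ⟨k, hk1, hk2⟩ := exists_between hlt
  have hk : 0 < k := (norm_nonneg _).trans_lt hk1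
  have hsub : Continuous fun z : ℂ => A - algebraMap ℂ Op z :=
    continuous_const.sub (continuous_algebraMap ℂ Op)
  have hunits : ∀ᶠ w in 𝓝 z₀, IsUnit (A - algebraMap ℂ Op w) :=
    hsub.continuousAt.eventually (Units.isOpen.mem_nhds hu)
  have hinv : ContinuousAt (fun w : ℂ => Ring.inverse (A - algebraMap ℂ Op w)) z₀ := by
    obtain ⟨u, hu'⟩ := hu
    have h := NormedRing.inverse_continuousAt u
    rw [hu'] at h
    exact ContinuousAt.comp (f := fun w : ℂ => A - algebraMap ℂ Op w) h hsub.continuousAt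
  have hcont := (hinv.pow (2 ^ N)).norm
  obtain ⟨ρ, hρ, hball⟩ := Metric.eventually_nhds_iff.1
    (hunits.and (hcont.eventually (gt_mem_nhds hk1)))
  have hεk : ε ^ 2 ^ N < 1 / k := by
    rw [lt_div_iff₀ hk]
    calc _ < ε ^ 2 ^ N * (1 / ε) ^ 2 ^ N := by gcongr
      _ = 1 := by rw [← mul_pow, mul_one_div_cancel hε.ne', one_pow]
  refine ⟨ρ, hρ, 1 / k - ε ^ 2 ^ N, sub_pos.2 hεk, fun z hz x => ?_⟩
  obtain ⟨h1, h2⟩ := hball hz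
  rw [add_sub_cancel, one_div, inv_mul_eq_div, div_le_iff₀' hk, div_le_iff₀' hk]
  constructor
  · exact (norm_le_inverse_pow h1 _ x).trans (by gcongr; exact h2.le)
  · exact (norm_le_adjoint_inverse_pow h1 _ x).trans (by gcongr; exact h2.le)

/-- Membership is a non-strict inequality, which finite tests cannot confirm. Moving z₀ slightly
makes it strict, since the norm of the inverse power has no local maximum. At a spectral point no
move is needed: the power or its adjoint is not bounded below. -/
theorem exists_norm_lt_near_pseudospectrum {N : ℕ} {ε : ℝ} (hε : 0 < ε) {A : Op}
    {z₀ : ℂ} (hz₀ : z₀ ∈ pseudospectrum N ε A) {δ : ℝ} (hδ : 0 < δ) :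
    ∃ z, dist z z₀ < δ ∧ ∃ x : L2,
      ‖((A - algebraMap ℂ Op z) ^ 2 ^ N) x‖ < ε ^ 2 ^ N * ‖x‖ ∨
      ‖ContinuousLinearMap.adjoint ((A - algebraMap ℂ Op z) ^ 2 ^ N) x‖ < ε ^ 2 ^ N * ‖x‖ := by
  have hn : 2 ^ N ≠ 0 := by positivity
  by_cases hu : IsUnit (A - algebraMap ℂ Op z₀)
  · have hle := ((mem_pseudospectrum_iff hε).1 hz₀).resolve_left (not_not.2 hu)
    obtain ⟨z, hz, hu', hlt⟩ := exists_norm_inverse_pow_gt hu hn hδ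
    refine ⟨z, hz, ?_⟩
    set R := Ring.inverse (A - algebraMap ℂ Op z) ^ 2 ^ N with hR
    have hgt : (1 / ε) ^ 2 ^ N < ‖R‖ := hle.trans_lt hlt
    have hex : ∃ y, (1 / ε) ^ 2 ^ N * ‖y‖ < ‖R y‖ := by
      by_contra hcon
      push Not at hcon
      exact absurd (R.opNorm_le_bound (by positivity) hcon) (not_le.2 hgt)
    obtain ⟨y, hy⟩ := hex
    refine ⟨R y, Or.inl ?_⟩
    have h : (A - algebraMap ℂ Op z) ^ 2 ^ N * R = 1 := (inverse_pow_mul_pow hu' _).2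
    rw [← mul_apply_eq_comp, h, one_apply_eq_self]
    calc ‖y‖ = ε ^ 2 ^ N * ((1 / ε) ^ 2 ^ N * ‖y‖) := by
          rw [← mul_assoc, ← mul_pow, mul_one_div_cancel hε.ne', one_pow, one_mul]
      _ < _ := by gcongr
  · refine ⟨z₀, by simpa using hδ, exists_norm_lt_of_not_isUnit ?_ (by positivity)⟩
    rwa [isUnit_pow_iff hn]

/-- Since ‖R^n‖ ≤ ‖R‖^n, a lower bound for A - z alone handles every N. -/
theorem not_mem_pseudospectrum_of_bounded_below {N : ℕ} {ε : ℝ} (hε : 0 < ε) {A : Op} {z : ℂ}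
    (hu : IsUnit (A - algebraMap ℂ Op z)) {c : ℝ} (hc : ε < c)
    (hbelow : ∀ x : L2, c * ‖x‖ ≤ ‖(A - algebraMap ℂ Op z) x‖) :
    z ∉ pseudospectrum N ε A := by
  have hc0 : 0 < c := hε.trans hc
  rw [not_mem_pseudospectrum_iff hε]
  refine ⟨hu, ?_⟩
  have h1 : ‖Ring.inverse (A - algebraMap ℂ Op z)‖ ≤ 1 / c := by
    refine ContinuousLinearMap.opNorm_le_bound _ (by positivity) fun y => ?_
    have := hbelow (Ring.inverse (A - algebraMap ℂ Op z) y)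
    rw [← mul_apply_eq_comp, Ring.mul_inverse_cancel _ hu, one_apply_eq_self] at this
    rw [one_div, inv_mul_eq_div, le_div_iff₀' hc0]
    exact this
  calc _ ≤ ‖Ring.inverse (A - algebraMap ℂ Op z)‖ ^ 2 ^ N := norm_pow_le _ _
    _ ≤ (1 / c) ^ 2 ^ N := by gcongr
    _ < _ := by gcongr

theorem mem_pseudospectrum_of_eigenvector {N : ℕ} {ε : ℝ} (hε : 0 < ε) {A : Op} {z μ : ℂ} {x : L2}
    (hx : x ≠ 0) (hAx : A x = μ • x) (hz : ‖μ - z‖ ≤ ε) : z ∈ pseudospectrum N ε A := by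
  by_contra hcon
  obtain ⟨ρ, hρ, δ, hδ, h⟩ := exists_nhds_bounded_below_of_not_mem_pseudospectrum hε hcon
  have h1 := (h z (by simpa using hρ) x).1
  have h2 : ∀ n, ((A - algebraMap ℂ Op z) ^ n) x = (μ - z) ^ n • x := by
    intro n
    induction n with
    | zero => simp
    | succ n ih =>
      rw [pow_succ', mul_apply_eq_comp, ih, map_smul, sub_apply, hAx,
        Algebra.algebraMap_eq_smul_one, smul_apply, one_apply_eq_self, ← sub_smul, smul_smul,
        pow_succ]
  rw [h2, norm_smul, norm_pow] at h1
  have h3 : ‖μ - z‖ ^ 2 ^ N ≤ ε ^ 2 ^ N := by gcongr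
  have hx' : 0 < ‖x‖ := norm_pos_iff.2 hx
  nlinarith

/-- The sets decrease to the spectrum. At a point of the resolvent set, 1/ε eventually exceeds the
norm of the resolvent, and the complement of that pseudospectrum is open. -/
theorem tendsto_pseudospecMap_specMap (A : Op) :
    Tendsto (fun k : ℕ => pseudospecMap 0 (ε := 1 / ((k : ℝ) + 1)) (by positivity) A) atTop
      (𝓝 (specMap A)) := by
  obtain ⟨R, hR⟩ := (isCompact_pseudospectrum 0 one_pos A).isBounded.subset_closedBall 0
  have hmono : ∀ k : ℕ, pseudospectrum 0 (1 / ((k : ℝ) + 1)) A ⊆ pseudospectrum 0 1 A := by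
    intro k z hz
    rw [mem_pseudospectrum_iff (by positivity)] at hz ⊢
    refine hz.imp id fun h => le_trans ?_ h
    simp
  refine tendsto_nonemptyCompacts (R := R) ?_ ?_ ?_
  · exact .of_forall fun k w hw => by simpa using hR (hmono k hw)
  · exact fun z hz δ hδ => .of_forall fun k =>
      ⟨z, spectrum_subset_pseudospectrum _ _ _ hz, by simpa using hδ⟩
  · intro z hz
    have hu : IsUnit (A - algebraMap ℂ Op z) := isUnit_sub_algebraMap_iff.2 (by
      by_contra h; exact hz h)
    obtain ⟨k₀, hk₀⟩ := exists_nat_gt ‖Ring.inverse (A - algebraMap ℂ Op z)‖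
    have hz' : z ∉ pseudospectrum 0 (1 / ((k₀ : ℝ) + 1)) A := by
      rw [not_mem_pseudospectrum_iff (by positivity)]
      refine ⟨hu, ?_⟩
      simp only [pow_zero, pow_one, one_div_one_div]
      linarith
    have hopen := (isCompact_pseudospectrum 0 (ε := 1 / ((k₀ : ℝ) + 1)) (by positivity)
      A).isClosed.isOpen_compl
    obtain ⟨ρ, hρ, hball⟩ := Metric.isOpen_iff.1 hopen z hz'
    refine ⟨ρ, hρ, ?_⟩
    filter_upwards [eventually_ge_atTop k₀] with k hk w hw
    by_contra hlt
    push Not at hlt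
    refine hball hlt ?_
    have hw : w ∈ pseudospectrum 0 (1 / ((k : ℝ) + 1)) A := hw
    rw [mem_pseudospectrum_iff (by positivity)] at hw ⊢
    refine hw.imp id fun h => le_trans ?_ h
    simp only [one_div_one_div]
    gcongr

/-! ### Coordinates and sections -/

theorem inner_basisVec (i : ℕ) (x : L2) : inner ℂ (basisVec i) x = x i := by
  rw [basisVec, lp.inner_single_left]
  simp

theorem norm_basisVec (i : ℕ) : ‖basisVec i‖ = 1 := by
  rw [basisVec, lp.norm_single (by norm_num)]
  simp

theorem basisVec_apply (i j : ℕ) : basisVec i j = if j = i then 1 else 0 := by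
  rw [basisVec, lp.single_apply, Pi.single_apply]

theorem sum_apply_L2 {ι : Type*} (s : Finset ι) (g : ι → L2) (i : ℕ) :
    (∑ j ∈ s, g j) i = ∑ j ∈ s, g j i := by
  rw [lp.coeFn_sum, Finset.sum_apply]

theorem proj_apply (m : ℕ) (x : L2) : proj m x = ∑ i ∈ Finset.range m, x i • basisVec i := by
  simp [proj, inner_basisVec]

theorem proj_apply_apply (m : ℕ) (x : L2) (i : ℕ) : proj m x i = if i < m then x i else 0 := by
  rw [proj_apply, sum_apply_L2]
  simp [basisVec_apply]

theorem proj_mul_proj (m k : ℕ) : proj m * proj k = proj (min m k) := by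
  ext x i
  simp only [mul_apply_eq_comp, proj_apply_apply, lt_min_iff]
  split_ifs <;> simp_all

theorem norm_sq_eq_tsum (x : L2) : ‖x‖ ^ 2 = ∑' i, ‖x i‖ ^ 2 := by
  have := lp.norm_rpow_eq_tsum (p := 2) (by norm_num) x
  simpa using this

theorem hasSum_norm_sq (x : L2) : HasSum (fun i => ‖x i‖ ^ 2) (‖x‖ ^ 2) := by
  have := lp.hasSum_norm (p := 2) (by norm_num) x
  simpa using this

theorem norm_sq_proj (m : ℕ) (x : L2) : ‖proj m x‖ ^ 2 = ∑ i ∈ Finset.range m, ‖x i‖ ^ 2 := by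
  rw [norm_sq_eq_tsum, tsum_eq_sum (s := Finset.range m)]
  · refine Finset.sum_congr rfl fun i hi => ?_
    rw [proj_apply_apply, if_pos (Finset.mem_range.1 hi)]
  · intro i hi
    rw [proj_apply_apply, if_neg (by simpa using hi)]
    simp

theorem norm_proj_apply_le (m : ℕ) (x : L2) : ‖proj m x‖ ≤ ‖x‖ := by
  rw [← sq_le_sq₀ (norm_nonneg _) (norm_nonneg _), norm_sq_proj]
  exact sum_le_hasSum _ (fun i _ => by positivity) (hasSum_norm_sq x)

theorem norm_proj_le (m : ℕ) : ‖proj m‖ ≤ 1 :=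
  ContinuousLinearMap.opNorm_le_bound _ zero_le_one fun x => by
    simpa using norm_proj_apply_le m x

theorem isSelfAdjoint_proj (m : ℕ) : ContinuousLinearMap.adjoint (proj m) = proj m := by
  rw [eq_comm, ContinuousLinearMap.eq_adjoint_iff]
  intro x y
  rw [proj_apply, proj_apply, sum_inner, inner_sum]
  refine Finset.sum_congr rfl fun i _ => ?_
  rw [inner_smul_left, inner_smul_right, inner_basisVec, ← inner_conj_symm, inner_basisVec,
    mul_comm]

theorem norm_one_sub_proj_apply_le (m : ℕ) (x : L2) : ‖(1 - proj m) x‖ ≤ ‖x‖ := by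
  rw [← sq_le_sq₀ (norm_nonneg _) (norm_nonneg _), norm_sq_eq_tsum, norm_sq_eq_tsum]
  refine (hasSum_norm_sq _).summable.tsum_le_tsum (fun i => ?_) (hasSum_norm_sq x).summable
  have : ((1 - proj m) x) i = x i - proj m x i := rfl
  rw [this, proj_apply_apply]
  split_ifs <;> simp

theorem norm_one_sub_proj_le (m : ℕ) : ‖1 - proj m‖ ≤ 1 :=
  ContinuousLinearMap.opNorm_le_bound _ zero_le_one fun x => by
    simpa using norm_one_sub_proj_apply_le m x

theorem tendsto_proj_apply (x : L2) : Tendsto (fun m => proj m x) atTop (𝓝 x) := by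
  have h := (lp.hasSum_single (p := 2) (by norm_num) x).tendsto_sum_nat
  refine h.congr fun m => ?_
  rw [proj_apply]
  refine Finset.sum_congr rfl fun i _ => ?_
  rw [basisVec, ← lp.single_smul]
  simp

theorem proj_eq_self_of_le {n m : ℕ} (hnm : n ≤ m) {x : L2} (hx : proj n x = x) :
    proj m x = x := by
  rw [← hx, ← mul_apply_eq_comp, proj_mul_proj, min_eq_right hnm]

/-- Continuous convergence of a sequence of operators. -/
def ContConv (T : ℕ → Op) (T' : Op) : Prop :=
  ∀ (x : ℕ → L2) (x' : L2), Tendsto x atTop (𝓝 x') → Tendsto (fun n => T n (x n)) atTop (𝓝 (T' x'))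

/-- Continuous convergence passes to products with no bound on norms, and it allows the grid point,
the vector and the section to vary together. -/
theorem ContConv.mul {S T : ℕ → Op} {S' T' : Op} (hS : ContConv S S') (hT : ContConv T T') :
    ContConv (fun n => S n * T n) (S' * T') := fun x x' hx =>
  hS _ _ (hT x x' hx)

theorem ContConv.pow {T : ℕ → Op} {T' : Op} (hT : ContConv T T') (k : ℕ) :
    ContConv (fun n => T n ^ k) (T' ^ k) := by
  induction k with
  | zero => intro x x' hx; simpa using hx
  | succ k ih => simpa only [pow_succ] using ih.mul hT

theorem ContConv.of_tendsto {T : ℕ → Op} {T' : Op} (hT : Tendsto T atTop (𝓝 T')) :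
    ContConv T T' := fun _ _ hx =>
  (isBoundedBilinearMap_apply (𝕜 := ℂ) (E := L2) (F := L2)).continuous.tendsto (T', _) |>.comp
    (hT.prodMk_nhds hx)

theorem contConv_proj {m : ℕ → ℕ} (hm : Tendsto m atTop atTop) :
    ContConv (fun n => proj (m n)) 1 := by
  intro x x' hx
  have h1 : Tendsto (fun n => proj (m n) (x n - x')) atTop (𝓝 0) := by
    refine squeeze_zero_norm (fun n => norm_proj_apply_le _ _) ?_
    have := (hx.sub_const x').norm
    simpa using this
  have h2 := h1.add ((tendsto_proj_apply x').comp hm)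
  simpa [map_sub] using h2

/-- The compression of `T` to the span of the first `m` basis vectors. -/
noncomputable def compression (m : ℕ) (T : Op) : Op := proj m * T * proj m

theorem adjoint_compression (m : ℕ) (T : Op) :
    ContinuousLinearMap.adjoint (compression m T) = compression m (ContinuousLinearMap.adjoint T) := by
  simp only [compression, ← ContinuousLinearMap.star_eq_adjoint, star_mul]
  simp only [ContinuousLinearMap.star_eq_adjoint, isSelfAdjoint_proj, mul_assoc]

theorem adjoint_pow (T : Op) (k : ℕ) :
    ContinuousLinearMap.adjoint (T ^ k) = ContinuousLinearMap.adjoint T ^ k := by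
  simp only [← ContinuousLinearMap.star_eq_adjoint, star_pow]

theorem adjoint_sub_algebraMap (A : Op) (z : ℂ) :
    ContinuousLinearMap.adjoint (A - algebraMap ℂ Op z) =
      ContinuousLinearMap.adjoint A - algebraMap ℂ Op ((starRingEnd ℂ) z) := by
  simp only [← ContinuousLinearMap.star_eq_adjoint, star_sub, algebraMap_star_comm,
    starRingEnd_apply]

theorem contConv_compression {T : ℕ → Op} {T' : Op} (hT : ContConv T T') {m : ℕ → ℕ}
    (hm : Tendsto m atTop atTop) : ContConv (fun n => compression (m n) (T n)) T' := by
  have := ((contConv_proj hm).mul hT).mul (contConv_proj hm)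
  simpa [compression] using this

theorem tendsto_sub_algebraMap (A : Op) {z : ℕ → ℂ} {z' : ℂ} (hz : Tendsto z atTop (𝓝 z')) :
    Tendsto (fun n => A - algebraMap ℂ Op (z n)) atTop (𝓝 (A - algebraMap ℂ Op z')) :=
  tendsto_const_nhds.sub (((continuous_algebraMap ℂ Op).tendsto z').comp hz)

theorem proj_compression_pow_apply {m k : ℕ} (T : Op) {x : L2} (hx : proj m x = x) :
    proj m ((compression m T ^ k) x) = (compression m T ^ k) x := by
  cases k with
  | zero => simpa using hx
  | succ k =>
    rw [pow_succ', mul_apply_eq_comp, compression]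
    simp only [mul_apply_eq_comp]
    rw [← mul_apply_eq_comp (proj m) (proj m), proj_mul_proj, min_self]

/-- On the range of the projection the section of A - z is the section of A, of norm at most ‖A‖,
minus z; each application therefore stretches by at least ‖z‖ - ‖A‖. This keeps the accepted grid
points bounded. -/
theorem le_norm_compression_pow (A : Op) (z : ℂ) {m : ℕ} {x : L2} (hx : proj m x = x) (k : ℕ)
    (hz : ‖A‖ ≤ ‖z‖) :
    (‖z‖ - ‖A‖) ^ k * ‖x‖ ≤ ‖(compression m (A - algebraMap ℂ Op z) ^ k) x‖ := by
  induction k with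
  | zero => simp
  | succ k ih =>
    set y := (compression m (A - algebraMap ℂ Op z) ^ k) x with hy
    have hPy : proj m y = y := proj_compression_pow_apply _ hx
    have h1 : (compression m (A - algebraMap ℂ Op z)) y = proj m (A y) - z • y := by
      simp [compression, hPy, Algebra.algebraMap_eq_smul_one]
    rw [pow_succ' (compression m _), mul_apply_eq_comp, ← hy, h1]
    have h2 : ‖proj m (A y)‖ ≤ ‖A‖ * ‖y‖ := (norm_proj_apply_le _ _).trans (A.le_opNorm y)
    have h3 := norm_sub_norm_le (z • y) (proj m (A y))
    rw [norm_smul, norm_sub_rev] at h3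
    have h4 : (‖z‖ - ‖A‖) * ((‖z‖ - ‖A‖) ^ k * ‖x‖) ≤ (‖z‖ - ‖A‖) * ‖y‖ :=
      mul_le_mul_of_nonneg_left ih (sub_nonneg.2 hz)
    calc _ = (‖z‖ - ‖A‖) * ((‖z‖ - ‖A‖) ^ k * ‖x‖) := by ring
      _ ≤ _ := h4
      _ ≤ _ := by linarith

/-! ### Rational grids -/

/-- The points `(a + b i) / q` with integers `|a|, |b| ≤ r`. -/
noncomputable def ratGrid (q r : ℕ) : Finset ℂ :=
  ((Finset.Icc (-(r : ℤ)) r) ×ˢ (Finset.Icc (-(r : ℤ)) r)).image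
    fun p => (((p.1 : ℚ) / q : ℚ) : ℂ) + (((p.2 : ℚ) / q : ℚ) : ℂ) * Complex.I

theorem isRatComplex_of_mem_ratGrid {q r : ℕ} {z : ℂ} (hz : z ∈ ratGrid q r) : IsRatComplex z := by
  obtain ⟨p, _, rfl⟩ := Finset.mem_image.1 hz
  exact ⟨_, _, rfl⟩

theorem isRatComplex_zero : IsRatComplex 0 := ⟨0, 0, by simp⟩

theorem exists_mem_ratGrid {q r : ℕ} (hq : 0 < q) {z : ℂ} (hz : ‖z‖ * q ≤ r) :
    ∃ w ∈ ratGrid q r, ‖w - z‖ ≤ 1 / q := by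
  have hq' : (0 : ℝ) < q := by exact_mod_cast hq
  have hround : ∀ t : ℝ, |t| * q ≤ r → round (t * q) ∈ Finset.Icc (-(r : ℤ)) r := by
    intro t ht
    rw [← abs_of_pos hq', ← abs_mul] at ht
    obtain ⟨h1, h2⟩ := abs_le.1 ht
    have h3 := abs_le.1 (abs_sub_round (t * q))
    rw [Finset.mem_Icc]
    constructor
    · have h : (-(r : ℤ) - 1 : ℝ) < (round (t * q) : ℤ) := by push_cast; linarith [h3.2]
      have : -(r : ℤ) - 1 < round (t * q) := by exact_mod_cast h
      omega
    · have h : ((round (t * q) : ℤ) : ℝ) < (r : ℤ) + 1 := by push_cast; linarith [h3.1]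
      have : round (t * q) < (r : ℤ) + 1 := by exact_mod_cast h
      omega
  have herr : ∀ t : ℝ, |(round (t * q) : ℝ) / q - t| ≤ 1 / 2 / q := by
    intro t
    have h := abs_sub_round (t * q)
    rw [abs_sub_comm] at h
    rw [show (round (t * q) : ℝ) / q - t = (round (t * q) - t * q) / q by field_simp, abs_div,
      abs_of_pos hq']
    gcongr
  refine ⟨_, Finset.mem_image.2 ⟨(round (z.re * q), round (z.im * q)), Finset.mem_product.2
    ⟨hround _ ?_, hround _ ?_⟩, rfl⟩, ?_⟩
  · exact le_trans (by gcongr; exact Complex.abs_re_le_norm z) hz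
  · exact le_trans (by gcongr; exact Complex.abs_im_le_norm z) hz
  · refine (Complex.norm_le_abs_re_add_abs_im _).trans ?_
    have h1 := herr z.re
    have h2 := herr z.im
    simp only [Complex.sub_re, Complex.sub_im, Complex.add_re, Complex.add_im, Complex.mul_re,
      Complex.mul_im, Complex.I_re, Complex.I_im, Complex.ratCast_re, Complex.ratCast_im]
    push_cast
    rw [show (1 : ℝ) / q = 1 / 2 / q + 1 / 2 / q by ring]
    exact add_le_add (by simpa using h1) (by simpa using h2)

/-- The grid that is searched at stage `n`. -/
noncomputable def grid (n : ℕ) : Finset ℂ := ratGrid ((n + 1) ^ 3) ((n + 1) ^ 4)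

/-- The grid has mesh (n+1)⁻³ and half-width (n+1)⁴/(n+1)³ = n+1, so it exhausts the plane; the mesh
is much finer than the threshold 1/(n+1) used for compact operators. -/
theorem exists_mem_grid {n : ℕ} {z : ℂ} (hz : ‖z‖ ≤ n + 1) :
    ∃ w ∈ grid n, ‖w - z‖ ≤ 1 / ((n : ℝ) + 1) ^ 3 := by
  have := exists_mem_ratGrid (q := (n + 1) ^ 3) (r := (n + 1) ^ 4) (z := z) (by positivity) (by
    push_cast
    calc _ ≤ ((n : ℝ) + 1) * (n + 1) ^ 3 := by gcongr
      _ = _ := by ring)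
  simpa [grid] using this

/-- The nonzero vectors in the span of the first `n` basis vectors that are tested at stage `n`. -/
noncomputable def testVecs (n : ℕ) : Finset L2 := by
  classical exact
  ((Fintype.piFinset fun _ : Fin n => ratGrid ((n + 1) ^ 3) ((n + 1) ^ 3)).image
    fun v => ∑ i : Fin n, v i • basisVec i).filter (· ≠ 0)

theorem ne_zero_of_mem_testVecs {n : ℕ} {x : L2} (hx : x ∈ testVecs n) : x ≠ 0 := by
  simp only [testVecs, Finset.mem_filter] at hx
  exact hx.2

theorem isRatComplex_of_mem_testVecs {n : ℕ} {x : L2} (hx : x ∈ testVecs n) (i : ℕ) :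
    IsRatComplex (x i) := by
  classical
  simp only [testVecs, Finset.mem_filter, Finset.mem_image, Fintype.mem_piFinset] at hx
  obtain ⟨⟨v, hv, rfl⟩, _⟩ := hx
  rw [sum_apply_L2]
  by_cases hi : i < n
  · rw [Finset.sum_eq_single ⟨i, hi⟩]
    · simpa [basisVec_apply] using isRatComplex_of_mem_ratGrid (hv ⟨i, hi⟩)
    · intro j _ hj
      have : i ≠ j := fun h => hj (Fin.ext h.symm)
      simp [basisVec_apply, this]
    · simp
  · rw [Finset.sum_eq_zero]
    · exact isRatComplex_zero
    · intro j _
      have : i ≠ j := fun h => hi (h ▸ j.2)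
      simp [basisVec_apply, this]

theorem proj_of_mem_testVecs {n : ℕ} {x : L2} (hx : x ∈ testVecs n) : proj n x = x := by
  classical
  simp only [testVecs, Finset.mem_filter, Finset.mem_image, Fintype.mem_piFinset] at hx
  obtain ⟨⟨v, hv, rfl⟩, _⟩ := hx
  ext i
  rw [proj_apply_apply]
  split_ifs with hi
  · rfl
  · rw [sum_apply_L2, Finset.sum_eq_zero]
    intro j _
    have : i ≠ j := fun h => hi (h ▸ j.2)
    simp [basisVec_apply, this]

/-- Each of the n coordinates is rounded with error at most (n+1)⁻³, in total at most (n+1)⁻². The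
lower bound on ‖`proj n u`‖ ensures that the rounded vector is not zero. -/
theorem exists_mem_testVecs {n : ℕ} {u : L2} (hu : ‖u‖ ≤ 1)
    (hn : 1 / ((n : ℝ) + 1) ^ 2 < ‖proj n u‖) :
    ∃ x ∈ testVecs n, ‖x - proj n u‖ ≤ 1 / ((n : ℝ) + 1) ^ 2 := by
  classical
  have h : ∀ i : Fin n, ∃ w ∈ ratGrid ((n + 1) ^ 3) ((n + 1) ^ 3),
      ‖w - u i‖ ≤ 1 / ((n + 1) ^ 3 : ℕ) := fun i =>
    exists_mem_ratGrid (by positivity) (by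
      have : ‖u i‖ ≤ 1 := (lp.norm_apply_le_norm (by norm_num) u i).trans hu
      exact mul_le_of_le_one_left (by positivity) this)
  choose v hv hvu using h
  have hdist : ‖∑ i : Fin n, v i • basisVec i - proj n u‖ ≤ 1 / ((n : ℝ) + 1) ^ 2 := by
    rw [proj_apply, Finset.sum_range, ← Finset.sum_sub_distrib]
    refine (norm_sum_le _ _).trans ?_
    calc _ ≤ ∑ i : Fin n, (1 / ((n + 1) ^ 3 : ℕ) : ℝ) := by
          refine Finset.sum_le_sum fun i _ => ?_
          rw [← sub_smul, norm_smul, norm_basisVec, mul_one]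
          exact hvu i
      _ ≤ _ := by
          simp only [Finset.sum_const, Finset.card_univ, Fintype.card_fin, nsmul_eq_mul]
          push_cast
          rw [mul_one_div, div_le_div_iff₀ (by positivity) (by positivity)]
          have : (0 : ℝ) ≤ n := n.cast_nonneg
          have h2 : (0 : ℝ) ≤ ((n : ℝ) + 1) ^ 2 := by positivity
          nlinarith
  refine ⟨∑ i : Fin n, v i • basisVec i, ?_, hdist⟩
  simp only [testVecs, Finset.mem_filter, Finset.mem_image, Fintype.mem_piFinset]
  refine ⟨⟨v, hv, rfl⟩, fun h0 => ?_⟩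
  rw [h0, zero_sub, norm_neg] at hdist
  linarith

theorem exists_testVecs_tendsto {u : L2} (hu : ‖u‖ = 1) :
    ∃ x : ℕ → L2, (∀ᶠ n in atTop, x n ∈ testVecs n) ∧ Tendsto x atTop (𝓝 u) := by
  have hlim : Tendsto (fun n : ℕ => 1 / ((n : ℝ) + 1) ^ 2) atTop (𝓝 0) := by
    have := (tendsto_one_div_add_atTop_nhds_zero_nat (𝕜 := ℝ)).pow 2
    simpa [div_pow] using this
  have hev : ∀ᶠ n : ℕ in atTop, 1 / ((n : ℝ) + 1) ^ 2 < ‖proj n u‖ :=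
    hlim.eventually_lt (tendsto_proj_apply u).norm (by rw [hu]; exact one_pos)
  have h : ∀ n : ℕ, ∃ x, 1 / ((n : ℝ) + 1) ^ 2 < ‖proj n u‖ →
      x ∈ testVecs n ∧ ‖x - proj n u‖ ≤ 1 / ((n : ℝ) + 1) ^ 2 := fun n => by
    by_cases hn : 1 / ((n : ℝ) + 1) ^ 2 < ‖proj n u‖
    · obtain ⟨x, h1, h2⟩ := exists_mem_testVecs hu.le hn
      exact ⟨x, fun _ => ⟨h1, h2⟩⟩
    · exact ⟨0, fun h => absurd h hn⟩
  choose x hx using h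
  refine ⟨x, hev.mono fun n hn => (hx n hn).1, ?_⟩
  have h0 : Tendsto (fun n => x n - proj n u) atTop (𝓝 0) :=
    squeeze_zero_norm' (hev.mono fun n hn => (hx n hn).2) hlim
  simpa using h0.add (tendsto_proj_apply u)

/-! ### Computability of the coordinates of powers of sections -/

theorem termComputable_compression_pow_apply {Ω : Type*} {Λ : Set (Ω → ℂ)} {B : Ω → Op}
    (hB : ∀ i j, TermComputable Λ fun A => inner ℂ (basisVec i) (B A (basisVec j))) (m : ℕ)
    {x : L2} (hx : ∀ i, IsRatComplex (x i)) (k i : ℕ) :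
    TermComputable Λ fun A => ((compression m (B A) ^ k) x) i := by
  induction k generalizing i with
  | zero => simpa using TermComputable.const (Λ := Λ) (hx i)
  | succ k ih =>
    by_cases hi : i < m
    · have h : ∀ A, ((compression m (B A) ^ (k + 1)) x) i = ∑ j ∈ Finset.range m,
          ((compression m (B A) ^ k) x) j * inner ℂ (basisVec i) (B A (basisVec j)) := by
        intro A
        rw [pow_succ', mul_apply_eq_comp, compression, mul_apply_eq_comp, mul_apply_eq_comp,
          proj_apply_apply, if_pos hi, ← compression, proj_apply, map_sum, sum_apply_L2]
        refine Finset.sum_congr rfl fun j _ => ?_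
        rw [map_smul, inner_basisVec]
        rfl
      simp only [h]
      exact TermComputable.sum _ fun j _ => (ih j).mul (hB i j)
    · have h : ∀ A, ((compression m (B A) ^ (k + 1)) x) i = 0 := by
        intro A
        rw [pow_succ', mul_apply_eq_comp, compression, mul_apply_eq_comp, mul_apply_eq_comp,
          proj_apply_apply, if_neg hi]
      simp only [h]
      exact TermComputable.const isRatComplex_zero

/-- The norm is squared because roots are not arithmetic operations; this is why the thresholds are
squares too. -/
theorem termComputable_norm_compression_pow {Ω : Type*} {Λ : Set (Ω → ℂ)} {B : Ω → Op}
    (hB : ∀ i j, TermComputable Λ fun A => inner ℂ (basisVec i) (B A (basisVec j))) {m : ℕ}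
    {x : L2} (hx : ∀ i, IsRatComplex (x i)) (hPx : proj m x = x) (k : ℕ) :
    TermComputable Λ fun A => ((‖(compression m (B A) ^ k) x‖ ^ 2 : ℝ) : ℂ) := by
  have h : ∀ A, ((‖(compression m (B A) ^ k) x‖ ^ 2 : ℝ) : ℂ) = ∑ i ∈ Finset.range m,
      ((compression m (B A) ^ k) x) i * (starRingEnd ℂ) (((compression m (B A) ^ k) x) i) := by
    intro A
    rw [← proj_compression_pow_apply (B A) hPx, norm_sq_proj, proj_compression_pow_apply (B A) hPx]
    push_cast
    refine Finset.sum_congr rfl fun i _ => ?_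
    rw [Complex.mul_conj, Complex.normSq_eq_norm_sq]
    push_cast
    rfl
  simp only [h]
  refine TermComputable.sum _ fun i _ => ?_
  have := termComputable_compression_pow_apply hB m hx k i
  exact this.mul this.conj

/-! ### Finite sets as points of the Hausdorff space -/

open scoped Classical in
/-- A finite set of complex numbers as a nonempty compact set; the empty set is replaced by
`{0}`. -/
noncomputable def finsetCompacts (S : Finset ℂ) : TopologicalSpace.NonemptyCompacts ℂ :=
  if h : S.Nonempty then ⟨⟨S, S.finite_toSet.isCompact⟩, h⟩ else {0}

theorem mem_finsetCompacts {S : Finset ℂ} (h : S.Nonempty) {z : ℂ} :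
    z ∈ finsetCompacts S ↔ z ∈ S := by
  rw [finsetCompacts, dif_pos h]
  rfl

theorem finite_finsetCompacts (S : Finset ℂ) : (finsetCompacts S : Set ℂ).Finite := by
  rw [finsetCompacts]
  split_ifs
  · exact S.finite_toSet
  · simp

theorem isRatComplex_of_mem_finsetCompacts {S : Finset ℂ} (hS : ∀ z ∈ S, IsRatComplex z) {z : ℂ}
    (hz : z ∈ (finsetCompacts S : Set ℂ)) : IsRatComplex z := by
  rw [finsetCompacts] at hz
  split_ifs at hz
  · exact hS z hz
  · have : z = 0 := by simpa using hz
    exact this ▸ isRatComplex_zero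

/-- The lower condition makes the sets eventually nonempty, so the default `{0}` does not affect the
limit. -/
theorem tendsto_finsetCompacts {K : TopologicalSpace.NonemptyCompacts ℂ}
    {S : ℕ → Finset ℂ} {R : ℝ}
    (hbdd : ∀ᶠ n in atTop, ∀ w ∈ S n, ‖w‖ ≤ R)
    (hlow : ∀ z ∈ K, ∀ δ > 0, ∀ᶠ n in atTop, ∃ w ∈ S n, dist w z < δ)
    (hupp : ∀ z ∉ K, ∃ ρ > 0, ∀ᶠ n in atTop, ∀ w ∈ S n, ρ ≤ dist w z) :
    Tendsto (fun n => finsetCompacts (S n)) atTop (𝓝 K) := by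
  obtain ⟨z₀, hz₀⟩ := K.nonempty
  have hne : ∀ᶠ n in atTop, (S n).Nonempty :=
    (hlow z₀ hz₀ 1 one_pos).mono fun n ⟨w, hw, _⟩ => ⟨w, hw⟩
  refine tendsto_nonemptyCompacts (R := R) ?_ ?_ ?_
  · filter_upwards [hne, hbdd] with n h1 h2 w hw using h2 w ((mem_finsetCompacts h1).1 hw)
  · intro z hz δ hδ
    filter_upwards [hne, hlow z hz δ hδ] with n h1 ⟨w, hw, h⟩
    exact ⟨w, (mem_finsetCompacts h1).2 hw, h⟩
  · intro z hz
    obtain ⟨ρ, hρ, h⟩ := hupp z hz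
    refine ⟨ρ, hρ, ?_⟩
    filter_upwards [hne, h] with n h1 h2 w hw using h2 w ((mem_finsetCompacts h1).1 hw)

theorem exists_grid_tendsto (z : ℂ) :
    ∃ w : ℕ → ℂ, (∀ᶠ n in atTop, w n ∈ grid n ∧ ‖w n - z‖ ≤ 1 / ((n : ℝ) + 1) ^ 3) ∧
      Tendsto w atTop (𝓝 z) := by
  have hlim : Tendsto (fun n : ℕ => 1 / ((n : ℝ) + 1) ^ 3) atTop (𝓝 0) := by
    have := (tendsto_one_div_add_atTop_nhds_zero_nat (𝕜 := ℝ)).pow 3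
    simpa [div_pow] using this
  have hev : ∀ᶠ n : ℕ in atTop, ‖z‖ ≤ n + 1 := by
    obtain ⟨k, hk⟩ := exists_nat_ge ‖z‖
    filter_upwards [eventually_ge_atTop k] with n hn
    have : (k : ℝ) ≤ n := by exact_mod_cast hn
    linarith
  have h : ∀ n : ℕ, ∃ w, ‖z‖ ≤ n + 1 → w ∈ grid n ∧ ‖w - z‖ ≤ 1 / ((n : ℝ) + 1) ^ 3 := fun n => by
    by_cases hn : ‖z‖ ≤ n + 1
    · obtain ⟨w, h1, h2⟩ := exists_mem_grid hn
      exact ⟨w, fun _ => ⟨h1, h2⟩⟩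
    · exact ⟨0, fun h => absurd h hn⟩
  choose w hw using h
  refine ⟨w, hev.mono fun n hn => hw n hn, ?_⟩
  have h0 : Tendsto (fun n => w n - z) atTop (𝓝 0) :=
    squeeze_zero_norm' (hev.mono fun n hn => (hw n hn).2) hlim
  simpa using h0.add_const z

/-! ### Operators and their adjoints -/

/-- The operator `T` or its adjoint. -/
noncomputable def orAdjoint (b : Bool) (T : Op) : Op :=
  if b then T else ContinuousLinearMap.adjoint T

theorem orAdjoint_pow (b : Bool) (T : Op) (k : ℕ) : orAdjoint b (T ^ k) = orAdjoint b T ^ k := by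
  cases b <;> simp [orAdjoint, adjoint_pow]

theorem norm_orAdjoint (b : Bool) (T : Op) : ‖orAdjoint b T‖ = ‖T‖ := by
  cases b <;> simp [orAdjoint]

theorem exists_orAdjoint_sub (b : Bool) (A : Op) (z : ℂ) : ∃ w : ℂ, ‖w‖ = ‖z‖ ∧
    (IsRatComplex z → IsRatComplex w) ∧
    orAdjoint b (A - algebraMap ℂ Op z) = orAdjoint b A - algebraMap ℂ Op w := by
  cases b
  · refine ⟨(starRingEnd ℂ) z, by simp, ?_, by simp [orAdjoint, adjoint_sub_algebraMap]⟩
    rintro ⟨p, q, rfl⟩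
    exact ⟨p, -q, by simp⟩
  · exact ⟨z, rfl, id, by simp [orAdjoint]⟩

theorem tendsto_orAdjoint (b : Bool) {T : ℕ → Op} {T' : Op} (hT : Tendsto T atTop (𝓝 T')) :
    Tendsto (fun n => orAdjoint b (T n)) atTop (𝓝 (orAdjoint b T')) := by
  cases b
  · exact ((ContinuousLinearMap.adjoint (𝕜 := ℂ) (E := L2) (F := L2)).continuous.tendsto T').comp hT
  · simpa [orAdjoint] using hT

theorem le_norm_orAdjoint_compression_pow (b : Bool) (A : Op) (z : ℂ) {m : ℕ} {x : L2}
    (hx : proj m x = x) (k : ℕ) (hz : ‖A‖ ≤ ‖z‖) :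
    (‖z‖ - ‖A‖) ^ k * ‖x‖ ≤ ‖(compression m (orAdjoint b (A - algebraMap ℂ Op z)) ^ k) x‖ := by
  obtain ⟨w, hw, -, h⟩ := exists_orAdjoint_sub b A z
  rw [h, ← hw, ← norm_orAdjoint b A]
  exact le_norm_compression_pow _ _ hx k (by rwa [hw, norm_orAdjoint])

/-- If ‖z‖ - ‖A‖ exceeded c ≥ 1, its k-th power would do so as well, and the section would stretch x
too much. -/
theorem norm_le_of_norm_compression_pow_le {b : Bool} {A : Op} {z : ℂ} {m : ℕ} {x : L2}
    (hx : proj m x = x) (hx0 : x ≠ 0) {k : ℕ} (hk : k ≠ 0) {c : ℝ} (hc : 1 ≤ c)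
    (h : ‖(compression m (orAdjoint b (A - algebraMap ℂ Op z)) ^ k) x‖ ≤ c * ‖x‖) :
    ‖z‖ ≤ ‖A‖ + c := by
  by_contra hlt
  push Not at hlt
  have h1 := (le_norm_orAdjoint_compression_pow b A z hx k (by linarith)).trans h
  have h2 : ‖z‖ - ‖A‖ ≤ (‖z‖ - ‖A‖) ^ k := le_self_pow₀ (by linarith) hk
  have h3 : 0 < ‖x‖ := norm_pos_iff.2 hx0
  have h4 := le_of_mul_le_mul_right h1 h3
  linarith

theorem tendsto_compression_pow (T : Op) (k : ℕ) (x : L2) :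
    Tendsto (fun m => (compression m T ^ k) x) atTop (𝓝 ((T ^ k) x)) :=
  (contConv_compression (ContConv.of_tendsto tendsto_const_nhds) tendsto_id).pow k _ _
    tendsto_const_nhds

theorem norm_le_of_norm_pow_le {b : Bool} {A : Op} {z : ℂ} {m : ℕ} {x : L2}
    (hx : proj m x = x) (hx0 : x ≠ 0) {k : ℕ} (hk : k ≠ 0) {c : ℝ} (hc : 1 ≤ c)
    (h : ‖(orAdjoint b (A - algebraMap ℂ Op z) ^ k) x‖ < c * ‖x‖) :
    ‖z‖ ≤ ‖A‖ + c := by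
  have h1 := (tendsto_compression_pow (orAdjoint b (A - algebraMap ℂ Op z)) k x).norm
  obtain ⟨j, hj, hjm⟩ := ((h1.eventually (gt_mem_nhds h)).and (eventually_ge_atTop m)).exists
  exact norm_le_of_norm_compression_pow_le (proj_eq_self_of_le hjm hx) hx0 hk hc hj.le

theorem exists_nhds_bounded_below {N : ℕ} {ε : ℝ} (hε : 0 < ε) {A : Op}
    {z₀ : ℂ} (hz₀ : z₀ ∉ pseudospectrum N ε A) :
    ∃ ρ > 0, ∃ δ > 0, ∀ z, dist z z₀ < ρ → ∀ b, ∀ x : L2,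
      (ε ^ 2 ^ N + δ) * ‖x‖ ≤ ‖(orAdjoint b (A - algebraMap ℂ Op z) ^ 2 ^ N) x‖ := by
  obtain ⟨ρ, hρ, δ, hδ, h⟩ := exists_nhds_bounded_below_of_not_mem_pseudospectrum hε hz₀
  refine ⟨ρ, hρ, δ, hδ, fun z hz b x => ?_⟩
  rw [← orAdjoint_pow]
  cases b
  · simpa [orAdjoint] using (h z hz x).2
  · simpa [orAdjoint] using (h z hz x).1

theorem exists_unit_norm_lt {N : ℕ} {ε : ℝ} (hε : 0 < ε) {A : Op}
    {z₀ : ℂ} (hz₀ : z₀ ∈ pseudospectrum N ε A) {δ : ℝ} (hδ : 0 < δ) :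
    ∃ z, dist z z₀ < δ ∧ ∃ b, ∃ x : L2, ‖x‖ = 1 ∧
      ‖(orAdjoint b (A - algebraMap ℂ Op z) ^ 2 ^ N) x‖ < ε ^ 2 ^ N := by
  obtain ⟨z, hz, x, hx⟩ := exists_norm_lt_near_pseudospectrum hε hz₀ hδ
  have hx' : ∃ b, ‖(orAdjoint b (A - algebraMap ℂ Op z) ^ 2 ^ N) x‖ < ε ^ 2 ^ N * ‖x‖ := by
    rcases hx with h | h
    · exact ⟨true, by simpa [orAdjoint] using h⟩
    · exact ⟨false, by rw [← orAdjoint_pow]; simpa [orAdjoint] using h⟩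
  obtain ⟨b, hb⟩ := hx'
  have hx0 : 0 < ‖x‖ := by
    by_contra h
    have : ‖x‖ = 0 := le_antisymm (not_lt.1 h) (norm_nonneg _)
    rw [this, mul_zero] at hb
    exact absurd hb (not_lt.2 (norm_nonneg _))
  refine ⟨z, hz, b, (‖x‖⁻¹ : ℂ) • x, ?_, ?_⟩
  · rw [norm_smul]; simp [hx0.ne']
  · rw [map_smul, norm_smul, norm_inv, Complex.norm_real, norm_norm, inv_mul_eq_div, div_lt_iff₀ hx0]
    exact hb

/-- `h2` is soundness: an accepted point has a witness that almost attains the threshold, which is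
impossible near a point outside the pseudospectrum. `h3` is completeness: a strict witness (z₀, x₀)
is eventually detected along any grid points and test vectors approaching it, and points with strict
witnesses are dense in the pseudospectrum. -/
theorem tendsto_pseudospecMap_of_tests {N : ℕ} {ε : ℝ} (hε : 0 < ε) {A : Op}
    {S : ℕ → Finset ℂ} {R : ℝ}
    (h1 : ∀ᶠ n in atTop, ∀ w ∈ S n, ‖w‖ ≤ R)
    (h2 : ∀ δ > 0, ∀ᶠ n in atTop, ∀ z ∈ S n, ∃ b, ∃ x : L2, x ≠ 0 ∧
      ‖(orAdjoint b (A - algebraMap ℂ Op z) ^ 2 ^ N) x‖ < (ε ^ 2 ^ N + δ) * ‖x‖)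
    (h3 : ∀ (z : ℕ → ℂ) (z₀ : ℂ) (x : ℕ → L2) (x₀ : L2) (b : Bool), ‖x₀‖ = 1 →
      ‖(orAdjoint b (A - algebraMap ℂ Op z₀) ^ 2 ^ N) x₀‖ < ε ^ 2 ^ N →
      Tendsto z atTop (𝓝 z₀) → Tendsto x atTop (𝓝 x₀) →
      ∀ᶠ n in atTop, z n ∈ grid n → x n ∈ testVecs n → z n ∈ S n) :
    Tendsto (fun n => finsetCompacts (S n)) atTop (𝓝 (pseudospecMap N hε A)) := by
  refine tendsto_finsetCompacts h1 ?_ ?_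
  · intro z hz δ hδ
    obtain ⟨z', hz', b, x, hx, hlt⟩ := exists_unit_norm_lt hε hz (half_pos hδ)
    obtain ⟨w, hw, hwlim⟩ := exists_grid_tendsto z'
    obtain ⟨y, hy, hylim⟩ := exists_testVecs_tendsto hx
    filter_upwards [h3 w z' y x b hx hlt hwlim hylim, hw, hy,
      Metric.tendsto_nhds.1 hwlim _ (half_pos hδ)] with n hn hwn hyn hd
    refine ⟨w n, hn hwn.1 hyn, (dist_triangle _ z' _).trans_lt ?_⟩
    linarith
  · intro z hz
    obtain ⟨ρ, hρ, δ, hδ, h⟩ := exists_nhds_bounded_below hε hz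
    refine ⟨ρ, hρ, ?_⟩
    filter_upwards [h2 δ hδ] with n hn w hw
    by_contra hlt
    push Not at hlt
    obtain ⟨b, x, _, hx⟩ := hn w hw
    exact absurd (h w hlt b x) (not_le.2 hx)

/-- Two rational thresholds tend to c from above; the gap between them is the width of the switch
used for general operators. -/
theorem exists_rat_seq (c : ℝ) : ∃ p q : ℕ → ℚ, ∀ n, c < p n ∧ (p n : ℝ) < q n ∧
    (q n : ℝ) < c + 1 / (n + 1) := by
  have h : ∀ n : ℕ, ∃ p q : ℚ, c < p ∧ (p : ℝ) < q ∧ (q : ℝ) < c + 1 / (n + 1) := fun n => by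
    have h0 : c < c + 1 / ((n : ℝ) + 1) := by
      have : (0 : ℝ) < 1 / ((n : ℝ) + 1) := by positivity
      linarith
    obtain ⟨q, h1, h2⟩ := exists_rat_btwn h0
    obtain ⟨p, h3, h4⟩ := exists_rat_btwn h1
    exact ⟨p, q, h3, h4, h2⟩
  choose p q h using h
  exact ⟨p, q, h⟩

theorem tendsto_of_rat_seq {c : ℝ} {q : ℕ → ℚ} (h : ∀ n : ℕ, c < q n ∧ (q n : ℝ) < c + 1 / (n + 1)) :
    Tendsto (fun n => (q n : ℝ)) atTop (𝓝 c) := by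
  refine tendsto_of_tendsto_of_tendsto_of_le_of_le tendsto_const_nhds ?_ (fun n => (h n).1.le)
    fun n => (h n).2.le
  simpa using (tendsto_one_div_add_atTop_nhds_zero_nat (𝕜 := ℝ)).const_add c

/-! ### Computability of the tests -/

theorem termComputable_entry_orAdjoint_sub {Ω : Set Op} {Λ : Set (Ω → ℂ)} (hΛ : matrixEvals Ω ⊆ Λ)
    (b : Bool) {z : ℂ} (hz : IsRatComplex z) (i j : ℕ) :
    TermComputable Λ fun A : Ω =>
      inner ℂ (basisVec i) (orAdjoint b (A.1 - algebraMap ℂ Op z) (basisVec j)) := by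
  have hentry : ∀ i j, TermComputable Λ fun A : Ω => inner ℂ (basisVec i) (A.1 (basisVec j)) :=
    fun i j => .of_mem (hΛ ⟨i, j, rfl⟩)
  have hd : ∀ i j, TermComputable Λ fun A : Ω =>
      inner ℂ (basisVec i) ((A.1 - algebraMap ℂ Op z) (basisVec j)) := by
    intro i j
    have hc : IsRatComplex (z * (if i = j then 1 else 0)) := by
      split_ifs
      · simpa using hz
      · simpa using isRatComplex_zero
    have h := (hentry i j).sub (.const hc)
    convert h using 2 with A
    rw [sub_apply, inner_sub_right, Algebra.algebraMap_eq_smul_one, smul_apply,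
      one_apply_eq_self, inner_smul_right, inner_basisVec i (basisVec j), basisVec_apply]
  cases b
  · convert (hd j i).conj using 2 with A
    simp [orAdjoint, ContinuousLinearMap.adjoint_inner_right, inner_smul_left]
  · simpa [orAdjoint] using hd i j

theorem termComputable_test {Ω : Set Op} {Λ : Set (Ω → ℂ)} (hΛ : matrixEvals Ω ⊆ Λ)
    (b : Bool) {z : ℂ} (hz : IsRatComplex z) {m n : ℕ} (hnm : n ≤ m) {x : L2} (hx : x ∈ testVecs n)
    (k : ℕ) (q : ℚ) :
    TermComputable Λ fun A : Ω => ((q * ‖x‖ ^ 2 -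
      ‖(compression m (orAdjoint b (A.1 - algebraMap ℂ Op z)) ^ k) x‖ ^ 2 : ℝ) : ℂ) := by
  have hP := proj_eq_self_of_le hnm (proj_of_mem_testVecs hx)
  have h := fun k => termComputable_norm_compression_pow
    (termComputable_entry_orAdjoint_sub hΛ b hz) (isRatComplex_of_mem_testVecs hx) hP k
  have h0 := h 0
  simp only [pow_zero, one_apply_eq_self] at h0
  convert ((TermComputable.rat q).mul h0).sub (h k) using 2 with A
  push_cast
  rfl

/-! ### A tower of height one for operators with bounded dispersion -/

open scoped Classical in
/-- The grid points `z` at which the section of size `m` of `(A - z) ^ k`, or of its adjoint, has a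
small value on a test vector. -/
noncomputable def smallPoints (k : ℕ) (q : ℝ) (n m : ℕ) (A : Op) : Finset ℂ :=
  (grid n).filter fun z => ∃ x ∈ testVecs n, ∃ b,
    ‖(compression m (orAdjoint b (A - algebraMap ℂ Op z)) ^ k) x‖ ^ 2 < q * ‖x‖ ^ 2

theorem isArithmeticAlgorithm_smallPoints {Ω : Set Op} {Λ : Set (Ω → ℂ)} (hΛ : matrixEvals Ω ⊆ Λ)
    (k : ℕ) (q : ℚ) {n m : ℕ} (hnm : n ≤ m) {S₀ : Finset ℂ} (hS₀ : ∀ z ∈ S₀, IsRatComplex z) :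
    IsArithmeticAlgorithm Λ fun A : Ω => finsetCompacts (S₀ ∪ smallPoints k q n m A.1) := by
  classical
  refine isArithmeticAlgorithm_of_signs (ι := ℂ × L2 × Bool)
    (grid n ×ˢ testVecs n ×ˢ Finset.univ)
    (u := fun i A => ((q * ‖i.2.1‖ ^ 2 -
      ‖(compression m (orAdjoint i.2.2 (A.1 - algebraMap ℂ Op i.1)) ^ k) i.2.1‖ ^ 2 : ℝ) : ℂ))
    ?_ ?_ (fun A => finite_finsetCompacts _) fun A z hz =>
      isRatComplex_of_mem_finsetCompacts (fun z hz => ?_) hz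
  · rintro ⟨z, x, b⟩ hi
    simp only [Finset.mem_product, Finset.mem_univ, and_true] at hi
    exact termComputable_test hΛ b (isRatComplex_of_mem_ratGrid hi.1) hnm hi.2 k q
  · intro A B h
    have : smallPoints k q n m A.1 = smallPoints k q n m B.1 := by
      refine Finset.filter_congr fun z hz => ?_
      refine exists_congr fun x => and_congr_right fun hx => exists_congr fun b => ?_
      have := h (z, x, b) (by simp [hz, hx])
      simpa only [Complex.ofReal_re, sub_pos] using this
    rw [this]
  · rcases Finset.mem_union.1 hz with h | h
    · exact hS₀ z h
    · exact isRatComplex_of_mem_ratGrid (Finset.mem_filter.1 h).1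

/-- The sizes of sections that are needed for the `i`-th power of an operator with dispersion
bounded by `f`. -/
def sectionSize (f : ℕ → ℕ) (i n : ℕ) : ℕ := (fun j => max (f j) j)^[i] n

theorem sectionSize_succ (f : ℕ → ℕ) (i n : ℕ) :
    sectionSize f (i + 1) n = max (f (sectionSize f i n)) (sectionSize f i n) :=
  Function.iterate_succ_apply' _ _ _

theorem le_sectionSize (f : ℕ → ℕ) (i n : ℕ) : n ≤ sectionSize f i n := by
  induction i with
  | zero => exact le_rfl
  | succ i ih => rw [sectionSize_succ]; exact ih.trans (le_max_right _ _)

theorem one_sub_proj_mul {m k : ℕ} (h : k ≤ m) :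
    (1 - proj m) * (1 - proj k) = 1 - proj m := by
  rw [mul_sub, mul_one, sub_mul, one_mul, proj_mul_proj, min_eq_right h, sub_self, sub_zero]

/-- If a vector lives almost in the first M coordinates, then A - z sends it almost into the first
max(f M, M), and cutting the image there costs only the leakage. Iterating i times gives an error
proportional to η, with a constant that does not depend on n, m, x or on z in the disc of radius R.
-/
theorem norm_compression_pow_sub_le {f : ℕ → ℕ} (B : Op) {R : ℝ} (hR : 0 ≤ R) (i : ℕ) :
    ∃ C : ℝ, 0 ≤ C ∧ ∀ (η : ℝ) (n : ℕ), 0 ≤ η →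
      (∀ j ≥ n, ‖(1 - proj (f j)) * B * proj j‖ ≤ η) → ∀ z : ℂ, ‖z‖ ≤ R → ∀ x : L2, proj n x = x →
      ∀ m ≥ sectionSize f i n,
        ‖(1 - proj (sectionSize f i n)) ((compression m (B - algebraMap ℂ Op z) ^ i) x)‖ ≤
          C * η * ‖x‖ ∧
        ‖(compression m (B - algebraMap ℂ Op z) ^ i) x - ((B - algebraMap ℂ Op z) ^ i) x‖ ≤
          C * η * ‖x‖ := by
  induction i with
  | zero =>
    refine ⟨0, le_rfl, fun η n hη hd z hz x hx m hm => ?_⟩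
    simp [sectionSize, hx]
  | succ i ih =>
    obtain ⟨C, hC, ih⟩ := ih
    set L := ‖B‖ + R with hL
    have hL0 : 0 ≤ L := by positivity
    -- L^i η is the fresh leakage of the new step; L C η occurs twice, once for the tail left by the
    -- former steps and once for their accumulated error.
    refine ⟨L ^ i + 2 * L * C, by positivity, fun η n hη hd z hz x hx m hm => ?_⟩
    set M := sectionSize f i n with hM
    set M' := sectionSize f (i + 1) n with hM'
    have hMM' : M ≤ M' := by rw [hM', sectionSize_succ]; exact le_max_right _ _
    have hfM' : f M ≤ M' := by rw [hM', sectionSize_succ]; exact le_max_left _ _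
    have hnM : n ≤ M := le_sectionSize f i n
    obtain ⟨ha, hb⟩ := ih η n hη hd z hz x hx m (hMM'.trans hm)
    set T := B - algebraMap ℂ Op z with hT
    set w := (compression m T ^ i) x with hw
    have hxm : proj m x = x := proj_eq_self_of_le (hnM.trans (hMM'.trans hm)) hx
    have hTL : ‖T‖ ≤ L := (norm_sub_le _ _).trans (by
      rw [norm_algebraMap']; linarith)
    have hcomp : ‖compression m T‖ ≤ L := by
      calc ‖compression m T‖ ≤ ‖proj m‖ * ‖T‖ * ‖proj m‖ :=
            (norm_mul_le _ _).trans (by gcongr; exact norm_mul_le _ _)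
        _ ≤ 1 * L * 1 := by gcongr <;> exact norm_proj_le m
        _ = L := by ring
    have hwL : ‖w‖ ≤ L ^ i * ‖x‖ := by
      have h : ‖compression m T ^ i‖ ≤ L ^ i := by
        rcases Nat.eq_zero_or_pos i with rfl | hi
        · simp
        · exact (norm_pow_le' _ hi).trans (by gcongr)
      exact (compression m T ^ i).le_of_opNorm_le h x
    have hstep : (compression m T ^ (i + 1)) x = proj m (T w) := by
      rw [pow_succ', mul_apply_eq_comp, ← hw, compression, mul_apply_eq_comp, mul_apply_eq_comp,
        hw, proj_compression_pow_apply T hxm]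
    have hE : ‖(1 - proj M') (T w)‖ ≤ (L ^ i + L * C) * η * ‖x‖ := by
      -- The scalar part of T does not leak, as M ≤ M'; and cutting at M' ≥ f M is no worse than
      -- cutting at f M.
      have h1 : (1 - proj M') * T * proj M =
          (1 - proj M') * ((1 - proj (f M)) * B * proj M) := by
        rw [hT, mul_sub, sub_mul, mul_assoc (1 - proj M') (algebraMap ℂ Op z),
          Algebra.algebraMap_eq_smul_one, smul_mul_assoc, one_mul, mul_smul_comm, sub_mul 1 _ (proj M),
          one_mul, proj_mul_proj, min_eq_right hMM', sub_self, smul_zero, sub_zero, ← mul_assoc,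
          ← mul_assoc, one_sub_proj_mul hfM']
      have h2 : (1 - proj M') (T w) = (1 - proj M') (((1 - proj (f M)) * B * proj M) w) +
          (1 - proj M') (T ((1 - proj M) w)) := by
        rw [← mul_apply_eq_comp (1 - proj M') ((1 - proj (f M)) * B * proj M), ← h1,
          mul_apply_eq_comp, mul_apply_eq_comp, ← map_add, ← map_add]
        simp
      rw [h2]
      calc _ ≤ ‖((1 - proj (f M)) * B * proj M) w‖ + ‖T ((1 - proj M) w)‖ :=
            (norm_add_le _ _).trans (add_le_add (norm_one_sub_proj_apply_le _ _)
              (norm_one_sub_proj_apply_le _ _))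
        _ ≤ η * (L ^ i * ‖x‖) + L * (C * η * ‖x‖) := by
            refine add_le_add ?_ ?_
            · refine (ContinuousLinearMap.le_of_opNorm_le _ (hd M hnM) w).trans ?_
              gcongr
            · refine (ContinuousLinearMap.le_of_opNorm_le _ hTL _).trans ?_
              gcongr
        _ = _ := by ring
    have hE' : (L ^ i + L * C) * η * ‖x‖ ≤ (L ^ i + 2 * L * C) * η * ‖x‖ := by
      have : 0 ≤ L * C := by positivity
      gcongr
      linarith
    rw [hstep]
    constructor
    · have hcomm : (1 - proj M') * proj m = proj m * (1 - proj M') := by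
        rw [sub_mul, mul_sub, proj_mul_proj, proj_mul_proj, one_mul, mul_one, min_comm]
      rw [← mul_apply_eq_comp, hcomm, mul_apply_eq_comp]
      exact ((norm_proj_apply_le _ _).trans hE).trans hE'
    · have h1 : proj m (T w) - (T ^ (i + 1)) x =
          T (w - (T ^ i) x) - (1 - proj m) ((1 - proj M') (T w)) := by
        rw [← mul_apply_eq_comp (1 - proj m), one_sub_proj_mul hm, pow_succ', mul_apply_eq_comp,
          map_sub]
        simp
      rw [h1]
      calc _ ≤ L * (C * η * ‖x‖) + (L ^ i + L * C) * η * ‖x‖ :=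
            (norm_sub_le _ _).trans (add_le_add
              ((ContinuousLinearMap.le_of_opNorm_le _ hTL _).trans (by gcongr))
              ((norm_one_sub_proj_apply_le _ _).trans hE))
        _ = _ := by ring

/-- The second norm in the definition of dispersion is the first one for the adjoint operator. -/
theorem DispersionBoundedBy.orAdjoint {f : ℕ → ℕ} {A : Op} (h : DispersionBoundedBy f A)
    (b : Bool) : Tendsto (fun m => ‖(1 - proj (f m)) * orAdjoint b A * proj m‖) atTop (𝓝 0) := by
  cases b
  · refine squeeze_zero (fun _ => norm_nonneg _) (fun m => ?_) h
    refine le_trans (le_of_eq ?_) (le_max_right _ _)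
    have hs : ∀ m, star (proj m) = proj m := fun m => by
      rw [ContinuousLinearMap.star_eq_adjoint, isSelfAdjoint_proj]
    rw [← norm_star, star_mul, star_mul, star_sub, star_one, hs, hs, TowerSCI.orAdjoint]
    simp [← ContinuousLinearMap.star_eq_adjoint, mul_assoc]
  · refine squeeze_zero (fun _ => norm_nonneg _) (fun m => ?_) h
    exact le_max_left _ _

theorem DispersionBoundedBy.eventually_norm_sub_le {f : ℕ → ℕ} {A : Op}
    (h : DispersionBoundedBy f A) (R : ℝ) (i : ℕ) {η : ℝ} (hη : 0 < η) :
    ∀ᶠ n in atTop, ∀ z : ℂ, ‖z‖ ≤ R → ∀ x : L2, proj n x = x → ∀ b,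
      ‖(compression (sectionSize f i n) (TowerSCI.orAdjoint b (A - algebraMap ℂ Op z)) ^ i) x -
        (TowerSCI.orAdjoint b (A - algebraMap ℂ Op z) ^ i) x‖ ≤ η * ‖x‖ := by
  have hb : ∀ b, ∀ᶠ n in atTop, ∀ z : ℂ, ‖z‖ ≤ R → ∀ x : L2, proj n x = x →
      ‖(compression (sectionSize f i n) (TowerSCI.orAdjoint b (A - algebraMap ℂ Op z)) ^ i) x -
        (TowerSCI.orAdjoint b (A - algebraMap ℂ Op z) ^ i) x‖ ≤ η * ‖x‖ := by
    intro b
    rcases lt_or_ge R 0 with hR | hR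
    · exact .of_forall fun n z hz => absurd ((norm_nonneg z).trans hz) (not_le.2 hR)
    obtain ⟨C, hC, hmain⟩ := norm_compression_pow_sub_le (f := f) (TowerSCI.orAdjoint b A) hR i
    have hpos : 0 < η / (C + 1) := by positivity
    have hev := (h.orAdjoint b).eventually (gt_mem_nhds hpos)
    obtain ⟨n₀, hn₀⟩ := eventually_atTop.1 hev
    filter_upwards [eventually_ge_atTop n₀] with n hn z hz x hx
    obtain ⟨w, hw, -, heq⟩ := exists_orAdjoint_sub b A z
    rw [heq]
    refine ((hmain (η / (C + 1)) n hpos.le (fun j hj => (hn₀ j (hn.trans hj)).le) w (hw ▸ hz) x hx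
      _ le_rfl).2).trans ?_
    gcongr
    rw [mul_div_assoc', div_le_iff₀ (by positivity)]
    nlinarith
  filter_upwards [hb true, hb false] with n h1 h2 z hz x hx b
  cases b
  · exact h2 z hz x hx
  · exact h1 z hz x hx

theorem sq_lt_sq_mul {a q c y : ℝ} (hc : 0 ≤ c) (hy : 0 ≤ y) (h : a ^ 2 < q * y ^ 2)
    (hq : q ≤ c ^ 2) : a < c * y := by
  refine lt_of_pow_lt_pow_left₀ 2 (by positivity) (h.trans_le ?_)
  rw [mul_pow]
  gcongr

theorem tendsto_pseudospecMap_smallPoints {f : ℕ → ℕ} {N : ℕ} {ε : ℝ} (hε : 0 < ε) {A : Op}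
    (hA : DispersionBoundedBy f A) {q : ℕ → ℚ}
    (hq : ∀ n : ℕ, (ε ^ 2 ^ N) ^ 2 < q n ∧ (q n : ℝ) < (ε ^ 2 ^ N) ^ 2 + 1 / (n + 1)) :
    Tendsto (fun n => finsetCompacts (smallPoints (2 ^ N) (q n) n (sectionSize f (2 ^ N) n) A)) atTop
      (𝓝 (pseudospecMap N hε A)) := by
  set c := ε ^ 2 ^ N with hc
  have hc0 : 0 < c := by positivity
  have hqlim := tendsto_of_rat_seq hq
  have hqev : ∀ δ > 0, ∀ᶠ n in atTop, (q n : ℝ) ≤ (c + δ) ^ 2 := fun δ hδ =>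
    (hqlim.eventually (ge_mem_nhds (by nlinarith : c ^ 2 < (c + δ) ^ 2)))
  have hk : 2 ^ N ≠ 0 := by positivity
  have hbdd : ∀ᶠ n in atTop,
      ∀ w ∈ smallPoints (2 ^ N) (q n) n (sectionSize f (2 ^ N) n) A, ‖w‖ ≤ ‖A‖ + (c + 1) := by
    filter_upwards [hqev 1 one_pos] with n hn z hz
    obtain ⟨_, x, hx, b, h⟩ := Finset.mem_filter.1 hz
    exact norm_le_of_norm_compression_pow_le (proj_eq_self_of_le (le_sectionSize _ _ _)
      (proj_of_mem_testVecs hx)) (ne_zero_of_mem_testVecs hx) hk (by linarith)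
      (sq_lt_sq_mul (by linarith) (norm_nonneg _) h hn).le
  refine tendsto_pseudospecMap_of_tests hε hbdd ?_ ?_
  · intro δ hδ
    -- Half of δ pays for the excess of the threshold, the other half for the error of the section.
    filter_upwards [hqev (δ / 2) (by positivity), hbdd,
      hA.eventually_norm_sub_le (‖A‖ + (c + 1)) (2 ^ N) (half_pos hδ)] with n hn hb happ z hz
    have hzR := hb z hz
    obtain ⟨_, x, hx, b, h⟩ := Finset.mem_filter.1 hz
    refine ⟨b, x, ne_zero_of_mem_testVecs hx, ?_⟩
    have h1 := happ z hzR x (proj_of_mem_testVecs hx) b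
    have h2 := sq_lt_sq_mul (by linarith) (norm_nonneg _) h hn
    rw [norm_sub_rev] at h1
    have h3 := norm_le_norm_add_norm_sub
      ((compression (sectionSize f (2 ^ N) n) (orAdjoint b (A - algebraMap ℂ Op z)) ^ 2 ^ N) x)
      ((orAdjoint b (A - algebraMap ℂ Op z) ^ 2 ^ N) x)
    rw [norm_sub_rev] at h1 
    linarith
  · intro z z₀ x x₀ b hx₀ hlt hz hx
    have hm : Tendsto (sectionSize f (2 ^ N)) atTop atTop :=
      tendsto_atTop_mono (le_sectionSize f _) tendsto_id
    have h1 := ((contConv_compression (ContConv.of_tendsto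
      (tendsto_orAdjoint b (tendsto_sub_algebraMap A hz))) hm).pow (2 ^ N) x x₀ hx).norm.pow 2
    have h2 : Tendsto (fun n => (q n : ℝ) * ‖x n‖ ^ 2) atTop (𝓝 (c ^ 2 * ‖x₀‖ ^ 2)) :=
      hqlim.mul (hx.norm.pow 2)
    rw [hx₀] at h2
    have hlt2 : ‖(orAdjoint b (A - algebraMap ℂ Op z₀) ^ 2 ^ N) x₀‖ ^ 2 < c ^ 2 * 1 ^ 2 := by
      rw [one_pow, mul_one]
      gcongr
    filter_upwards [h1.eventually_lt h2 hlt2] with n hn hzn hxn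
    exact Finset.mem_filter.2 ⟨hzn, x n, hxn, b, hn⟩

/-- The values of f only fix the section size at stage n, so the matrix entries are the only
evaluations consulted. -/
theorem exists_tower_pseudospecMap_of_dispersion {f : ℕ → ℕ} {Ω : Set Op} (hΩ : Ω ⊆ dispersionOps f)
    {Λ : Set (Ω → ℂ)} (hΛ : matrixEvals Ω ⊆ Λ) (N : ℕ) {ε : ℝ} (hε : 0 < ε) :
    ∃ Γ, IsTower (IsArithmeticAlgorithm Λ) (fun A : Ω => pseudospecMap N hε A.1) 1 Γ := by
  obtain ⟨p, q, hpq⟩ := exists_rat_seq ((ε ^ 2 ^ N) ^ 2)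
  refine ⟨fun l => match l with
    | [] => fun A => pseudospecMap N hε A.1
    | n :: _ => fun A =>
      finsetCompacts (∅ ∪ smallPoints (2 ^ N) (q n) n (sectionSize f (2 ^ N) n) A.1),
    rfl, ?_, ?_⟩
  · intro l hl
    obtain ⟨n, rfl⟩ := List.length_eq_one_iff.1 hl
    exact isArithmeticAlgorithm_smallPoints hΛ _ _ (le_sectionSize _ _ _) (by simp)
  · intro l hl A
    obtain rfl : l = [] := List.length_eq_zero_iff.1 (by omega)
    simpa using tendsto_pseudospecMap_smallPoints hε (hΩ A.2) fun n =>
      ⟨(hpq n).1.trans (hpq n).2.1, (hpq n).2.2⟩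

/-! ### Comparison in the limit with hysteresis -/

/-- The state after `n` values of a sequence of a switch that is turned on by values below `lo` and
turned off by values that are at least `hi`. -/
def switchState (lo hi : ℝ) (a : ℕ → ℝ) : ℕ → Prop
  | 0 => False
  | n + 1 => a n < lo ∨ (a n < hi ∧ switchState lo hi a n)

theorem switchState_congr {lo hi lo' hi' : ℝ} {a b : ℕ → ℝ} {m : ℕ}
    (h : ∀ n < m, (a n < lo ↔ b n < lo') ∧ (a n < hi ↔ b n < hi')) :
    switchState lo hi a m ↔ switchState lo' hi' b m := by
  induction m with
  | zero => rfl
  | succ m ih =>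
    have h1 := h m (by omega)
    rw [switchState, switchState, h1.1, h1.2, ih fun n hn => h n (by omega)]

/-- If l < hi, the values are eventually below hi, and a switch that is on stays on. If l ≥ hi > lo,
they are eventually above lo, and a switch that is off stays off. So the switch always settles, and
its final position locates l up to the gap. -/
theorem eventually_switchState {lo hi : ℝ} (hlohi : lo < hi) {a : ℕ → ℝ} {l : ℝ}
    (ha : Tendsto a atTop (𝓝 l)) :
    ((∀ᶠ n in atTop, switchState lo hi a n) ∧ l ≤ hi) ∨
      ((∀ᶠ n in atTop, ¬ switchState lo hi a n) ∧ lo ≤ l) := by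
  rcases lt_or_ge l hi with hl | hl
  · obtain ⟨n₀, hn₀⟩ := eventually_atTop.1 (ha.eventually (gt_mem_nhds hl))
    by_cases hex : ∃ n ≥ n₀, switchState lo hi a n
    · obtain ⟨n, hn, hs⟩ := hex
      refine .inl ⟨eventually_atTop.2 ⟨n, fun m hm => ?_⟩, hl.le⟩
      induction m, hm using Nat.le_induction with
      | base => exact hs
      | succ m hm ih => exact .inr ⟨hn₀ m (hn.trans hm), ih⟩
    · push Not at hex
      refine .inr ⟨eventually_atTop.2 ⟨n₀, hex⟩, ?_⟩
      refine ge_of_tendsto ha (eventually_atTop.2 ⟨n₀, fun n hn => ?_⟩)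
      by_contra hlt
      exact hex (n + 1) (by omega) (.inl (not_le.1 hlt))
  · obtain ⟨n₀, hn₀⟩ := eventually_atTop.1 (ha.eventually (lt_mem_nhds (hlohi.trans_le hl)))
    by_cases hex : ∃ n ≥ n₀, ¬ switchState lo hi a n
    · obtain ⟨n, hn, hs⟩ := hex
      refine .inr ⟨eventually_atTop.2 ⟨n, fun m hm => ?_⟩, hlohi.le.trans hl⟩
      induction m, hm using Nat.le_induction with
      | base => exact hs
      | succ m hm ih =>
        rintro (h | h)
        · exact absurd h (not_lt.2 (hn₀ m (hn.trans hm)).le)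
        · exact ih h.2
    · push Not at hex
      refine .inl ⟨eventually_atTop.2 ⟨n₀, hex⟩, ?_⟩
      refine le_of_tendsto ha (eventually_atTop.2 ⟨n₀, fun n hn => ?_⟩)
      rcases hex (n + 1) (by omega) with h | h
      · exact (h.trans hlohi).le
      · exact h.1.le

/-! ### A tower of height two for all bounded operators -/

/-- The squared norm that is compared with the thresholds. -/
noncomputable def testValue (k : ℕ) (A : Op) (z : ℂ) (x : L2) (b : Bool) (m : ℕ) : ℝ :=
  ‖(compression m (orAdjoint b (A - algebraMap ℂ Op z)) ^ k) x‖ ^ 2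

theorem tendsto_testValue (k : ℕ) (A : Op) (z : ℂ) (x : L2) (b : Bool) :
    Tendsto (testValue k A z x b) atTop
      (𝓝 (‖(orAdjoint b (A - algebraMap ℂ Op z) ^ k) x‖ ^ 2)) :=
  (tendsto_compression_pow _ k x).norm.pow 2

open scoped Classical in
/-- The grid points at which the switch for some test vector is on after `m` sections. -/
noncomputable def switchedPoints (k : ℕ) (p q : ℝ) (n m : ℕ) (A : Op) : Finset ℂ :=
  (grid n).filter fun z => ∃ x ∈ testVecs n, ∃ b,
    switchState (p * ‖x‖ ^ 2) (q * ‖x‖ ^ 2) (fun j => testValue k A z x b (n + j)) m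

open scoped Classical in
/-- The grid points at which the switch for some test vector is on in the limit. -/
noncomputable def limitPoints (k : ℕ) (p q : ℝ) (n : ℕ) (A : Op) : Finset ℂ :=
  (grid n).filter fun z => ∃ x ∈ testVecs n, ∃ b,
    ∀ᶠ m in atTop, switchState (p * ‖x‖ ^ 2) (q * ‖x‖ ^ 2)
      (fun j => testValue k A z x b (n + j)) m

/-- The switch depends on finitely many comparisons, with both thresholds and with section sizes n +
j; starting at n puts every test vector into the range of the projection. -/
theorem isArithmeticAlgorithm_switchedPoints {Ω : Set Op} {Λ : Set (Ω → ℂ)}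
    (hΛ : matrixEvals Ω ⊆ Λ) (k : ℕ) (p q : ℚ) (n m : ℕ) :
    IsArithmeticAlgorithm Λ fun A : Ω => finsetCompacts (switchedPoints k p q n m A.1) := by
  classical
  refine isArithmeticAlgorithm_of_signs (ι := ℂ × L2 × Bool × ℕ × Bool)
    (grid n ×ˢ testVecs n ×ˢ Finset.univ ×ˢ Finset.range m ×ˢ Finset.univ)
    (u := fun i A => (((if i.2.2.2.2 then p else q : ℚ) * ‖i.2.1‖ ^ 2 -
      ‖(compression (n + i.2.2.2.1) (orAdjoint i.2.2.1 (A.1 - algebraMap ℂ Op i.1)) ^ k) i.2.1‖ ^ 2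
      : ℝ) : ℂ)) ?_ ?_ (fun A => finite_finsetCompacts _) fun A z hz =>
      isRatComplex_of_mem_finsetCompacts (fun z hz => ?_) hz
  · rintro ⟨z, x, b, j, t⟩ hi
    simp only [Finset.mem_product, Finset.mem_univ, and_true, true_and] at hi
    exact termComputable_test hΛ b (isRatComplex_of_mem_ratGrid hi.1) (Nat.le_add_right _ _) hi.2.1
      k _
  · intro A B h
    have : switchedPoints k p q n m A.1 = switchedPoints k p q n m B.1 := by
      refine Finset.filter_congr fun z hz => ?_
      refine exists_congr fun x => and_congr_right fun hx => exists_congr fun b => ?_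
      refine switchState_congr fun j hj => ?_
      have h1 := h (z, x, b, j, true) (by simp [hz, hx, hj])
      have h2 := h (z, x, b, j, false) (by simp [hz, hx, hj])
      simp only [Complex.ofReal_re, sub_pos, if_true, Bool.false_eq_true, if_false] at h1 h2
      exact ⟨h1, h2⟩
    rw [this]
  · exact isRatComplex_of_mem_ratGrid (Finset.mem_filter.1 hz).1

/-- At a fixed stage n there are finitely many switches and each of them settles. -/
theorem eventually_switchedPoints_eq (k : ℕ) {p q : ℝ} (hpq : p < q) (n : ℕ) (A : Op) :
    ∀ᶠ m in atTop, switchedPoints k p q n m A = limitPoints k p q n A := by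
  classical
  have h : ∀ z ∈ grid n, ∀ x ∈ testVecs n, ∀ b : Bool, ∀ᶠ m in atTop,
      (switchState (p * ‖x‖ ^ 2) (q * ‖x‖ ^ 2) (fun j => testValue k A z x b (n + j)) m ↔
        ∀ᶠ m in atTop, switchState (p * ‖x‖ ^ 2) (q * ‖x‖ ^ 2)
          (fun j => testValue k A z x b (n + j)) m) := by
    intro z _ x hx b
    have hx0 : 0 < ‖x‖ := norm_pos_iff.2 (ne_zero_of_mem_testVecs hx)
    have hlohi : p * ‖x‖ ^ 2 < q * ‖x‖ ^ 2 := by gcongr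
    rcases eventually_switchState hlohi (a := fun j => testValue k A z x b (n + j))
      ((tendsto_testValue k A z x b).comp (tendsto_atTop_mono (fun j => Nat.le_add_left j n)
        tendsto_id)) with ⟨h, _⟩ | ⟨h, _⟩
    · filter_upwards [h] with m hm
      exact iff_of_true hm h
    · filter_upwards [h] with m hm
      refine iff_of_false hm fun h' => ?_
      obtain ⟨j, h1, h2⟩ := (h.and h').exists
      exact h1 h2
  have h' : ∀ᶠ m in atTop, ∀ z ∈ grid n, ∀ x ∈ testVecs n, ∀ b : Bool,
      (switchState (p * ‖x‖ ^ 2) (q * ‖x‖ ^ 2) (fun j => testValue k A z x b (n + j)) m ↔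
        ∀ᶠ m in atTop, switchState (p * ‖x‖ ^ 2) (q * ‖x‖ ^ 2)
          (fun j => testValue k A z x b (n + j)) m) := by
    rw [eventually_all_finset]
    intro z hz
    rw [eventually_all_finset]
    intro x hx
    rw [eventually_all]
    exact h z hz x hx
  filter_upwards [h'] with m hm
  refine Finset.filter_congr fun z hz => ?_
  exact exists_congr fun x => and_congr_right fun hx => exists_congr fun b => hm z hz x hx b

/-- A switch that settles on gives a limit at most q‖x‖², which yields soundness; one that settles
off gives a limit at least p‖x‖², which a strict witness eventually contradicts. -/
theorem tendsto_pseudospecMap_limitPoints {N : ℕ} {ε : ℝ} (hε : 0 < ε) (A : Op) {p q : ℕ → ℚ}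
    (hpq : ∀ n : ℕ, (ε ^ 2 ^ N) ^ 2 < p n ∧ (p n : ℝ) < q n ∧
      (q n : ℝ) < (ε ^ 2 ^ N) ^ 2 + 1 / (n + 1)) :
    Tendsto (fun n => finsetCompacts (limitPoints (2 ^ N) (p n) (q n) n A)) atTop
      (𝓝 (pseudospecMap N hε A)) := by
  classical
  set c := ε ^ 2 ^ N with hc
  have hc0 : 0 < c := by positivity
  have hqlim := tendsto_of_rat_seq fun n => ⟨(hpq n).1.trans (hpq n).2.1, (hpq n).2.2⟩
  have hplim := tendsto_of_rat_seq fun n => ⟨(hpq n).1, (hpq n).2.1.trans (hpq n).2.2⟩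
  have hqev : ∀ δ > 0, ∀ᶠ n in atTop, (q n : ℝ) < (c + δ) ^ 2 := fun δ hδ =>
    (hqlim.eventually (gt_mem_nhds (by nlinarith : c ^ 2 < (c + δ) ^ 2)))
  have hk : 2 ^ N ≠ 0 := by positivity
  have hlim : ∀ n z x b, Tendsto (fun j => testValue (2 ^ N) A z x b (n + j)) atTop
      (𝓝 (‖(orAdjoint b (A - algebraMap ℂ Op z) ^ 2 ^ N) x‖ ^ 2)) := fun n z x b =>
    (tendsto_testValue _ A z x b).comp (tendsto_atTop_mono (fun j => Nat.le_add_left j n)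
        tendsto_id)
  have hsmall : ∀ δ > 0, ∀ᶠ n in atTop, ∀ z ∈ limitPoints (2 ^ N) (p n) (q n) n A, ∃ b,
      ∃ x ∈ testVecs n,
        ‖(orAdjoint b (A - algebraMap ℂ Op z) ^ 2 ^ N) x‖ < (c + δ) * ‖x‖ := by
    intro δ hδ
    filter_upwards [hqev δ hδ] with n hn z hz
    obtain ⟨_, x, hx, b, h⟩ := Finset.mem_filter.1 hz
    have hx0 : 0 < ‖x‖ := norm_pos_iff.2 (ne_zero_of_mem_testVecs hx)
    refine ⟨b, x, hx, ?_⟩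
    have hlohi : (p n : ℝ) * ‖x‖ ^ 2 < q n * ‖x‖ ^ 2 := by
      have := (hpq n).2.1
      gcongr
    rcases eventually_switchState hlohi (hlim n z x b) with ⟨_, h'⟩ | ⟨h', _⟩
    · refine lt_of_pow_lt_pow_left₀ 2 (by positivity) (h'.trans_lt ?_)
      rw [mul_pow]
      gcongr
    · obtain ⟨j, h1, h2⟩ := (h.and h').exists
      exact absurd h1 h2
  refine tendsto_pseudospecMap_of_tests hε (R := ‖A‖ + (c + 1)) ?_ ?_ ?_
  · filter_upwards [hsmall 1 one_pos] with n hn z hz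
    obtain ⟨b, x, hx, h⟩ := hn z hz
    exact norm_le_of_norm_pow_le (proj_of_mem_testVecs hx) (ne_zero_of_mem_testVecs hx) hk
      (by linarith) h
  · intro δ hδ
    filter_upwards [hsmall δ hδ] with n hn z hz
    obtain ⟨b, x, hx, h⟩ := hn z hz
    exact ⟨b, x, ne_zero_of_mem_testVecs hx, h⟩
  · intro z z₀ x x₀ b hx₀ hlt hz hx
    have h1 := ((ContConv.of_tendsto
      (tendsto_orAdjoint b (tendsto_sub_algebraMap A hz))).pow (2 ^ N) x x₀ hx).norm.pow 2
    have h2 : Tendsto (fun n => (p n : ℝ) * ‖x n‖ ^ 2) atTop (𝓝 (c ^ 2 * ‖x₀‖ ^ 2)) :=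
      hplim.mul (hx.norm.pow 2)
    rw [hx₀] at h2
    have hlt2 : ‖(orAdjoint b (A - algebraMap ℂ Op z₀) ^ 2 ^ N) x₀‖ ^ 2 < c ^ 2 * 1 ^ 2 := by
      rw [one_pow, mul_one]
      gcongr
    filter_upwards [h1.eventually_lt h2 hlt2] with n hn hzn hxn
    refine Finset.mem_filter.2 ⟨hzn, x n, hxn, b, ?_⟩
    have hx0 : 0 < ‖x n‖ := norm_pos_iff.2 (ne_zero_of_mem_testVecs hxn)
    have hlohi : (p n : ℝ) * ‖x n‖ ^ 2 < q n * ‖x n‖ ^ 2 := by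
      have := (hpq n).2.1
      gcongr
    rcases eventually_switchState hlohi (hlim n (z n) (x n) b) with ⟨h', _⟩ | ⟨_, h'⟩
    · exact h'
    · exact absurd hn (not_lt.2 h')

theorem exists_tower_pseudospecMap {Ω : Set Op} {Λ : Set (Ω → ℂ)} (hΛ : matrixEvals Ω ⊆ Λ)
    (N : ℕ) {ε : ℝ} (hε : 0 < ε) :
    ∃ Γ, IsTower (IsArithmeticAlgorithm Λ) (fun A : Ω => pseudospecMap N hε A.1) 2 Γ := by
  obtain ⟨p, q, hpq⟩ := exists_rat_seq ((ε ^ 2 ^ N) ^ 2)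
  refine ⟨fun l => match l with
    | [] => fun A => pseudospecMap N hε A.1
    | [n] => fun A => finsetCompacts (limitPoints (2 ^ N) (p n) (q n) n A.1)
    | n :: m :: _ => fun A => finsetCompacts (switchedPoints (2 ^ N) (p n) (q n) n m A.1),
    rfl, ?_, ?_⟩
  · intro l hl
    obtain ⟨n, m, rfl⟩ := List.length_eq_two.1 hl
    exact isArithmeticAlgorithm_switchedPoints hΛ _ _ _ _ _
  · intro l hl A
    match l, hl with
    | [], _ => exact tendsto_pseudospecMap_limitPoints hε A.1 hpq
    | [n], _ =>
      refine Tendsto.congr' ?_ tendsto_const_nhds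
      filter_upwards [eventually_switchedPoints_eq (2 ^ N) (hpq n).2.1 n A.1] with m hm
      simp only [List.cons_append, List.nil_append, hm]

/-! ### Towers for the spectrum from towers for pseudospectra -/

theorem exists_tower_specMap {Ω : Set Op} {Λ : Set (Ω → ℂ)} {k : ℕ}
    (h : ∀ ε : ℝ, ∀ hε : 0 < ε,
      ∃ Γ, IsTower (IsArithmeticAlgorithm Λ) (fun A : Ω => pseudospecMap 0 hε A.1) k Γ) :
    ∃ Γ, IsTower (IsArithmeticAlgorithm Λ) (fun A : Ω => specMap A.1) (k + 1) Γ := by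
  choose Γ hΓ using fun n : ℕ => h (1 / ((n : ℝ) + 1)) (by positivity)
  refine ⟨fun l => match l with
    | [] => fun A => specMap A.1
    | n :: l => Γ n l, rfl, ?_, ?_⟩
  · rintro (_ | ⟨n, l⟩) hl
    · simp at hl
    · exact (hΓ n).lowest l (by simpa using hl)
  · rintro (_ | ⟨n, l⟩) hl A
    · refine (tendsto_pseudospecMap_specMap A.1).congr fun n => ?_
      simp only [List.nil_append, (hΓ n).top]
    · exact (hΓ n).limit l (by simpa using hl) A

/-! ### Compact operators -/

/-- Pointwise convergence of the contractions 1 - P_n to 0 is uniform on the totally bounded image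
of the unit ball. -/
theorem tendsto_norm_one_sub_proj_mul {A : Op} (hA : IsCompactOperator A) :
    Tendsto (fun n => ‖(1 - proj n) * A‖) atTop (𝓝 0) := by
  rw [Metric.tendsto_atTop]
  intro δ hδ
  have hK := hA.isCompact_closure_image_closedBall 1
  obtain ⟨t, -, htfin, ht⟩ := Metric.totallyBounded_iff.1 hK.totallyBounded (δ / 3) (by positivity)
    |>.imp fun t h => (⟨trivial, h.1, h.2⟩ : True ∧ _ ∧ _)
  have hev : ∀ᶠ n in atTop, ∀ y ∈ t, ‖(1 - proj n) y‖ < δ / 3 := by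
    refine (eventually_all_finite htfin).2 fun y _ => ?_
    have h : Tendsto (fun n => ‖(1 - proj n) y‖) atTop (𝓝 0) := by
      have := (tendsto_const_nhds (x := y)).sub (tendsto_proj_apply y)
      simpa using this.norm
    exact h.eventually (gt_mem_nhds (by positivity))
  obtain ⟨n₀, hn₀⟩ := eventually_atTop.1 hev
  refine ⟨n₀, fun n hn => ?_⟩
  rw [dist_zero_right, norm_norm]
  refine lt_of_le_of_lt (b := 2 * δ / 3) ?_ (by linarith)
  refine ContinuousLinearMap.opNorm_le_of_unit_norm (𝕜 := ℂ) (by positivity) fun x hx => ?_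
  have hmem : A x ∈ closure (A '' Metric.closedBall 0 1) :=
    subset_closure ⟨x, by simp [hx], rfl⟩
  obtain ⟨y, hy, hxy⟩ := Set.mem_iUnion₂.1 (ht hmem)
  have h1 : ((1 - proj n) * A) x = (1 - proj n) (A x - y) + (1 - proj n) y := by
    rw [mul_apply_eq_comp, ← map_add, sub_add_cancel]
  rw [h1]
  have h2 : ‖A x - y‖ < δ / 3 := by simpa [dist_eq_norm] using hxy
  calc _ ≤ ‖A x - y‖ + ‖(1 - proj n) y‖ :=
        (norm_add_le _ _).trans (by gcongr; exact norm_one_sub_proj_apply_le _ _)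
    _ ≤ _ := by linarith [hn₀ n hn y hy]

theorem norm_mul_one_sub_proj_mul_proj (A : Op) (m n : ℕ) :
    ‖proj m * A * (1 - proj n)‖ =
      ‖(1 - proj n) * ContinuousLinearMap.adjoint A * proj m‖ := by
  have hs : ∀ m, star (proj m) = proj m := fun m => by
    rw [ContinuousLinearMap.star_eq_adjoint, isSelfAdjoint_proj]
  rw [← norm_star, star_mul, star_mul, star_sub, star_one, hs, hs, mul_assoc,
    ContinuousLinearMap.star_eq_adjoint]

theorem isCompactOperator_proj (m : ℕ) : IsCompactOperator (proj m) := by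
  induction m with
  | zero =>
    have : proj 0 = 0 := by simp [proj]
    rw [this]
    exact isCompactOperator_zero
  | succ m ih =>
    have : proj (m + 1) = proj m + (innerSL ℂ (basisVec m)).smulRight (basisVec m) := by
      simp [proj, Finset.sum_range_succ]
    rw [this]
    refine ih.add ?_
    have h := isCompactOperator_of_locallyCompactSpace_rng
      (ContinuousLinearMap.toSpanSingleton ℂ (basisVec m))
    exact h.comp_clm (innerSL ℂ (basisVec m))

/-- Compactness of the adjoint of A is not needed: A is close in norm to P_m A, whose adjoint A* P_m
is compact because P_m is. -/
theorem tendsto_norm_mul_one_sub_proj {A : Op} (hA : IsCompactOperator A) :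
    Tendsto (fun n => ‖A * (1 - proj n)‖) atTop (𝓝 0) := by
  rw [Metric.tendsto_atTop]
  intro δ hδ
  obtain ⟨m, hm⟩ := ((tendsto_norm_one_sub_proj_mul hA).eventually
    (gt_mem_nhds (half_pos hδ))).exists
  have h2 : Tendsto (fun n => ‖proj m * A * (1 - proj n)‖) atTop (𝓝 0) := by
    have hc : IsCompactOperator (ContinuousLinearMap.adjoint A ∘ proj m) :=
      (isCompactOperator_proj m).clm_comp _
    have hc : IsCompactOperator (ContinuousLinearMap.adjoint A * proj m) := hc
    refine (tendsto_norm_one_sub_proj_mul hc).congr fun n => ?_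
    rw [norm_mul_one_sub_proj_mul_proj, mul_assoc]
  obtain ⟨n₀, hn₀⟩ := eventually_atTop.1 (h2.eventually (gt_mem_nhds (half_pos hδ)))
  refine ⟨n₀, fun n hn => ?_⟩
  rw [dist_zero_right, norm_norm]
  have h3 : A * (1 - proj n) = (1 - proj m) * A * (1 - proj n) + proj m * A * (1 - proj n) := by
    noncomm_ring
  rw [h3]
  calc _ ≤ ‖(1 - proj m) * A‖ * 1 + ‖proj m * A * (1 - proj n)‖ :=
        (norm_add_le _ _).trans (by
          gcongr
          exact (norm_mul_le _ _).trans (by gcongr; exact norm_one_sub_proj_le n))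
    _ < δ := by linarith [hn₀ n hn]

theorem compactOps_subset_dispersionOps {f : ℕ → ℕ} (hf : Tendsto f atTop atTop) :
    compactOps ⊆ dispersionOps f := by
  intro A hA
  have h1 := (tendsto_norm_one_sub_proj_mul hA).comp hf
  have h2 := (tendsto_norm_mul_one_sub_proj hA).comp hf
  have h3 := h1.max h2
  rw [max_self] at h3
  refine squeeze_zero (fun m => le_max_of_le_left (norm_nonneg _)) (fun m => ?_) h3
  refine max_le_max ?_ ?_
  · exact (norm_mul_le _ _).trans (mul_le_of_le_one_right (norm_nonneg _) (norm_proj_le m))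
  · rw [mul_assoc]
    exact (norm_mul_le _ _).trans (mul_le_of_le_one_left (norm_nonneg _) (norm_proj_le m))

/-! ### The spectrum of a compact operator -/

/-- Nonzero spectral points are eigenvalues. From infinitely many of modulus at least ρ,
Gram–Schmidt produces orthonormal e_k in the span of the first eigenvectors such that A e_k - μ_k
e_k lies in the span of the preceding ones. Then ⟨e_k, A e_k - A e_j⟩ = μ_k for j < k, so the images
are ρ-separated and have no convergent subsequence. -/
theorem finite_spectrum_of_isCompactOperator {A : Op} (hA : IsCompactOperator A) {ρ : ℝ}
    (hρ : 0 < ρ) : {μ ∈ spectrum ℂ A | ρ ≤ ‖μ‖}.Finite := by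
  by_contra hinf
  obtain ⟨g⟩ : Nonempty (ℕ ↪ {μ ∈ spectrum ℂ A | ρ ≤ ‖μ‖}) := ⟨Set.Infinite.natEmbedding _ hinf⟩
  set μ : ℕ → ℂ := fun k => g k with hμ
  have hμinj : Function.Injective μ := fun i j h => g.injective (Subtype.ext h)
  have hμρ : ∀ k, ρ ≤ ‖μ k‖ := fun k => (g k).2.2
  have hev : ∀ k, ∃ v, Module.End.HasEigenvector (A : Module.End ℂ L2) (μ k) v := fun k => by
    have hne : μ k ≠ 0 := fun h => by
      have := hμρ k
      rw [h, norm_zero] at this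
      linarith
    exact ((hA.hasEigenvalue_iff_mem_spectrum hne).2 (g k).2.1).exists_hasEigenvector
  choose v hv using hev
  have hlin : LinearIndependent ℂ v := Module.End.eigenvectors_linearIndependent' _ μ hμinj v hv
  have hAv : ∀ k, A (v k) = μ k • v k := fun k => (hv k).apply_eq_smul
  set e := InnerProductSpace.gramSchmidtNormed ℂ v with he
  have horth : Orthonormal ℂ e := InnerProductSpace.gramSchmidtNormed_orthonormal hlin
  have hIic : ∀ k, e k ∈ Submodule.span ℂ (v '' Set.Iic k) := fun k => by
    rw [← InnerProductSpace.span_gramSchmidt_Iic ℂ v k,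
      ← InnerProductSpace.span_gramSchmidtNormed v (Set.Iic k)]
    exact Submodule.subset_span ⟨k, le_refl k, rfl⟩
  have hperp : ∀ k, ∀ x ∈ Submodule.span ℂ (v '' Set.Iio k), inner ℂ (e k) x = 0 := fun k x hx => by
    rw [← InnerProductSpace.span_gramSchmidt_Iio ℂ v k,
      ← InnerProductSpace.span_gramSchmidtNormed v (Set.Iio k)] at hx
    refine Submodule.span_induction ?_ (inner_zero_right _) ?_ ?_ hx
    · rintro _ ⟨j, hj, rfl⟩
      exact horth.2 (ne_of_gt hj)
    · intro x y _ _ hx hy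
      rw [inner_add_right, hx, hy, add_zero]
    · intro c x _ hx
      rw [inner_smul_right, hx, mul_zero]
  have hdiff : ∀ k, A (e k) - μ k • e k ∈ Submodule.span ℂ (v '' Set.Iio k) := fun k => by
    have h : ∀ x ∈ Submodule.span ℂ (v '' Set.Iic k),
        A x - μ k • x ∈ Submodule.span ℂ (v '' Set.Iio k) := fun x hx => by
      refine Submodule.span_induction ?_ (by simp) ?_ ?_ hx
      · rintro _ ⟨j, hj, rfl⟩
        rw [hAv, ← sub_smul]
        rcases (Set.mem_Iic.1 hj).lt_or_eq with hj | rfl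
        · exact Submodule.smul_mem _ _ (Submodule.subset_span ⟨j, hj, rfl⟩)
        · simp
      · intro x y _ _ hx hy
        rw [map_add, smul_add, add_sub_add_comm]
        exact Submodule.add_mem _ hx hy
      · intro c x _ hx
        rw [map_smul, smul_comm, ← smul_sub]
        exact Submodule.smul_mem _ _ hx
    exact h _ (hIic k)
  have hAe : ∀ j, A (e j) ∈ Submodule.span ℂ (v '' Set.Iic j) := fun j => by
    have h1 : Submodule.span ℂ (v '' Set.Iio j) ≤ Submodule.span ℂ (v '' Set.Iic j) :=
      Submodule.span_mono (Set.image_mono Set.Iio_subset_Iic_self)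
    have := Submodule.add_mem _ (h1 (hdiff j)) (Submodule.smul_mem _ (μ j) (hIic j))
    rwa [sub_add_cancel] at this
  have hsep : ∀ j k, j < k → ρ ≤ ‖A (e k) - A (e j)‖ := fun j k hjk => by
    have h1 : inner ℂ (e k) (A (e k) - A (e j)) = μ k := by
      have h2 := hperp k _ (hdiff k)
      have h3 := hperp k _ (Submodule.span_mono (Set.image_mono (Set.Iic_subset_Iio.2 hjk)) (hAe j))
      rw [inner_sub_right, inner_smul_right, inner_self_eq_norm_sq_to_K, horth.1 k] at h2
      rw [inner_sub_right, h3, sub_zero]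
      simpa [sub_eq_zero] using h2
    have h4 := norm_inner_le_norm (𝕜 := ℂ) (e k) (A (e k) - A (e j))
    rw [h1, horth.1 k, one_mul] at h4
    exact (hμρ k).trans h4
  obtain ⟨K, hK, hK'⟩ := hA.image_closedBall_subset_compact 1
  obtain ⟨y, -, ψ, hψ, hψy⟩ := hK.tendsto_subseq (x := fun k => A (e k)) fun k =>
    hK' ⟨e k, by simp [horth.1 k], rfl⟩
  obtain ⟨n₀, hn₀⟩ := Metric.cauchySeq_iff'.1 hψy.cauchySeq ρ hρ
  have h1 := hn₀ (n₀ + 1) (by omega)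
  rw [dist_eq_norm] at h1
  exact absurd h1 (not_lt.2 (hsep _ _ (hψ (Nat.lt_succ_self n₀))))

/-- Only finitely many spectral points have modulus at least ‖l‖/2, and a radius below ‖l‖/2 that
differs from all their distances to l will do. -/
theorem exists_sphere_subset_resolventSet {A : Op} (hA : IsCompactOperator A) {l : ℂ} (hl : l ≠ 0)
    {δ : ℝ} (hδ : 0 < δ) : ∃ r, 0 < r ∧ r < δ ∧ Metric.sphere l r ⊆ resolventSet ℂ A := by
  have hl' : 0 < ‖l‖ := norm_pos_iff.2 hl
  have hfin := (finite_spectrum_of_isCompactOperator hA (half_pos hl')).image fun μ => dist μ l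
  have hm : 0 < min δ (‖l‖ / 2) := lt_min hδ (by positivity)
  obtain ⟨r, hr, hrF⟩ := (Set.Ioo_infinite hm).exists_notMem_finite hfin
  refine ⟨r, hr.1, hr.2.trans_le (min_le_left _ _), fun z hz => ?_⟩
  by_contra hsp
  refine hrF ⟨z, ⟨hsp, ?_⟩, hz⟩
  have h1 : ‖l‖ ≤ ‖z‖ + ‖l - z‖ := norm_le_norm_add_norm_sub' _ _
  have h2 : ‖l - z‖ = r := by rw [← dist_eq_norm, dist_comm]; exact hz
  have h3 := hr.2.trans_le (min_le_right _ _)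
  linarith

/-- Lower semicontinuity of the spectrum at points that are separated from the rest of the spectrum
by small circles. -/
theorem eventually_exists_mem_spectrum_near {A : Op} {l : ℂ} (hl : l ∈ spectrum ℂ A) {δ : ℝ}
    (hcirc : ∃ r, 0 < r ∧ r < δ ∧ Metric.sphere l r ⊆ resolventSet ℂ A) {B : ℕ → Op}
    (hB : Tendsto B atTop (𝓝 A)) : ∀ᶠ n in atTop, ∃ μ ∈ spectrum ℂ (B n), dist μ l < δ := by
  obtain ⟨r, hr, hrδ, hsub⟩ := hcirc
  have hcont : ContinuousOn (resolvent A) (Metric.sphere l r) := fun z hz =>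
    (spectrum.hasDerivAt_resolvent_const_left (hsub hz)).continuousAt.continuousWithinAt
  obtain ⟨C₀, hC₀⟩ := (isCompact_sphere l r).exists_bound_of_continuousOn hcont
  set C := max C₀ 1 with hCdef
  have hC1 : 1 ≤ C := le_max_right _ _
  have hC : ∀ z ∈ Metric.sphere l r, ‖resolvent A z‖ ≤ C := fun z hz => (hC₀ z hz).trans (le_max_left _ _)
  have hev := (tendsto_iff_norm_sub_tendsto_zero.1 hB).eventually
    (gt_mem_nhds (show (0 : ℝ) < 1 / (2 * C) by positivity))
  filter_upwards [hev] with n hn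
  by_contra hcon
  push Not at hcon
  have hres : Metric.closedBall l r ⊆ resolventSet ℂ (B n) := fun z hz => by
    by_contra hsp
    exact absurd (hcon z hsp) (not_le.2 ((Metric.mem_closedBall.1 hz).trans_lt hrδ))
  -- The resolvent identity with ‖B_n - A‖ < 1/(2C) allows the resolvent norm on the circle at most
  -- to double.
  have hsph : ∀ z ∈ Metric.sphere l r, ‖resolvent (B n) z‖ ≤ 2 * C := fun z hz => by
    have hz1 : IsUnit (algebraMap ℂ Op z - A) := hsub hz
    have hz2 : IsUnit (algebraMap ℂ Op z - B n) := hres (Metric.sphere_subset_closedBall hz)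
    have hid : resolvent (B n) z = resolvent A z + resolvent (B n) z * (B n - A) * resolvent A z := by
      have h : B n - A = (algebraMap ℂ Op z - A) - (algebraMap ℂ Op z - B n) := by abel
      rw [h, mul_sub, sub_mul, resolvent, resolvent, mul_assoc, Ring.mul_inverse_cancel _ hz1,
        Ring.inverse_mul_cancel _ hz2]
      simp
    have h1 : ‖resolvent (B n) z‖ ≤ C + ‖resolvent (B n) z‖ * (1 / (2 * C)) * C := by
      conv_lhs => rw [hid]
      refine (norm_add_le _ _).trans (add_le_add (hC z hz) ?_)
      refine (norm_mul_le _ _).trans ?_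
      gcongr
      · exact (norm_mul_le _ _).trans (by gcongr)
      · exact hC z hz
    have h2 : ‖resolvent (B n) z‖ * (1 / (2 * C)) * C = ‖resolvent (B n) z‖ / 2 := by
      field_simp
    linarith
  -- If the disc were free of spectrum of B_n, the maximum principle would carry the bound to its
  -- centre l, and a Neumann series would then put l into the resolvent set of A.
  have hlB : ‖resolvent (B n) l‖ ≤ 2 * C := by
    refine Complex.norm_le_of_forall_mem_frontier_norm_le (U := Metric.ball l r)
      Metric.isBounded_ball ?_ ?_ (subset_closure (Metric.mem_ball_self hr))
    · refine DifferentiableOn.diffContOnCl fun z hz => ?_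
      rw [closure_ball _ hr.ne'] at hz
      exact (spectrum.hasDerivAt_resolvent_const_left
        (hres hz)).differentiableAt.differentiableWithinAt
    · rw [frontier_ball _ hr.ne']
      exact hsph
  have hlu : IsUnit (algebraMap ℂ Op l - B n) := hres (Metric.mem_closedBall_self hr.le)
  have hunit : IsUnit (1 - resolvent (B n) l * (A - B n)) := by
    apply isUnit_one_sub_of_norm_lt_one
    rw [norm_sub_rev] at hn
    calc _ ≤ ‖resolvent (B n) l‖ * ‖A - B n‖ := norm_mul_le _ _
      _ ≤ 2 * C * ‖A - B n‖ := by gcongr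
      _ < 2 * C * (1 / (2 * C)) := by gcongr
      _ = 1 := by field_simp
  refine hl ?_
  have := hlu.mul hunit
  rwa [mul_sub, mul_one, ← mul_assoc, resolvent, Ring.mul_inverse_cancel _ hlu, one_mul,
    sub_sub_sub_cancel_right] at this

theorem isCompactOperator_compression (m : ℕ) (A : Op) : IsCompactOperator (compression m A) := by
  have h : IsCompactOperator ((proj m * A) ∘ proj m) := (isCompactOperator_proj m).clm_comp _
  exact h

theorem tendsto_compression_of_isCompactOperator {A : Op} (hA : IsCompactOperator A) :
    Tendsto (fun n => compression n A) atTop (𝓝 A) := by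
  rw [tendsto_iff_norm_sub_tendsto_zero]
  have h := (tendsto_norm_one_sub_proj_mul hA).add (tendsto_norm_mul_one_sub_proj hA)
  rw [add_zero] at h
  refine squeeze_zero (fun _ => norm_nonneg _) (fun n => ?_) h
  have h1 : compression n A - A = -((1 - proj n) * A) - proj n * (A * (1 - proj n)) := by
    rw [compression]; noncomm_ring
  rw [h1]
  refine (norm_sub_le _ _).trans ?_
  rw [norm_neg]
  gcongr
  exact (norm_mul_le _ _).trans (mul_le_of_le_one_left (norm_nonneg _) (norm_proj_le n))

theorem compression_sub_apply {n : ℕ} (A : Op) (z : ℂ) {x : L2} (hx : proj n x = x) :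
    compression n (A - algebraMap ℂ Op z) x = compression n A x - z • x := by
  simp [compression, hx, Algebra.algebraMap_eq_smul_one]

/-- An eigenvector for μ ≠ 0 lies in the range of P_n. With s = 1/(n+1), rounding it and μ leaves a
residual of at most (2R+3)s², whereas the test allows s‖x‖ with ‖x‖ > 1/2; the condition on n makes
(2R+3)s ≤ 1/2. -/
theorem exists_mem_smallPoints {A : Op} {R : ℝ} (hAR : ‖A‖ ≤ R) {n : ℕ}
    (hn : 4 * R + 6 ≤ n) {μ : ℂ} (hμ : μ ∈ spectrum ℂ (compression n A)) (hμ0 : μ ≠ 0)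
    (hμn : ‖μ‖ ≤ R + 1) :
    ∃ w ∈ smallPoints 1 (((n : ℝ) + 1)⁻¹ ^ 2) n n A, ‖w - μ‖ ≤ 1 / ((n : ℝ) + 1) := by
  classical
  have hR : 0 ≤ R := (norm_nonneg A).trans hAR
  obtain ⟨s, hs⟩ : ∃ s : ℝ, s = 1 / ((n : ℝ) + 1) := ⟨_, rfl⟩
  rw [← hs, inv_eq_one_div, ← hs]
  have hs0 : 0 < s := by rw [hs]; positivity
  have hsn : s * (n + 1) = 1 := by rw [hs]; field_simp
  have hs1 : s * (4 * R + 7) ≤ 1 := by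
    rw [← hsn]
    exact mul_le_mul_of_nonneg_left (by linarith) hs0.le
  obtain ⟨v, hv⟩ := ((isCompactOperator_compression n A).hasEigenvalue_iff_mem_spectrum
    hμ0).2 hμ |>.exists_hasEigenvector
  have hv0 : v ≠ 0 := hv.2
  have hAv : compression n A v = μ • v := hv.apply_eq_smul
  set u : L2 := (‖v‖⁻¹ : ℂ) • v with hu
  have hu1 : ‖u‖ = 1 := by
    rw [hu, norm_smul]; simp [hv0]
  have hAu : compression n A u = μ • u := by
    rw [hu, map_smul, hAv, smul_comm]
  have hPu : proj n u = u := by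
    have h : proj n (μ • u) = μ • u := by
      rw [← hAu, compression, mul_assoc, mul_apply_eq_comp, ← mul_apply_eq_comp (proj n) (proj n),
        proj_mul_proj, min_self]
    rw [map_smul] at h
    exact (smul_right_injective L2 hμ0) h
  have hs2 : 1 / ((n : ℝ) + 1) ^ 2 = s ^ 2 := by rw [hs, div_pow, one_pow]
  have hs3 : 1 / ((n : ℝ) + 1) ^ 3 = s ^ 3 := by rw [hs, div_pow, one_pow]
  have hslt : s ≤ 1 / 7 := by nlinarith
  obtain ⟨x, hx, hxu⟩ := exists_mem_testVecs (n := n) hu1.le (by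
    rw [hPu, hu1, hs2]; nlinarith)
  rw [hPu, hs2] at hxu
  obtain ⟨w, hw, hwμ⟩ := exists_mem_grid (n := n) (z := μ) (by linarith)
  rw [hs3] at hwμ
  have hs3' : s ^ 3 ≤ s ^ 2 := pow_le_pow_of_le_one hs0.le (by linarith) (by norm_num)
  have hs2' : s ^ 2 ≤ s * (1 / 7) := by rw [sq]; gcongr
  refine ⟨w, Finset.mem_filter.2 ⟨hw, x, hx, true, ?_⟩, by linarith⟩
  have hPx := proj_of_mem_testVecs hx
  have hcompn : ‖compression n A‖ ≤ R := by
    calc ‖compression n A‖ ≤ ‖proj n‖ * ‖A‖ * ‖proj n‖ :=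
          (norm_mul_le _ _).trans (by gcongr; exact norm_mul_le _ _)
      _ ≤ 1 * R * 1 := by gcongr <;> exact norm_proj_le n
      _ = R := by ring
  have h1 : (compression n (orAdjoint true (A - algebraMap ℂ Op w)) ^ 1) x =
      compression n A (x - u) - w • (x - u) + (μ - w) • u := by
    simp only [orAdjoint, if_true, pow_one]
    rw [compression_sub_apply A w hPx, map_sub, hAu]
    module
  have hwR : ‖w‖ ≤ R + 2 := by
    have := norm_le_norm_add_norm_sub μ w
    rw [norm_sub_rev] at this
    linarith
  have h2 : ‖(compression n (orAdjoint true (A - algebraMap ℂ Op w)) ^ 1) x‖ ≤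
      (2 * R + 3) * s ^ 2 := by
    rw [h1]
    calc _ ≤ ‖compression n A (x - u)‖ + ‖w • (x - u)‖ + ‖(μ - w) • u‖ :=
          (norm_add_le _ _).trans (by gcongr; exact norm_sub_le _ _)
      _ ≤ R * s ^ 2 + (R + 2) * s ^ 2 + s ^ 3 * 1 := by
          rw [norm_smul, norm_smul, hu1, norm_sub_rev μ w]
          gcongr
          exact (ContinuousLinearMap.le_of_opNorm_le _ hcompn _).trans (by gcongr)
      _ ≤ _ := by linarith
  have h3 : (1 : ℝ) / 2 < ‖x‖ := by
    have := norm_le_norm_add_norm_sub' u x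
    rw [hu1, norm_sub_rev] at this
    linarith
  have h4 : (2 * R + 3) * s ^ 2 < s * ‖x‖ := by
    have h5 : (2 * R + 3) * s ≤ 1 / 2 := by linarith
    calc (2 * R + 3) * s ^ 2 = s * ((2 * R + 3) * s) := by ring
      _ ≤ s * (1 / 2) := mul_le_mul_of_nonneg_left h5 hs0.le
      _ < s * ‖x‖ := mul_lt_mul_of_pos_left h3 hs0
  rw [← mul_pow]
  exact pow_lt_pow_left₀ (h2.trans_lt h4) (norm_nonneg _) two_ne_zero

/-- If A were invertible, 1 - P_n = (1 - P_n) A A⁻¹ would tend to 0 in norm, although it fixes a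
unit vector. -/
theorem zero_mem_spectrum_of_isCompactOperator {A : Op} (hA : IsCompactOperator A) :
    (0 : ℂ) ∈ spectrum ℂ A := by
  intro h0
  have hu : IsUnit A := by
    have := isUnit_sub_algebraMap_iff.2 h0
    simpa using this
  have h1 := ((tendsto_norm_one_sub_proj_mul hA).mul_const ‖Ring.inverse A‖)
  rw [zero_mul] at h1
  obtain ⟨n, hn⟩ := (h1.eventually (gt_mem_nhds one_pos)).exists
  have h2 : (1 - proj n) * A * Ring.inverse A = 1 - proj n := by
    rw [mul_assoc, Ring.mul_inverse_cancel _ hu, mul_one]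
  have h3 : ‖(1 - proj n) (basisVec n)‖ = 1 := by
    have : (1 - proj n) (basisVec n) = basisVec n := by
      rw [sub_apply, one_apply_eq_self, sub_eq_self, proj_apply]
      refine Finset.sum_eq_zero fun i hi => ?_
      rw [basisVec_apply, if_neg (Finset.mem_range.1 hi).ne, zero_smul]
    rw [this, norm_basisVec]
  have h4 := (1 - proj n).le_opNorm (basisVec n)
  rw [h3, norm_basisVec, mul_one, ← h2] at h4
  linarith [norm_mul_le ((1 - proj n) * A) (Ring.inverse A)]

theorem tendsto_specMap_smallPoints {A : Op} (hA : IsCompactOperator A) :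
    Tendsto (fun n : ℕ => finsetCompacts ({0} ∪ smallPoints 1 (((n : ℝ) + 1)⁻¹ ^ 2) n n A)) atTop
      (𝓝 (specMap A)) := by
  have hqlim : Tendsto (fun n : ℕ => ((n : ℝ) + 1)⁻¹) atTop (𝓝 0) := by
    simpa [one_div] using (tendsto_one_div_add_atTop_nhds_zero_nat (𝕜 := ℝ))
  have hq1 : ∀ n : ℕ, ((n : ℝ) + 1)⁻¹ ≤ 1 := fun n => inv_le_one_of_one_le₀ (by simp)
  have hq0 : ∀ n : ℕ, 0 < ((n : ℝ) + 1)⁻¹ := fun n => by positivity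
  have htest : ∀ n : ℕ, ∀ w ∈ smallPoints 1 (((n : ℝ) + 1)⁻¹ ^ 2) n n A, ∃ x ∈ testVecs n, ∃ b,
      ‖(compression n (orAdjoint b (A - algebraMap ℂ Op w)) ^ 1) x‖ < ((n : ℝ) + 1)⁻¹ * ‖x‖ := by
    intro n w hw
    obtain ⟨_, x, hx, b, h⟩ := Finset.mem_filter.1 hw
    exact ⟨x, hx, b, sq_lt_sq_mul (hq0 n).le (norm_nonneg _) h le_rfl⟩
  have hlim := tendsto_compression_of_isCompactOperator hA
  refine tendsto_finsetCompacts (R := ‖A‖ + 1) (.of_forall fun n w hw => ?_) ?_ ?_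
  · rcases Finset.mem_union.1 hw with hw | hw
    · rw [Finset.mem_singleton.1 hw, norm_zero]
      positivity
    · obtain ⟨x, hx, b, h⟩ := htest n w hw
      refine norm_le_of_norm_compression_pow_le (proj_of_mem_testVecs hx)
        (ne_zero_of_mem_testVecs hx) one_ne_zero le_rfl (h.le.trans ?_)
      gcongr
      exact hq1 n
  · intro z hz δ hδ
    by_cases hz0 : z = 0
    · exact .of_forall fun n => ⟨0, by simp, by simpa [hz0] using hδ⟩
    have hz' : 0 < ‖z‖ := norm_pos_iff.2 hz0
    -- The three bounds give closeness, μ ≠ 0, and ‖μ‖ ≤ ‖A‖ + 1.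
    have hm : 0 < min (δ / 2) (min ‖z‖ 1) := by positivity
    have hzA : ‖z‖ ≤ ‖A‖ := spectrum.norm_le_norm_of_mem hz
    obtain ⟨k, hk⟩ := exists_nat_ge (4 * ‖A‖ + 6)
    filter_upwards [eventually_exists_mem_spectrum_near hz
      (exists_sphere_subset_resolventSet hA hz0 hm) hlim, eventually_ge_atTop k,
      hqlim.eventually (gt_mem_nhds (half_pos hδ))] with n ⟨μ, hμ, hd⟩ hkn hn
    have hd1 := hd.trans_le (min_le_left _ _)
    have hd2 := hd.trans_le ((min_le_right _ _).trans (min_le_left _ _))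
    have hd3 := hd.trans_le ((min_le_right _ _).trans (min_le_right _ _))
    have hkn' : (k : ℝ) ≤ n := by exact_mod_cast hkn
    obtain ⟨w, hw, hwμ⟩ := exists_mem_smallPoints (A := A) le_rfl (n := n) (by linarith) hμ
      (fun h => by rw [h, dist_eq_norm, zero_sub, norm_neg] at hd2; exact lt_irrefl _ hd2) (by
        rw [dist_eq_norm] at hd3
        have := norm_le_norm_add_norm_sub z μ
        rw [norm_sub_rev] at this
        linarith [norm_le_norm_add_norm_sub z μ])
    refine ⟨w, Finset.mem_union_right _ hw, (dist_triangle w μ z).trans_lt ?_⟩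
    rw [dist_eq_norm w μ]
    rw [one_div] at hwμ
    linarith
  · intro z hz
    have hu : IsUnit (A - algebraMap ℂ Op z) := isUnit_sub_algebraMap_iff.2 (by
      by_contra h; exact hz h)
    obtain ⟨k₀, hk₀⟩ := exists_nat_gt ‖Ring.inverse (A - algebraMap ℂ Op z)‖
    have hzk : z ∉ pseudospectrum 0 (1 / ((k₀ : ℝ) + 1)) A := by
      rw [not_mem_pseudospectrum_iff (by positivity)]
      refine ⟨hu, ?_⟩
      simp only [pow_zero, pow_one, one_div_one_div]
      linarith
    obtain ⟨ρ, hρ, η, hη, h⟩ := exists_nhds_bounded_below (by positivity) hzk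
    have hz0 : z ≠ 0 := fun h0 => hz (h0 ▸ zero_mem_spectrum_of_isCompactOperator hA)
    have hz0' : 0 < ‖z‖ := norm_pos_iff.2 hz0
    refine ⟨min ρ ‖z‖, by positivity, ?_⟩
    filter_upwards [hqlim.eventually (gt_mem_nhds (half_pos hη)),
      (tendsto_iff_norm_sub_tendsto_zero.1 hlim).eventually (gt_mem_nhds (half_pos hη))]
      with n hn1 hn2 w hw
    by_contra hlt
    push Not at hlt
    rcases Finset.mem_union.1 hw with hw | hw
    · rw [Finset.mem_singleton.1 hw, dist_zero_left] at hlt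
      exact absurd hlt (not_lt.2 (min_le_right _ _))
    obtain ⟨x, hx, b, hxw⟩ := htest n w hw
    have hx0 : 0 < ‖x‖ := norm_pos_iff.2 (ne_zero_of_mem_testVecs hx)
    have h1 := h w (hlt.trans_le (min_le_left _ _)) b x
    rw [pow_zero, pow_one, pow_one] at h1
    rw [pow_one] at hxw
    obtain ⟨w', -, -, hw'⟩ := exists_orAdjoint_sub b A w
    rw [hw'] at h1 hxw
    rw [compression_sub_apply _ _ (proj_of_mem_testVecs hx)] at hxw
    -- The test and the norm error of the section cost η/2 each, less than the lower bound 1/(k₀+1)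
    -- + η valid near z.
    have h2 : ‖(compression n (orAdjoint b A) - orAdjoint b A) x‖ ≤ η / 2 * ‖x‖ := by
      refine ContinuousLinearMap.le_of_opNorm_le _ (le_of_eq_of_le ?_ hn2.le) x
      rw [← norm_orAdjoint b (compression n A - A)]
      cases b
      · simp [orAdjoint, adjoint_compression]
      · simp [orAdjoint]
    have h3 : (orAdjoint b A - algebraMap ℂ Op w') x =
        (compression n (orAdjoint b A) x - w' • x) -
          (compression n (orAdjoint b A) - orAdjoint b A) x := by
      simp [Algebra.algebraMap_eq_smul_one]
    rw [h3] at h1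
    have h4 := h1.trans (norm_sub_le _ _)
    have h5 : 0 < 1 / ((k₀ : ℝ) + 1) := by positivity
    have h6 : ((n : ℝ) + 1)⁻¹ * ‖x‖ ≤ η / 2 * ‖x‖ := by gcongr
    have h7 : 0 < 1 / ((k₀ : ℝ) + 1) * ‖x‖ := by positivity
    nlinarith

theorem exists_tower_specMap_of_compact {Ω : Set Op} (hΩ : Ω ⊆ compactOps) {Λ : Set (Ω → ℂ)}
    (hΛ : matrixEvals Ω ⊆ Λ) :
    ∃ Γ, IsTower (IsArithmeticAlgorithm Λ) (fun A : Ω => specMap A.1) 1 Γ := by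
  refine ⟨fun l => match l with
    | [] => fun A => specMap A.1
    | n :: _ => fun A => finsetCompacts ({0} ∪ smallPoints 1 (((n : ℝ) + 1)⁻¹ ^ 2) n n A.1),
    rfl, ?_, ?_⟩
  · intro l hl
    obtain ⟨n, rfl⟩ := List.length_eq_one_iff.1 hl
    have := isArithmeticAlgorithm_smallPoints hΛ 1 (((n : ℚ) + 1)⁻¹ ^ 2) (le_refl n) (S₀ := {0})
      (by simpa using isRatComplex_zero)
    simpa using this
  · intro l hl A
    obtain rfl : l = [] := List.length_eq_zero_iff.1 (by omega)
    exact tendsto_specMap_smallPoints (hΩ A.2)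

/-! ### Lower bounds for towers by Baire category -/

theorem continuous_infDist_nonemptyCompacts (z : ℂ) :
    Continuous fun K : TopologicalSpace.NonemptyCompacts ℂ => Metric.infDist z (K : Set ℂ) :=
  (Metric.lipschitz_infDist_set (α := ℂ) z).continuous

/-- The finitely many evaluations consulted at `a x` keep their values near `x`, hence so does the
output. -/
theorem IsGeneralAlgorithm.isLocallyConstant_comp {Ω M X : Type*} [TopologicalSpace X]
    {Λ : Set (Ω → ℂ)} {Γ : Ω → M} (hΓ : IsGeneralAlgorithm Λ Γ) {a : X → Ω}
    (ha : ∀ φ ∈ Λ, IsLocallyConstant fun x => φ (a x)) : IsLocallyConstant fun x => Γ (a x) := by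
  obtain ⟨L, hL⟩ := hΓ
  rw [IsLocallyConstant.iff_eventually_eq]
  intro x
  obtain ⟨hfin, hsub, h⟩ := hL (a x)
  have h1 : ∀ᶠ y in 𝓝 x, ∀ φ ∈ L (a x), φ (a y) = φ (a x) := by
    rw [hfin.eventually_all]
    exact fun φ hφ => (IsLocallyConstant.iff_eventually_eq _).1 (ha φ (hsub hφ)) x
  filter_upwards [h1] with y hy using (h (a y) hy).1

theorem exists_agree_subset_of_mem_nhds {s : Set (ℕ → ℕ → Bool)} {x : ℕ → ℕ → Bool}
    (hs : s ∈ 𝓝 x) : ∃ n : ℕ, ∀ y : ℕ → ℕ → Bool, (∀ i < n, ∀ j < n, y i j = x i j) → y ∈ s := by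
  rw [nhds_pi, Filter.mem_pi] at hs
  obtain ⟨I, hI, t, ht, hts⟩ := hs
  have h1 : ∀ i, ∃ J : Set ℕ, J.Finite ∧ ∀ v : ℕ → Bool, (∀ j ∈ J, v j = x i j) → v ∈ t i := by
    intro i
    have h := ht i
    rw [nhds_pi, Filter.mem_pi] at h
    obtain ⟨J, hJ, u, hu, hut⟩ := h
    refine ⟨J, hJ, fun v hv => hut fun j hj => ?_⟩
    rw [hv j hj]
    exact mem_of_mem_nhds (hu j)
  choose J hJ hJt using h1
  obtain ⟨n, hn⟩ := (hI.union (hI.biUnion fun i _ => hJ i)).bddAbove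
  refine ⟨n + 1, fun y hy => hts fun i hi => hJt i _ fun j hj => hy i ?_ j ?_⟩
  · exact Nat.lt_succ_of_le (hn (Or.inl hi))
  · exact Nat.lt_succ_of_le (hn (Or.inr (Set.mem_biUnion hi hj)))

theorem exists_agree_subset_of_mem_nhds' {s : Set (ℕ → Bool)} {x : ℕ → Bool}
    (hs : s ∈ 𝓝 x) : ∃ n : ℕ, ∀ y : ℕ → Bool, (∀ i < n, y i = x i) → y ∈ s := by
  rw [nhds_pi, Filter.mem_pi] at hs
  obtain ⟨I, hI, t, ht, hts⟩ := hs
  obtain ⟨n, hn⟩ := hI.bddAbove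
  refine ⟨n + 1, fun y hy => hts fun i hi => ?_⟩
  rw [hy i (Nat.lt_succ_of_le (hn hi))]
  exact mem_of_mem_nhds (ht i)

theorem isGδ_infinitely_often {X : Type*} [TopologicalSpace X] {c : ℕ → X → Bool}
    (hc : ∀ j, Continuous (c j)) : IsGδ {x : X | ∀ n, ∃ j ≥ n, c j x = true} := by
  have : {x : X | ∀ n, ∃ j ≥ n, c j x = true} = ⋂ n, ⋃ j, ⋃ (_ : j ≥ n), c j ⁻¹' {true} := by
    ext x
    simp
  rw [this]
  exact IsGδ.iInter_of_isOpen fun n => isOpen_iUnion fun j => isOpen_iUnion fun _ =>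
    (isOpen_discrete _).preimage (hc j)

/-- The Baire category argument: a pointwise limit of continuous functions cannot separate the
sequences that are eventually zero from those that are not. -/
theorem not_separated_of_tendsto {h : ℕ → (ℕ → Bool) → ℝ} (hc : ∀ n, Continuous (h n))
    {g : (ℕ → Bool) → ℝ} (hg : ∀ x, Tendsto (fun n => h n x) atTop (𝓝 (g x))) {α β : ℝ}
    (hαβ : α < β) (hfin : ∀ x : ℕ → Bool, (∃ n, ∀ j ≥ n, x j = false) → g x ≤ α)
    (hinf : ∀ x : ℕ → Bool, (∀ n, ∃ j ≥ n, x j = true) → β ≤ g x) : False := by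
  obtain ⟨γ, h1, h2⟩ := exists_between hαβ
  have hG : IsGδ {x : ℕ → Bool | ∀ n, ∃ j ≥ n, x j = true} :=
    isGδ_infinitely_often (c := fun j (x : ℕ → Bool) => x j) fun j => continuous_apply j
  have hd : Dense {x : ℕ → Bool | ∀ n, ∃ j ≥ n, x j = true} := by
    intro x
    rw [mem_closure_iff_nhds]
    intro s hs
    obtain ⟨n, hn⟩ := exists_agree_subset_of_mem_nhds' hs
    exact ⟨fun j => if j < n then x j else true, hn _ fun i hi => if_pos hi,
      fun k => ⟨max k n, le_max_left _ _, if_neg (not_lt.2 (le_max_right _ _))⟩⟩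
  -- These closed sets cover a dense Gδ set, so one of them has interior points.
  have hC : ∀ k, IsClosed (⋂ n ≥ k, {x | γ ≤ h n x}) := fun k =>
    isClosed_biInter fun n _ => isClosed_le continuous_const (hc n)
  have hcov : {x : ℕ → Bool | ∀ n, ∃ j ≥ n, x j = true} ⊆ ⋃ k, ⋂ n ≥ k, {x | γ ≤ h n x} := by
    intro x hx
    obtain ⟨k, hk⟩ := eventually_atTop.1
      ((hg x).eventually (lt_mem_nhds (h2.trans_le (hinf x hx))))
    exact Set.mem_iUnion.2 ⟨k, Set.mem_iInter₂.2 fun n hn => (hk n hn).le⟩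
  obtain ⟨x, hx⟩ := (hG.dense_iUnion_interior_of_closed hd hC hcov).nonempty
  obtain ⟨k, hk⟩ := Set.mem_iUnion.1 hx
  obtain ⟨n, hn⟩ := exists_agree_subset_of_mem_nhds' (mem_interior_iff_mem_nhds.1 hk)
  -- Replacing a far tail by zeros stays in the interior but makes the sequence eventually zero.
  have hy := hn (fun j => if j < n then x j else false) fun i hi => if_pos hi
  have hle := hfin (fun j => if j < n then x j else false) ⟨n, fun j hj => if_neg (not_lt.2 hj)⟩
  refine absurd (ge_of_tendsto (hg _) (eventually_atTop.2 ⟨k, fun m hm => ?_⟩)) (not_le.2 (hle.trans_lt h1))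
  exact Set.mem_iInter₂.1 hy m hm

/-- One stage of a diagonal construction. With the columns before k frozen, Baire's theorem finds m
≥ k and a finite square of entries that force `γ ≤ g m`, as it does for a generic column k with
infinitely many ones. The square being finite, column k can then be made eventually zero without
losing the conclusion, whatever the later columns do outside the square. -/
theorem exists_cylinder_step {h : ℕ → ℕ → (ℕ → ℕ → Bool) → ℝ} (hc : ∀ m n, Continuous (h m n))
    {g : ℕ → (ℕ → ℕ → Bool) → ℝ} (hg : ∀ m x, Tendsto (fun n => h m n x) atTop (𝓝 (g m x)))
    {γ : ℝ} (hinf : ∀ x : ℕ → ℕ → Bool, (∃ k, ∀ n, ∃ j ≥ n, x k j = true) →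
      ∀ᶠ m in atTop, γ < g m x) (k : ℕ) (w : ℕ → ℕ → Bool) (b : ℕ) :
    ∃ w' : ℕ → ℕ → Bool, ∃ b' m : ℕ, b ≤ b' ∧ k ≤ m ∧ (∀ i < k, w' i = w i) ∧
      (∀ i < b, ∀ j < b, w' i j = w i j) ∧ (∃ n, ∀ j ≥ n, w' k j = false) ∧
      ∀ y : ℕ → ℕ → Bool, (∀ i ≤ k, y i = w' i) → (∀ i < b', ∀ j < b', y i j = w' i j) →
        γ ≤ g m y := by
  set Φ : (ℕ → ℕ → Bool) → ℕ → ℕ → Bool := fun y i => if i < k then w i else y i with hΦ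
  have hΦc : Continuous Φ := continuous_pi fun i => by
    by_cases hi : i < k
    · simp only [hΦ, if_pos hi]
      exact continuous_const
    · simp only [hΦ, if_neg hi]
      exact continuous_apply i
  have hΦk : ∀ y, Φ y k = y k := fun y => if_neg (lt_irrefl k)
  have hG : IsGδ {x : ℕ → ℕ → Bool | ∀ n, ∃ j ≥ n, x k j = true} :=
    isGδ_infinitely_often (c := fun j (x : ℕ → ℕ → Bool) => x k j) fun j => continuous_apply_apply k j
  have hd : Dense {x : ℕ → ℕ → Bool | ∀ n, ∃ j ≥ n, x k j = true} := by
    intro x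
    rw [mem_closure_iff_nhds]
    intro s hs
    obtain ⟨n, hn⟩ := exists_agree_subset_of_mem_nhds hs
    exact ⟨fun i j => if j < n then x i j else true, hn _ fun i _ j hj => if_pos hj,
      fun l => ⟨max l n, le_max_left _ _, if_neg (not_lt.2 (le_max_right _ _))⟩⟩
  have hC : ∀ q : ℕ × ℕ, IsClosed (⋂ n ≥ q.2, {x | γ ≤ h (k + q.1) n (Φ x)}) := fun q =>
    isClosed_biInter fun n _ => isClosed_le continuous_const ((hc _ n).comp hΦc)
  have hcov : {x : ℕ → ℕ → Bool | ∀ n, ∃ j ≥ n, x k j = true} ⊆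
      ⋃ q : ℕ × ℕ, ⋂ n ≥ q.2, {x | γ ≤ h (k + q.1) n (Φ x)} := by
    intro x hx
    obtain ⟨l, hl⟩ := eventually_atTop.1 (hinf (Φ x) ⟨k, by rw [hΦk]; exact hx⟩)
    obtain ⟨n₀, hn₀⟩ := eventually_atTop.1
      ((hg (k + l) (Φ x)).eventually (lt_mem_nhds (hl (k + l) (Nat.le_add_left _ _))))
    exact Set.mem_iUnion.2 ⟨(l, n₀), Set.mem_iInter₂.2 fun n hn => (hn₀ n hn).le⟩
  have hUo : IsOpen {y : ℕ → ℕ → Bool | ∀ i < b, ∀ j < b, y i j = w i j} := by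
    have : {y : ℕ → ℕ → Bool | ∀ i < b, ∀ j < b, y i j = w i j} =
        ⋂ i ∈ Set.Iio b, ⋂ j ∈ Set.Iio b, (fun y : ℕ → ℕ → Bool => y i j) ⁻¹' {w i j} := by
      ext y
      simp
    rw [this]
    exact (Set.finite_Iio b).isOpen_biInter fun i _ => (Set.finite_Iio b).isOpen_biInter fun j _ =>
      (isOpen_discrete _).preimage (continuous_apply_apply i j)
  obtain ⟨y₀, hy₀U, hy₀⟩ := (hG.dense_iUnion_interior_of_closed hd hC hcov).inter_open_nonempty _
    hUo ⟨w, fun _ _ _ _ => rfl⟩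
  obtain ⟨q, hq⟩ := Set.mem_iUnion.1 hy₀
  obtain ⟨n, hn⟩ := exists_agree_subset_of_mem_nhds (mem_interior_iff_mem_nhds.1 hq)
  set b' := max n b with hb'
  refine ⟨fun i j => if i = k then (if j < b' then y₀ k j else false) else Φ y₀ i j, b', k + q.1,
    le_max_right _ _, Nat.le_add_right _ _, fun i hi => ?_, fun i hi j hj => ?_, ⟨b', fun j hj => ?_⟩,
    fun y hy1 hy2 => ?_⟩
  · funext j
    simp [hi.ne, hΦ, hi]
  · have hj' : j < b' := lt_of_lt_of_le hj (le_max_right _ _)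
    by_cases hik : i = k
    · subst hik
      simp [hj', hy₀U i hi j hj]
    · by_cases hlt : i < k
      · simp [hik, hΦ, hlt]
      · simp [hik, hΦ, hlt, hy₀U i hi j hj]
  · simp [not_lt.2 hj]
  -- The frozen columns of y are exchanged for those of y₀ in order to enter the interior set; Φ
  -- puts them back.
  · have hmem := hn (fun i => if i < k then y₀ i else y i) (fun i hi j hj => by
      by_cases hlt : i < k
      · simp [hlt]
      · have hj' : j < b' := lt_of_lt_of_le hj (le_max_left _ _)
        have := hy2 i (lt_of_lt_of_le hi (le_max_left _ _)) j hj'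
        simp only [if_neg hlt, this]
        by_cases hik : i = k
        · subst hik
          simp [hj']
        · simp [hik, hΦ, hlt])
    have hΦy : Φ (fun i => if i < k then y₀ i else y i) = y := by
      funext i
      by_cases hlt : i < k
      · simp only [hΦ, if_pos hlt]
        rw [hy1 i hlt.le]
        funext j
        simp [hlt.ne, hΦ, hlt]
      · simp only [hΦ, if_neg hlt]
    refine ge_of_tendsto (hg (k + q.1) y) (eventually_atTop.2 ⟨q.2, fun l hl => ?_⟩)
    have := Set.mem_iInter₂.1 hmem l hl
    rwa [Set.mem_ofPred_eq, hΦy] at this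

/-- An iterated pointwise limit of continuous functions cannot separate the arrays all of whose
columns are eventually zero from those with a column that is not. -/
theorem not_separated_of_tendsto_tendsto {h : ℕ → ℕ → (ℕ → ℕ → Bool) → ℝ}
    (hc : ∀ m n, Continuous (h m n)) {g : ℕ → (ℕ → ℕ → Bool) → ℝ}
    (hg : ∀ m x, Tendsto (fun n => h m n x) atTop (𝓝 (g m x))) {q : (ℕ → ℕ → Bool) → ℝ}
    (hq : ∀ x, Tendsto (fun m => g m x) atTop (𝓝 (q x))) {α β : ℝ} (hαβ : α < β)
    (hfin : ∀ x : ℕ → ℕ → Bool, (∀ k, ∃ n, ∀ j ≥ n, x k j = false) → q x ≤ α)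
    (hinf : ∀ x : ℕ → ℕ → Bool, (∃ k, ∀ n, ∃ j ≥ n, x k j = true) → β ≤ q x) : False := by
  obtain ⟨γ, h1, h2⟩ := exists_between hαβ
  choose W B' m hB hm hW1 hW2 hW3 hW4 using exists_cylinder_step hc hg (γ := γ) fun x hx =>
    (hq x).eventually (lt_mem_nhds (h2.trans_le (hinf x hx)))
  let S : ℕ → (ℕ → ℕ → Bool) × ℕ := fun k =>
    Nat.rec (fun _ _ => false, 0) (fun k s => (W k s.1 s.2, B' k s.1 s.2)) k
  have hS : ∀ k, S (k + 1) = (W k (S k).1 (S k).2, B' k (S k).1 (S k).2) := fun k => rfl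
  have hnest : ∀ k l, k ≤ l → (∀ i < k, (S l).1 i = (S k).1 i) ∧
      (∀ i < (S k).2, ∀ j < (S k).2, (S l).1 i j = (S k).1 i j) ∧ (S k).2 ≤ (S l).2 := by
    intro k l hkl
    induction l, hkl using Nat.le_induction with
    | base => exact ⟨fun _ _ => rfl, fun _ _ _ _ => rfl, le_rfl⟩
    | succ l hkl ih =>
      obtain ⟨i1, i2, i3⟩ := ih
      rw [hS]
      refine ⟨fun i hi => ?_, fun i hi j hj => ?_, i3.trans (hB _ _ _)⟩
      · dsimp only
        rw [hW1 l _ _ i (hi.trans_le hkl), i1 i hi]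
      · dsimp only
        rw [hW2 l _ _ i (hi.trans_le i3) j (hj.trans_le i3), i2 i hi j hj]
  -- Column i is final after stage i. In the diagonal array every column is eventually zero, yet `γ
  -- ≤ g m x` for arbitrarily large m.
  set x : ℕ → ℕ → Bool := fun i => (S (i + 1)).1 i with hx
  have hx1 : ∀ k, ∀ i < k, x i = (S k).1 i := fun k i hi =>
    ((hnest (i + 1) k hi).1 i (Nat.lt_succ_self i)).symm
  have hx2 : ∀ k, ∀ i < (S k).2, ∀ j < (S k).2, x i j = (S k).1 i j := by
    intro k i hi j hj
    rcases lt_or_ge i k with hik | hik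
    · rw [hx1 k i hik]
    · exact (hnest k (i + 1) (hik.trans (Nat.le_succ i))).2.1 i hi j hj
  have hqx := hfin x fun k => hW3 k (S k).1 (S k).2
  obtain ⟨l, hl⟩ := eventually_atTop.1 ((hq x).eventually (gt_mem_nhds (hqx.trans_lt h1)))
  refine absurd (hl _ (hm l (S l).1 (S l).2)) (not_lt.2 ?_)
  refine hW4 l (S l).1 (S l).2 x (fun i hi => ?_) (fun i hi j hj => ?_)
  · rw [hx1 (l + 1) i (Nat.lt_succ_of_le hi), hS]
  · rw [hx2 (l + 1) i hi j hj, hS]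

theorem not_isTower_one {Ω M : Type*} [PseudoMetricSpace M] {Λ : Set (Ω → ℂ)} {Ξ : Ω → M}
    {a : (ℕ → Bool) → Ω} (ha : ∀ φ ∈ Λ, IsLocallyConstant fun x => φ (a x)) {g : M → ℝ}
    (hg : Continuous g) {α β : ℝ} (hαβ : α < β)
    (hfin : ∀ x : ℕ → Bool, (∃ n, ∀ j ≥ n, x j = false) → g (Ξ (a x)) ≤ α)
    (hinf : ∀ x : ℕ → Bool, (∀ n, ∃ j ≥ n, x j = true) → β ≤ g (Ξ (a x)))
    (Γ : List ℕ → Ω → M) : ¬ IsTower (IsGeneralAlgorithm Λ) Ξ 1 Γ := by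
  intro hΓ
  refine not_separated_of_tendsto (h := fun n x => g (Γ [n] (a x))) (fun n => ?_)
    (g := fun x => g (Ξ (a x))) (fun x => ?_) hαβ hfin hinf
  · exact ((hΓ.lowest [n] rfl).isLocallyConstant_comp ha |>.comp g).continuous
  · have := hΓ.limit [] (by simp) (a x)
    rw [hΓ.top] at this
    exact (hg.tendsto _).comp this

theorem not_isTower_two {Ω M : Type*} [PseudoMetricSpace M] {Λ : Set (Ω → ℂ)} {Ξ : Ω → M}
    {a : (ℕ → ℕ → Bool) → Ω} (ha : ∀ φ ∈ Λ, IsLocallyConstant fun x => φ (a x)) {g : M → ℝ}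
    (hg : Continuous g) {α β : ℝ} (hαβ : α < β)
    (hfin : ∀ x : ℕ → ℕ → Bool, (∀ k, ∃ n, ∀ j ≥ n, x k j = false) → g (Ξ (a x)) ≤ α)
    (hinf : ∀ x : ℕ → ℕ → Bool, (∃ k, ∀ n, ∃ j ≥ n, x k j = true) → β ≤ g (Ξ (a x)))
    (Γ : List ℕ → Ω → M) : ¬ IsTower (IsGeneralAlgorithm Λ) Ξ 2 Γ := by
  intro hΓ
  refine not_separated_of_tendsto_tendsto (h := fun m n x => g (Γ [m, n] (a x))) (fun m n => ?_)
    (g := fun m x => g (Γ [m] (a x))) (fun m x => ?_) (q := fun x => g (Ξ (a x))) (fun x => ?_)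
    hαβ hfin hinf
  · exact ((hΓ.lowest [m, n] rfl).isLocallyConstant_comp ha |>.comp g).continuous
  · exact (hg.tendsto _).comp (hΓ.limit [m] (by simp) (a x))
  · have := hΓ.limit [] (by simp) (a x)
    rw [hΓ.top] at this
    exact (hg.tendsto _).comp this

/-! ### Isometries induced by injections of the index set -/

theorem apply_eq_inner_adjoint (T : Op) (u : L2) (i : ℕ) :
    T u i = inner ℂ (ContinuousLinearMap.adjoint T (basisVec i)) u := by
  rw [ContinuousLinearMap.adjoint_inner_left, inner_basisVec]

/-- The operator `u ↦ u ∘ p` for an injective map `p`. -/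
noncomputable def pullback (p : ℕ → ℕ) (hp : Function.Injective p) : Op :=
  LinearMap.mkContinuous
    { toFun := fun u => ⟨fun j => u (p j), memℓp_gen (by
        simpa [Function.comp_def] using (hasSum_norm_sq u).summable.comp_injective hp)⟩
      map_add' := fun u v => by ext j; rfl
      map_smul' := fun c u => by ext j; rfl } 1 (fun u => by
        rw [one_mul]
        refine le_of_sq_le_sq ?_ (norm_nonneg _)
        rw [norm_sq_eq_tsum, norm_sq_eq_tsum]
        exact tsum_comp_le_tsum_of_inj (hasSum_norm_sq u).summable (fun i => by positivity) hp)

theorem pullback_apply {p : ℕ → ℕ} (hp : Function.Injective p) (u : L2) (j : ℕ) :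
    pullback p hp u j = u (p j) := rfl

theorem norm_pullback_le {p : ℕ → ℕ} (hp : Function.Injective p) : ‖pullback p hp‖ ≤ 1 :=
  LinearMap.mkContinuous_norm_le _ zero_le_one _

theorem pullback_basisVec {p : ℕ → ℕ} (hp : Function.Injective p) (j : ℕ) :
    pullback p hp (basisVec (p j)) = basisVec j := by
  ext i
  rw [pullback_apply, basisVec_apply, basisVec_apply]
  simp [hp.eq_iff]

theorem pullback_basisVec_of_notMem {p : ℕ → ℕ} (hp : Function.Injective p) {i : ℕ}
    (hi : i ∉ Set.range p) : pullback p hp (basisVec i) = 0 := by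
  ext j
  rw [pullback_apply, basisVec_apply, if_neg (fun h => hi ⟨j, h⟩)]
  rfl

/-- The isometry that maps the `j`-th basis vector to the `p j`-th. -/
noncomputable def pushforward (p : ℕ → ℕ) (hp : Function.Injective p) : Op :=
  ContinuousLinearMap.adjoint (pullback p hp)

theorem adjoint_pushforward {p : ℕ → ℕ} (hp : Function.Injective p) :
    ContinuousLinearMap.adjoint (pushforward p hp) = pullback p hp :=
  ContinuousLinearMap.adjoint_adjoint _

theorem adjoint_pullback {p : ℕ → ℕ} (hp : Function.Injective p) :
    ContinuousLinearMap.adjoint (pullback p hp) = pushforward p hp := rfl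

theorem norm_pushforward_le {p : ℕ → ℕ} (hp : Function.Injective p) : ‖pushforward p hp‖ ≤ 1 := by
  rw [pushforward, LinearIsometryEquiv.norm_map]
  exact norm_pullback_le hp

theorem pushforward_apply {p : ℕ → ℕ} (hp : Function.Injective p) (u : L2) (j : ℕ) :
    pushforward p hp u (p j) = u j := by
  rw [apply_eq_inner_adjoint, adjoint_pushforward, pullback_basisVec, inner_basisVec]

theorem pushforward_apply_of_notMem {p : ℕ → ℕ} (hp : Function.Injective p) (u : L2) {i : ℕ}
    (hi : i ∉ Set.range p) : pushforward p hp u i = 0 := by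
  rw [apply_eq_inner_adjoint, adjoint_pushforward, pullback_basisVec_of_notMem hp hi,
    inner_zero_left]

theorem pushforward_basisVec {p : ℕ → ℕ} (hp : Function.Injective p) (j : ℕ) :
    pushforward p hp (basisVec j) = basisVec (p j) := by
  ext i
  by_cases hi : i ∈ Set.range p
  · obtain ⟨k, rfl⟩ := hi
    rw [pushforward_apply, basisVec_apply, basisVec_apply]
    simp [hp.eq_iff]
  · rw [pushforward_apply_of_notMem hp _ hi, basisVec_apply, if_neg fun h => hi ⟨j, h.symm⟩]

theorem pullback_mul_pushforward {p : ℕ → ℕ} (hp : Function.Injective p) :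
    pullback p hp * pushforward p hp = 1 := by
  ext u j
  rw [mul_apply_eq_comp, pullback_apply, pushforward_apply, one_apply_eq_self]

theorem pullback_pushforward {p : ℕ → ℕ} (hp : Function.Injective p) (u : L2) :
    pullback p hp (pushforward p hp u) = u := by
  rw [← mul_apply_eq_comp, pullback_mul_pushforward, one_apply_eq_self]

theorem pullback_pushforward_eq_zero {p q : ℕ → ℕ} (hp : Function.Injective p)
    (hq : Function.Injective q) (h : ∀ i j, p i ≠ q j) (u : L2) :
    pullback p hp (pushforward q hq u) = 0 := by
  ext j
  rw [pullback_apply, pushforward_apply_of_notMem hq _ (fun ⟨i, hi⟩ => h j i hi.symm)]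
  rfl

theorem pushforward_pullback_apply {p : ℕ → ℕ} (hp : Function.Injective p) (u : L2) (i : ℕ)
    [Decidable (i ∈ Set.range p)] :
    pushforward p hp (pullback p hp u) i = if i ∈ Set.range p then u i else 0 := by
  split_ifs with hi
  · obtain ⟨k, rfl⟩ := hi
    rw [pushforward_apply, pullback_apply]
  · exact pushforward_apply_of_notMem hp _ hi

theorem norm_pushforward_apply {p : ℕ → ℕ} (hp : Function.Injective p) (u : L2) :
    ‖pushforward p hp u‖ = ‖u‖ := by
  refine le_antisymm ?_ ?_
  · simpa using (pushforward p hp).le_of_opNorm_le (norm_pushforward_le hp) u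
  · have := (pullback p hp).le_of_opNorm_le (norm_pullback_le hp) (pushforward p hp u)
    rwa [pullback_pushforward, one_mul] at this

/-! ### Families of operators with locally constant matrix entries -/

/-- Each matrix entry of the family is locally constant in the parameter. -/
def LocallyConstantEntries {X : Type*} [TopologicalSpace X] (T : X → Op) : Prop :=
  ∀ i j : ℕ, IsLocallyConstant fun x => inner ℂ (basisVec i) (T x (basisVec j))

section LocallyConstantEntries

variable {X : Type*} [TopologicalSpace X]

theorem locallyConstantEntries_const (T : Op) : LocallyConstantEntries fun _ : X => T :=
  fun _ _ => IsLocallyConstant.const _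

theorem LocallyConstantEntries.add {S T : X → Op} (hS : LocallyConstantEntries S)
    (hT : LocallyConstantEntries T) : LocallyConstantEntries fun x => S x + T x := fun i j => by
  simp only [add_apply, inner_add_right]
  exact (hS i j).add (hT i j)

theorem LocallyConstantEntries.smul {T : X → Op} (hT : LocallyConstantEntries T) (c : ℂ) :
    LocallyConstantEntries fun x => c • T x := fun i j => by
  simp only [smul_apply, inner_smul_right]
  exact (hT i j).comp fun w => c * w

theorem LocallyConstantEntries.adjoint {T : X → Op} (hT : LocallyConstantEntries T) :
    LocallyConstantEntries fun x => ContinuousLinearMap.adjoint (T x) := fun i j => by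
  simp only [ContinuousLinearMap.adjoint_inner_right]
  have h : (fun x => inner ℂ (T x (basisVec i)) (basisVec j)) =
      starRingEnd ℂ ∘ fun x => inner ℂ (basisVec j) (T x (basisVec i)) :=
    funext fun x => (inner_conj_symm _ _).symm
  rw [h]
  exact (hT j i).comp _

theorem LocallyConstantEntries.sandwich {T : X → Op} (hT : LocallyConstantEntries T) {p q : ℕ → ℕ}
    (hp : Function.Injective p) (hq : Function.Injective q) :
    LocallyConstantEntries fun x => pushforward p hp * T x * pullback q hq := fun i j => by
  by_cases hj : j ∈ Set.range q
  · obtain ⟨l, rfl⟩ := hj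
    by_cases hi : i ∈ Set.range p
    · obtain ⟨k, rfl⟩ := hi
      simp only [mul_apply_eq_comp, pullback_basisVec, inner_basisVec, pushforward_apply]
      simpa only [inner_basisVec] using hT k l
    · simp only [mul_apply_eq_comp, inner_basisVec, pushforward_apply_of_notMem hp _ hi]
      exact IsLocallyConstant.const _
  · simp only [mul_apply_eq_comp, pullback_basisVec_of_notMem hq hj, map_zero, inner_zero_right]
    exact IsLocallyConstant.const _

theorem locallyConstantEntries_pushforward {p : X → ℕ → ℕ} (hp : ∀ x, Function.Injective (p x))
    (h : ∀ j, IsLocallyConstant fun x => p x j) :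
    LocallyConstantEntries fun x => pushforward (p x) (hp x) := fun i j => by
  simp only [pushforward_basisVec, inner_basisVec, basisVec_apply]
  exact (h j).comp fun k => if i = k then (1 : ℂ) else 0

theorem LocallyConstantEntries.isLocallyConstant_eval {Ω : Set Op} {a : X → Ω}
    (ha : LocallyConstantEntries fun x => (a x).1) {f : ℕ → ℕ} {φ : Ω → ℂ}
    (hφ : φ ∈ matrixEvals Ω ∪ constEvals Ω f) : IsLocallyConstant fun x => φ (a x) := by
  rcases hφ with ⟨i, j, rfl⟩ | ⟨m, rfl⟩
  · exact ha i j
  · exact IsLocallyConstant.const _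

end LocallyConstantEntries

/-! ### Finitely many evaluations do not determine the output -/

theorem IsGeneralAlgorithm.eventually_eq {Ω M : Type*} {Λ : Set (Ω → ℂ)} {Γ : Ω → M}
    (hΓ : IsGeneralAlgorithm Λ Γ) {a : ℕ → Ω} {A : Ω} (h : ∀ φ ∈ Λ, ∀ᶠ m in atTop, φ (a m) = φ A) :
    ∀ᶠ m in atTop, Γ (a m) = Γ A := by
  obtain ⟨L, hL⟩ := hΓ
  obtain ⟨hfin, hsub, hA⟩ := hL A
  have h1 : ∀ᶠ m in atTop, ∀ φ ∈ L A, φ (a m) = φ A :=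
    hfin.eventually_all.2 fun φ hφ => h φ (hsub hφ)
  filter_upwards [h1] with m hm using (hA _ hm).1

/-- The orthogonal projection onto the span of a basis vector. -/
noncomputable def basisProj (m : ℕ) : Op := (innerSL ℂ (basisVec m)).smulRight (basisVec m)

theorem basisProj_apply (m : ℕ) (x : L2) : basisProj m x = x m • basisVec m := by
  simp [basisProj, inner_basisVec]

theorem basisProj_basisVec (m : ℕ) : basisProj m (basisVec m) = basisVec m := by
  simp [basisProj_apply, basisVec_apply]

theorem norm_basisProj_le (m : ℕ) : ‖basisProj m‖ ≤ 1 := by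
  rw [basisProj, ContinuousLinearMap.norm_smulRight_apply, innerSL_apply_norm, norm_basisVec,
    mul_one]

theorem isCompactOperator_basisProj (m : ℕ) : IsCompactOperator (basisProj m) := by
  have : basisProj m = proj (m + 1) - proj m := by
    rw [proj, proj, Finset.sum_range_succ, add_sub_cancel_left, basisProj]
  rw [this]
  exact (isCompactOperator_proj _).sub (isCompactOperator_proj _)

/-- Every fixed matrix entry of `s • basisProj m` vanishes for large m, so finitely many evaluations
confuse it with 0. -/
theorem not_isGeneralAlgorithm_of_basisProj {Ω : Set Op} {f : ℕ → ℕ} {Λ : Set (Ω → ℂ)}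
    (hΛ : Λ ⊆ matrixEvals Ω ∪ constEvals Ω f) {s : ℝ} (h0 : (0 : Op) ∈ Ω)
    (hs : ∀ m, (s : ℂ) • basisProj m ∈ Ω) {M : Type*} {Ξ : Op → M}
    (hΞ : ∀ m, Ξ ((s : ℂ) • basisProj m) ≠ Ξ 0) :
    ¬ IsGeneralAlgorithm Λ fun A : Ω => Ξ A.1 := by
  intro hΓ
  have h : ∀ φ ∈ Λ, ∀ᶠ m in atTop, φ ⟨_, hs m⟩ = φ ⟨0, h0⟩ := fun φ hφ => by
    rcases hΛ hφ with ⟨i, j, rfl⟩ | ⟨k, rfl⟩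
    · filter_upwards [eventually_gt_atTop j] with m hm
      show inner ℂ (basisVec i) (((s : ℂ) • basisProj m) (basisVec j)) =
        inner ℂ (basisVec i) ((0 : Op) (basisVec j))
      rw [smul_apply, basisProj_apply, basisVec_apply, if_neg hm.ne', zero_smul, smul_zero,
        zero_apply]
    · exact .of_forall fun _ => rfl
  obtain ⟨m, hm⟩ := (hΓ.eventually_eq h).exists
  exact hΞ m hm

theorem mem_spectrum_of_eigenvector {A : Op} {μ : ℂ} {x : L2} (hx : x ≠ 0) (hAx : A x = μ • x) :
    μ ∈ spectrum ℂ A := by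
  intro h
  have hu := isUnit_sub_algebraMap_iff.2 h
  obtain ⟨u, hu'⟩ := hu
  have h1 : (u : Op) x = 0 := by
    rw [hu', sub_apply, hAx, Algebra.algebraMap_eq_smul_one, smul_apply, one_apply_eq_self, sub_self]
  apply hx
  have : ((u⁻¹ : Opˣ) : Op) ((u : Op) x) = x := by
    rw [← mul_apply_eq_comp, Units.inv_mul, one_apply_eq_self]
  rw [← this, h1, map_zero]

theorem basisVec_ne_zero (m : ℕ) : basisVec m ≠ 0 := fun h => by
  have := norm_basisVec m
  simp [h] at this

theorem specMap_smul_basisProj_ne {s : ℝ} (hs : 0 < s) (m : ℕ) :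
    specMap ((s : ℂ) • basisProj m) ≠ specMap 0 := by
  intro h
  have h1 : (s : ℂ) ∈ (specMap ((s : ℂ) • basisProj m) : Set ℂ) :=
    mem_spectrum_of_eigenvector (basisVec_ne_zero m) (by rw [smul_apply, basisProj_basisVec])
  rw [h] at h1
  have h2 : (s : ℂ) ∈ spectrum ℂ (0 : Op) := h1
  rw [spectrum.zero_eq, Set.mem_singleton_iff] at h2
  exact hs.ne' (by exact_mod_cast h2)

theorem pseudospecMap_smul_basisProj_ne {s : ℝ} (hs : 0 < s) (m : ℕ) (N : ℕ) {ε : ℝ} (hε : 0 < ε) :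
    pseudospecMap N hε ((s : ℂ) • basisProj m) ≠ pseudospecMap N hε 0 := by
  intro h
  -- The point s + ε is within ε of the eigenvalue s, but farther than ε from the spectrum {0} of
  -- the zero operator.
  have hz : ‖((s + ε : ℝ) : ℂ)‖ = s + ε := by
    rw [Complex.norm_real, Real.norm_of_nonneg (by positivity)]
  have hz0 : ((s + ε : ℝ) : ℂ) ≠ 0 := by
    rw [← norm_pos_iff, hz]
    positivity
  have h1 : ((s + ε : ℝ) : ℂ) ∈ (pseudospecMap N hε ((s : ℂ) • basisProj m) : Set ℂ) :=
    mem_pseudospectrum_of_eigenvector hε (basisVec_ne_zero m) (μ := s)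
      (by rw [smul_apply, basisProj_basisVec]) (by
        rw [Complex.ofReal_add, sub_add_cancel_left, norm_neg, Complex.norm_real,
          Real.norm_of_nonneg hε.le])
  rw [h] at h1
  refine not_mem_pseudospectrum_of_bounded_below (A := 0) (N := N) hε ?_
    (c := s + ε) (by linarith) (fun x => ?_) h1
  · rw [zero_sub]
    exact ((isUnit_iff_ne_zero.2 hz0).map (algebraMap ℂ Op)).neg
  · rw [zero_sub, neg_apply, norm_neg, Algebra.algebraMap_eq_smul_one, smul_apply,
      one_apply_eq_self, norm_smul, hz]

/-! ### An injection that is surjective if and only if a sequence has infinitely many ones -/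

/-- The number that has not been used as a value before step `j`. -/
def unused (x : ℕ → Bool) : ℕ → ℕ
  | 0 => 0
  | j + 1 => if x j then j + 1 else unused x j

/-- At step `j` the unused number or the new number `j + 1` is taken as a value, according to
`x j`. -/
def useNext (x : ℕ → Bool) (j : ℕ) : ℕ := if x j then unused x j else j + 1

theorem unused_le (x : ℕ → Bool) (j : ℕ) : unused x j ≤ j := by
  induction j with
  | zero => exact le_rfl
  | succ j ih => rw [unused]; split_ifs <;> omega

/-- The invariant: after j steps exactly the numbers up to j, except the stored one, have been used.
A one in the sequence releases the stored number; without further ones it is never used. -/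
theorem exists_useNext_eq_iff (x : ℕ → Bool) (j i : ℕ) :
    (∃ k < j, useNext x k = i) ↔ i ≤ j ∧ i ≠ unused x j := by
  induction j with
  | zero => simp [unused]
  | succ j ih =>
    have h : (∃ k < j + 1, useNext x k = i) ↔ (∃ k < j, useNext x k = i) ∨ useNext x j = i := by
      constructor
      · rintro ⟨k, hk, rfl⟩
        rcases Nat.lt_succ_iff_lt_or_eq.1 hk with hk | rfl
        · exact Or.inl ⟨k, hk, rfl⟩
        · exact Or.inr rfl
      · rintro (⟨k, hk, rfl⟩ | rfl)
        · exact ⟨k, hk.trans (Nat.lt_succ_self j), rfl⟩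
        · exact ⟨j, Nat.lt_succ_self j, rfl⟩
    rw [h, ih, unused, useNext]
    have := unused_le x j
    split_ifs <;> omega

theorem injective_useNext (x : ℕ → Bool) : Function.Injective (useNext x) := by
  have h : ∀ k j, k < j → useNext x k ≠ useNext x j := by
    intro k j hkj
    have h1 := (exists_useNext_eq_iff x j _).1 ⟨k, hkj, rfl⟩
    rw [useNext.eq_def x j]
    split_ifs <;> omega
  intro k j hkj
  rcases lt_trichotomy k j with hlt | rfl | hlt
  · exact absurd hkj (h k j hlt)
  · rfl
  · exact absurd hkj.symm (h j k hlt)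

theorem surjective_useNext {x : ℕ → Bool} (hx : ∀ n, ∃ j ≥ n, x j = true) :
    Function.Surjective (useNext x) := by
  intro i
  obtain ⟨j, hj, hxj⟩ := hx i
  have h : i ≤ j + 1 ∧ i ≠ unused x (j + 1) := by
    rw [unused, if_pos hxj]
    omega
  obtain ⟨k, _, hk⟩ := (exists_useNext_eq_iff x (j + 1) i).2 h
  exact ⟨k, hk⟩

theorem exists_notMem_range_useNext {x : ℕ → Bool} (hx : ∃ n, ∀ j ≥ n, x j = false) :
    ∃ i, i ∉ Set.range (useNext x) := by
  obtain ⟨n, hn⟩ := hx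
  have h : ∀ j ≥ n, unused x j = unused x n := by
    intro j hj
    induction j, hj using Nat.le_induction with
    | base => rfl
    | succ j hj ih => rw [unused, hn j hj, ← ih]; simp
  refine ⟨unused x n, ?_⟩
  rintro ⟨k, hk⟩
  have := ((exists_useNext_eq_iff x (max n (k + 1)) _).1
    ⟨k, lt_of_lt_of_le (Nat.lt_succ_self k) (le_max_right _ _), hk⟩).2
  exact this (h _ (le_max_left _ _)).symm

theorem useNext_congr {x y : ℕ → Bool} {j : ℕ} (h : ∀ i ≤ j, x i = y i) :
    useNext x j = useNext y j := by
  have hu : ∀ k ≤ j, unused x k = unused y k := by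
    intro k hk
    induction k with
    | zero => rfl
    | succ k ih => rw [unused, unused, h k (by omega), ih (by omega)]
  rw [useNext, useNext, h j le_rfl, hu j le_rfl]

theorem isLocallyConstant_of_agree {X Y : Type*} [TopologicalSpace X] {F : X → Y}
    {ι : Type*} {I : Set ι} (hI : I.Finite) {c : ι → X → Bool} (hc : ∀ i, Continuous (c i))
    (h : ∀ x y, (∀ i ∈ I, c i x = c i y) → F x = F y) : IsLocallyConstant F := by
  rw [IsLocallyConstant.iff_eventually_eq]
  intro x
  have h1 : ∀ᶠ y in 𝓝 x, ∀ i ∈ I, c i y = c i x := hI.eventually_all.2 fun i _ =>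
    (hc i).continuousAt.eventually ((isOpen_discrete {c i x}).mem_nhds rfl)
  filter_upwards [h1] with y hy using h y x hy

theorem isLocallyConstant_useNext (j : ℕ) : IsLocallyConstant fun x => useNext x j :=
  isLocallyConstant_of_agree (Set.finite_Iic j) (fun i => continuous_apply i)
    fun _ _ h => useNext_congr h

/-! ### Block operators -/

/-- The even numbers and the odd numbers. -/
def half (b : Bool) (n : ℕ) : ℕ := if b then 2 * n + 1 else 2 * n

theorem injective_half (b : Bool) : Function.Injective (half b) := by
  intro m n h
  cases b <;> simp [half] at h <;> omega

/-- The embedding of a summand into the orthogonal sum of two copies of `l²(ℕ)`, which is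
identified with `l²(ℕ)`. -/
noncomputable def incl (b : Bool) : Op := pushforward (half b) (injective_half b)

/-- The projection onto a summand. -/
noncomputable def coord (b : Bool) : Op := pullback (half b) (injective_half b)

theorem adjoint_incl (b : Bool) : ContinuousLinearMap.adjoint (incl b) = coord b :=
  adjoint_pushforward _

theorem adjoint_coord (b : Bool) : ContinuousLinearMap.adjoint (coord b) = incl b := rfl

theorem coord_incl (b : Bool) (u : L2) : coord b (incl b u) = u := pullback_pushforward _ u

theorem coord_incl_of_ne {b c : Bool} (h : b ≠ c) (u : L2) : coord b (incl c u) = 0 :=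
  pullback_pushforward_eq_zero _ _ (fun i j hij => by
    revert h hij
    cases b <;> cases c <;> simp [half] <;> omega) u

theorem norm_incl_apply (b : Bool) (u : L2) : ‖incl b u‖ = ‖u‖ := norm_pushforward_apply _ u

theorem norm_coord_apply_le (b : Bool) (u : L2) : ‖coord b u‖ ≤ ‖u‖ := by
  simpa using (coord b).le_of_opNorm_le (norm_pullback_le _) u

theorem norm_incl_le (b : Bool) : ‖incl b‖ ≤ 1 := norm_pushforward_le _

theorem norm_coord_le (b : Bool) : ‖coord b‖ ≤ 1 := norm_pullback_le _

theorem incl_coord_add (b : Bool) (u : L2) : incl b (coord b u) + incl (!b) (coord (!b) u) = u := by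
  classical
  ext i
  have h : incl b (coord b u) i + incl (!b) (coord (!b) u) i = u i := by
    simp only [incl, coord, pushforward_pullback_apply]
    have h1 : ∀ c, i ∈ Set.range (half c) ↔ (i % 2 = if c then 1 else 0) := by
      intro c
      constructor
      · rintro ⟨k, rfl⟩
        cases c <;> simp [half]
      · intro hi
        refine ⟨i / 2, ?_⟩
        cases c <;> simp [half] at hi ⊢ <;> omega
    simp only [h1]
    rcases Nat.mod_two_eq_zero_or_one i with hi | hi <;> cases b <;> simp [hi]
  exact h

theorem norm_le_coord_add (b : Bool) (u : L2) : ‖u‖ ≤ ‖coord b u‖ + ‖coord (!b) u‖ := by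
  conv_lhs => rw [← incl_coord_add b u]
  refine (norm_add_le _ _).trans ?_
  rw [norm_incl_apply, norm_incl_apply]

theorem norm_block_le (b c : Bool) (T : Op) : ‖incl b * T * coord c‖ ≤ ‖T‖ := by
  calc _ ≤ ‖incl b‖ * ‖T‖ * ‖coord c‖ := (norm_mul_le _ _).trans (by gcongr; exact norm_mul_le _ _)
    _ ≤ 1 * ‖T‖ * 1 := by
      gcongr
      exacts [norm_incl_le b, norm_coord_le c]
    _ = ‖T‖ := by ring

theorem adjoint_block (b c : Bool) (T : Op) :
    ContinuousLinearMap.adjoint (incl b * T * coord c) =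
      incl c * ContinuousLinearMap.adjoint T * coord b := by
  simp only [← ContinuousLinearMap.star_eq_adjoint, star_mul]
  simp only [ContinuousLinearMap.star_eq_adjoint, adjoint_coord, adjoint_incl, mul_assoc]

/-! ### Pseudospectra of bounded operators need two limits -/

/-- The selfadjoint operator with the off-diagonal blocks given by an injection. -/
noncomputable def swapOp (p : ℕ → ℕ) (hp : Function.Injective p) : Op :=
  incl false * pushforward p hp * coord true + incl true * pullback p hp * coord false

theorem isSelfAdjoint_swapOp {p : ℕ → ℕ} (hp : Function.Injective p) :
    ContinuousLinearMap.adjoint (swapOp p hp) = swapOp p hp := by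
  rw [swapOp, map_add, adjoint_block, adjoint_block, adjoint_pullback, adjoint_pushforward, add_comm]

theorem norm_swapOp_le {p : ℕ → ℕ} (hp : Function.Injective p) : ‖swapOp p hp‖ ≤ 2 := by
  refine (norm_add_le _ _).trans ?_
  linarith [(norm_block_le false true (pushforward p hp)).trans (norm_pushforward_le hp),
    (norm_block_le true false (pullback p hp)).trans (norm_pullback_le hp)]

theorem swapOp_incl_true {p : ℕ → ℕ} (hp : Function.Injective p) (u : L2) :
    swapOp p hp (incl true u) = incl false (pushforward p hp u) := by
  simp [swapOp, coord_incl, coord_incl_of_ne]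

theorem swapOp_incl_false {p : ℕ → ℕ} (hp : Function.Injective p) (u : L2) :
    swapOp p hp (incl false u) = incl true (pullback p hp u) := by
  simp [swapOp, coord_incl, coord_incl_of_ne]

theorem pushforward_pullback {p : ℕ → ℕ} (hp : Function.Injective p) (hs : Function.Surjective p)
    (u : L2) : pushforward p hp (pullback p hp u) = u := by
  ext i
  obtain ⟨j, rfl⟩ := hs i
  rw [pushforward_apply, pullback_apply]

theorem swapOp_swapOp {p : ℕ → ℕ} (hp : Function.Injective p) (hs : Function.Surjective p)
    (u : L2) : swapOp p hp (swapOp p hp u) = u := by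
  conv_lhs => rw [← incl_coord_add true u]
  simp only [map_add, swapOp_incl_true, swapOp_incl_false, pullback_pushforward, Bool.not_true,
    pushforward_pullback hp hs]
  exact incl_coord_add true u

/-- For selfadjoint T the number ⟨Tu, u⟩ is real, so the cross term with iy drops out. -/
theorem norm_sq_sub_smul_I {T : Op} (hT : ContinuousLinearMap.adjoint T = T) {s : ℝ}
    (hs : ∀ u, T (T u) = ((s ^ 2 : ℝ) : ℂ) • u) (y : ℝ) (u : L2) :
    ‖T u - ((y : ℂ) * Complex.I) • u‖ ^ 2 = (s ^ 2 + y ^ 2) * ‖u‖ ^ 2 := by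
  have h1 : ‖T u‖ ^ 2 = s ^ 2 * ‖u‖ ^ 2 := by
    have : (inner ℂ (T u) (T u) : ℂ) = inner ℂ u (T (T u)) := by
      conv_lhs => rw [← hT, ContinuousLinearMap.adjoint_inner_left, hT]
    rw [hs, inner_smul_right, inner_self_eq_norm_sq_to_K, inner_self_eq_norm_sq_to_K] at this
    push_cast at this
    refine Complex.ofReal_injective ?_
    push_cast
    exact this
  have h2 : (inner ℂ (T u) u : ℂ) = starRingEnd ℂ (inner ℂ (T u) u) := by
    rw [inner_conj_symm]
    conv_lhs => rw [← hT, ContinuousLinearMap.adjoint_inner_left]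
  have h3 : (inner ℂ (T u) u : ℂ).im = 0 := Complex.conj_eq_iff_im.1 h2.symm
  rw [@norm_sub_sq ℂ, h1, norm_smul, inner_smul_right, mul_pow]
  simp [h3]
  ring

theorem not_mem_pseudospectrum_near_I {T : Op} (hT : ContinuousLinearMap.adjoint T = T) {s : ℝ}
    (hs : ∀ u, T (T u) = ((s ^ 2 : ℝ) : ℂ) • u) (N : ℕ) {ε r c : ℝ} (hε : 0 < ε) (hc : ε < c)
    (hr : c + r ≤ √(s ^ 2 + ε ^ 2)) {z : ℂ} (hz : ‖z - ε * Complex.I‖ ≤ r) :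
    z ∉ pseudospectrum N ε T := by
  have hb : ∀ y : ℝ, y ^ 2 = ε ^ 2 → ∀ w : ℂ, ‖w - y * Complex.I‖ ≤ r → ∀ u,
      c * ‖u‖ ≤ ‖(T - algebraMap ℂ Op w) u‖ := by
    intro y hy w hw u
    have h1 : ‖T u - ((y : ℂ) * Complex.I) • u‖ = √(s ^ 2 + ε ^ 2) * ‖u‖ := by
      rw [← Real.sqrt_sq (norm_nonneg (T u - _)), norm_sq_sub_smul_I hT hs, hy,
        Real.sqrt_mul (by positivity), Real.sqrt_sq (norm_nonneg _)]
    have h2 : (T - algebraMap ℂ Op w) u =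
        (T u - ((y : ℂ) * Complex.I) • u) - (w - y * Complex.I) • u := by
      rw [sub_apply, Algebra.algebraMap_eq_smul_one, smul_apply, one_apply_eq_self]
      module
    rw [h2]
    have h3 := norm_sub_norm_le (T u - ((y : ℂ) * Complex.I) • u) ((w - y * Complex.I) • u)
    rw [h1, norm_smul] at h3
    have h4 := mul_le_mul_of_nonneg_right hw (norm_nonneg u)
    have h5 := mul_le_mul_of_nonneg_right hr (norm_nonneg u)
    linarith
  have hbz := hb ε rfl z hz
  refine not_mem_pseudospectrum_of_bounded_below hε
    (isUnit_of_bounded_below (hε.trans hc) hbz fun u => ?_) hc hbz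
  rw [adjoint_sub_algebraMap, hT]
  -- Passing to the adjoint conjugates z and moves the centre to -iε.
  refine hb (-ε) (by ring) _ ?_ u
  rw [← Complex.norm_conj]
  simpa [sub_eq_add_neg] using hz

theorem locallyConstantEntries_swapOp {X : Type*} [TopologicalSpace X] {p : X → ℕ → ℕ}
    (hp : ∀ x, Function.Injective (p x)) (h : ∀ j, IsLocallyConstant fun x => p x j) :
    LocallyConstantEntries fun x => swapOp (p x) (hp x) := by
  have h1 := (locallyConstantEntries_pushforward hp h).adjoint.sandwich (injective_half true)
    (injective_half false)
  simp only [adjoint_pushforward] at h1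
  exact ((locallyConstantEntries_pushforward hp h).sandwich _ _).add h1

/-- If the isometry misses a basis vector, 0 is an eigenvalue and iε lies in the pseudospectrum. If
it is unitary, T² = s², and T - iε is bounded below by √(s² + ε²) > ε, so a disc around iε is
avoided. -/
theorem not_isTower_one_pseudospecMap {Ω : Set Op} {s : ℝ} (hs : 0 < s)
    (hΩ : ∀ A : Op, ‖A‖ ≤ 2 * s → A ∈ Ω) (N : ℕ) {ε : ℝ} (hε : 0 < ε)
    (Γ : List ℕ → Ω → TopologicalSpace.NonemptyCompacts ℂ) :
    ¬ IsTower (IsGeneralAlgorithm (matrixEvals Ω)) (fun A => pseudospecMap N hε A.1) 1 Γ := by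
  have hsq : ε < √(s ^ 2 + ε ^ 2) := Real.lt_sqrt_of_sq_lt (by nlinarith)
  have hinj := injective_useNext
  -- Half the gap is the radius of the disc, the other half keeps the lower bound ε + r above ε.
  set r := (√(s ^ 2 + ε ^ 2) - ε) / 2 with hr
  have hmem : ∀ x, (s : ℂ) • swapOp (useNext x) (hinj x) ∈ Ω := fun x => hΩ _ (by
    rw [norm_smul, Complex.norm_real, Real.norm_of_nonneg hs.le, mul_comm]
    exact mul_le_mul_of_nonneg_right (norm_swapOp_le _) hs.le)
  have hloc : LocallyConstantEntries fun x : ℕ → Bool => (s : ℂ) • swapOp (useNext x) (hinj x) :=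
    (locallyConstantEntries_swapOp hinj isLocallyConstant_useNext).smul _
  refine not_isTower_one (a := fun x => ⟨_, hmem x⟩)
    (fun φ hφ => hloc.isLocallyConstant_eval (a := fun x => ⟨_, hmem x⟩) (f := id) (Or.inl hφ))
    (continuous_infDist_nonemptyCompacts (ε * Complex.I)) (α := 0) (β := r)
    (by rw [hr]; linarith) (fun x hx => ?_) (fun x hx => ?_) Γ
  · obtain ⟨i, hi⟩ := exists_notMem_range_useNext hx
    refine (Metric.infDist_zero_of_mem ?_).le
    refine mem_pseudospectrum_of_eigenvector hε (x := incl false (basisVec i)) (μ := 0) ?_ ?_ ?_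
    · rw [← norm_ne_zero_iff, norm_incl_apply, norm_basisVec]
      exact one_ne_zero
    · rw [smul_apply, swapOp_incl_false, pullback_basisVec_of_notMem _ hi]
      simp
    · simp [abs_of_pos hε]
  · refine (Metric.le_infDist (TopologicalSpace.NonemptyCompacts.nonempty _)).2 fun z hz => ?_
    by_contra hlt
    push Not at hlt
    refine not_mem_pseudospectrum_near_I (s := s) ?_ (fun u => ?_) N hε (c := ε + r) (r := r)
      (by rw [hr]; linarith) (by rw [hr]; linarith) ?_ hz
    · rw [map_smulₛₗ, isSelfAdjoint_swapOp, Complex.conj_ofReal]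
    · rw [smul_apply, smul_apply, map_smul, swapOp_swapOp _ (surjective_useNext hx), smul_smul, sq,
        Complex.ofReal_mul]
    · rw [← dist_eq_norm, dist_comm]
      exact hlt.le

/-! ### Spectra of bounded operators need three limits -/

theorem norm_le_norm_of_apply_le {u v : L2} (h : ∀ i, ‖u i‖ ≤ ‖v i‖) : ‖u‖ ≤ ‖v‖ := by
  refine le_of_sq_le_sq ?_ (norm_nonneg _)
  rw [norm_sq_eq_tsum, norm_sq_eq_tsum]
  exact (hasSum_norm_sq u).summable.tsum_le_tsum (fun i => pow_le_pow_left₀ (norm_nonneg _) (h i) 2)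
    (hasSum_norm_sq v).summable

/-- The weight `1 / (k + 1)` of the numbers in the column `k` of the array `Nat.pair`. -/
noncomputable def columnWeight (n : ℕ) : ℝ := 1 / ((n.unpair.1 : ℝ) + 1)

theorem columnWeight_pos (n : ℕ) : 0 < columnWeight n := by
  rw [columnWeight]; positivity

theorem columnWeight_le_one (n : ℕ) : columnWeight n ≤ 1 := by
  rw [columnWeight, div_le_one (by positivity)]
  simp

theorem norm_columnWeight_mul_le (n : ℕ) (w : ℂ) : ‖(columnWeight n : ℂ) * w‖ ≤ ‖w‖ := by
  rw [norm_mul, Complex.norm_real, Real.norm_of_nonneg (columnWeight_pos n).le]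
  exact mul_le_of_le_one_left (norm_nonneg _) (columnWeight_le_one n)

/-- The diagonal operator with the entries `columnWeight`. -/
noncomputable def columnOp : Op :=
  LinearMap.mkContinuous
    { toFun := fun u => ⟨fun n => columnWeight n * u n,
        (lp.memℓp u).mono' (norm_columnWeight_mul_le · _)⟩
      map_add' := fun u v => by
        ext n
        exact mul_add _ _ _
      map_smul' := fun c u => by
        ext n
        exact mul_left_comm _ _ _ } 1 (fun u => by
        rw [one_mul]
        exact norm_le_norm_of_apply_le (norm_columnWeight_mul_le · _))

theorem columnOp_apply (u : L2) (n : ℕ) : columnOp u n = columnWeight n * u n := rfl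

theorem norm_columnOp_le : ‖columnOp‖ ≤ 1 := LinearMap.mkContinuous_norm_le _ zero_le_one _

theorem columnOp_basisVec (n : ℕ) : columnOp (basisVec n) = (columnWeight n : ℂ) • basisVec n := by
  ext i
  rw [columnOp_apply, lp.coeFn_smul, Pi.smul_apply, smul_eq_mul, basisVec_apply]
  split_ifs with h
  · rw [h]
  · simp

theorem adjoint_columnOp : ContinuousLinearMap.adjoint columnOp = columnOp := by
  ext u i
  rw [apply_eq_inner_adjoint, ContinuousLinearMap.adjoint_adjoint, columnOp_basisVec,
    inner_smul_left, inner_basisVec, Complex.conj_ofReal, columnOp_apply]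

/-- The triangular operator with an isometry and its adjoint on the diagonal. -/
noncomputable def triOp (p : ℕ → ℕ) (hp : Function.Injective p) (b : Bool) : Op :=
  incl b * pushforward p hp * coord b + incl b * columnOp * coord (!b) +
    incl (!b) * pullback p hp * coord (!b)

section triOp

variable {p : ℕ → ℕ} (hp : Function.Injective p)

theorem adjoint_triOp (b : Bool) :
    ContinuousLinearMap.adjoint (triOp p hp b) = triOp p hp (!b) := by
  rw [triOp, triOp, map_add, map_add, adjoint_block, adjoint_block, adjoint_block,
    adjoint_pushforward, adjoint_pullback, adjoint_columnOp, Bool.not_not]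
  abel

theorem norm_triOp_le (b : Bool) : ‖triOp p hp b‖ ≤ 3 := by
  refine (norm_add₃_le).trans ?_
  linarith [(norm_block_le b b (pushforward p hp)).trans (norm_pushforward_le hp),
    (norm_block_le b (!b) columnOp).trans norm_columnOp_le,
    (norm_block_le (!b) (!b) (pullback p hp)).trans (norm_pullback_le hp)]

theorem triOp_incl_not (b : Bool) (v : L2) :
    triOp p hp b (incl (!b) v) = incl b (columnOp v) + incl (!b) (pullback p hp v) := by
  simp [triOp, coord_incl, coord_incl_of_ne]

theorem coord_triOp (b : Bool) (w : L2) : coord b (triOp p hp b w) =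
    pushforward p hp (coord b w) + columnOp (coord (!b) w) := by
  simp [triOp, coord_incl, coord_incl_of_ne]

theorem coord_not_triOp (b : Bool) (w : L2) : coord (!b) (triOp p hp b w) =
    pullback p hp (coord (!b) w) := by
  simp [triOp, coord_incl, coord_incl_of_ne]

theorem pullback_columnOp (hcol : ∀ n, (p n).unpair.1 = n.unpair.1) (v : L2) :
    pullback p hp (columnOp v) = columnOp (pullback p hp v) := by
  ext n
  rw [pullback_apply, columnOp_apply, columnOp_apply, pullback_apply, columnWeight, hcol,
    ← columnWeight]

theorem norm_pushforward_le_norm (u : L2) : ‖pushforward p hp u‖ ≤ ‖u‖ :=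
  (norm_pushforward_apply hp u).le

theorem norm_pullback_le_norm (u : L2) : ‖pullback p hp u‖ ≤ ‖u‖ := by
  simpa using (pullback p hp).le_of_opNorm_le (norm_pullback_le hp) u

theorem norm_columnOp_le_norm (u : L2) : ‖columnOp u‖ ≤ ‖u‖ := by
  simpa using columnOp.le_of_opNorm_le norm_columnOp_le u

/-- With a = Vu + Dv - zu and b = V*v - zv, V*V = 1 and V*D = DV* give V*a - Db = u - zV*u + zDv;
inserting zDv = z(a - Vu + zu) eliminates v. For |z| ≤ 1/3 this reads (2/9)‖u‖ ≤ (7/3)δ, whatever V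
misses. -/
theorem norm_fst_le (hcol : ∀ n, (p n).unpair.1 = n.unpair.1) {z : ℂ} (hz : ‖z‖ ≤ 1 / 3)
    {u v : L2} {δ : ℝ} (ha : ‖pushforward p hp u + columnOp v - z • u‖ ≤ δ)
    (hb : ‖pullback p hp v - z • v‖ ≤ δ) : ‖u‖ ≤ 21 / 2 * δ := by
  set a := pushforward p hp u + columnOp v - z • u with had
  set b := pullback p hp v - z • v with hbd
  have h1 : u = (pullback p hp a - z • a - columnOp b) +
      z • (pullback p hp u + pushforward p hp u) - (z * z) • u := by
    rw [had, hbd]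
    simp only [map_sub, map_add, map_smul, pullback_pushforward, pullback_columnOp hp hcol]
    module
  have hu := norm_nonneg u
  have hz0 := norm_nonneg z
  have h2 : ‖u‖ ≤ (δ + 1 / 3 * δ + δ) + 1 / 3 * (‖u‖ + ‖u‖) + 1 / 3 * (1 / 3) * ‖u‖ := by
    conv_lhs => rw [h1]
    refine (norm_sub_le _ _).trans (add_le_add ((norm_add_le _ _).trans (add_le_add
      ((norm_sub_le _ _).trans (add_le_add ((norm_sub_le _ _).trans (add_le_add ?_ ?_)) ?_)) ?_)) ?_)
    · exact (norm_pullback_le_norm hp a).trans ha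
    · rw [norm_smul]
      exact mul_le_mul hz ha (norm_nonneg _) (by norm_num)
    · exact (norm_columnOp_le_norm b).trans hb
    · rw [norm_smul]
      exact mul_le_mul hz ((norm_add_le _ _).trans (add_le_add (norm_pullback_le_norm hp u)
        (norm_pushforward_le_norm hp u))) (norm_nonneg _) (by norm_num)
    · rw [norm_smul, norm_mul]
      exact mul_le_mul_of_nonneg_right (mul_le_mul hz hz hz0 (by norm_num)) hu
  linarith

/-- The part VV*v is controlled by V*v = b + zv. The rest is supported off the range of p, where the
weights of D are at least 1/K, so it is at most K‖Dv‖; and Dv = a - Vu + zu has norm at most δ +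
(4/3)(21/2)δ = 15δ. -/
theorem norm_snd_le (hcol : ∀ n, (p n).unpair.1 = n.unpair.1) {K : ℝ}
    (hK : ∀ i, i ∉ Set.range p → (i.unpair.1 : ℝ) + 1 ≤ K) {z : ℂ} (hz : ‖z‖ ≤ 1 / 3)
    {u v : L2} {δ : ℝ} (ha : ‖pushforward p hp u + columnOp v - z • u‖ ≤ δ)
    (hb : ‖pullback p hp v - z • v‖ ≤ δ) (hK0 : 0 < K) : ‖v‖ ≤ 3 / 2 * (1 + 15 * K) * δ := by
  classical
  have hu := norm_fst_le hp hcol hz ha hb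
  have hD : ‖columnOp v‖ ≤ 15 * δ := by
    have h1 : columnOp v = (pushforward p hp u + columnOp v - z • u) - pushforward p hp u + z • u := by
      abel
    rw [h1]
    refine (norm_add_le _ _).trans ?_
    have h2 := (norm_sub_le (pushforward p hp u + columnOp v - z • u) (pushforward p hp u))
    have h3 : ‖z • u‖ ≤ 1 / 3 * ‖u‖ := by
      rw [norm_smul]
      exact mul_le_mul_of_nonneg_right hz (norm_nonneg _)
    linarith [norm_pushforward_le_norm hp u]
  have hR : ‖v - pushforward p hp (pullback p hp v)‖ ≤ K * ‖columnOp v‖ := by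
    have : K * ‖columnOp v‖ = ‖(K : ℂ) • columnOp v‖ := by
      rw [norm_smul, Complex.norm_real, Real.norm_of_nonneg hK0.le]
    rw [this]
    refine norm_le_norm_of_apply_le fun i => ?_
    rw [lp.coeFn_sub, Pi.sub_apply, lp.coeFn_smul, Pi.smul_apply, pushforward_pullback_apply,
      columnOp_apply]
    split_ifs with hi
    · rw [sub_self, norm_zero]
      positivity
    · rw [sub_zero, smul_eq_mul, ← mul_assoc, norm_mul, ← Complex.ofReal_mul, Complex.norm_real]
      refine le_mul_of_one_le_left (norm_nonneg _) ?_
      have h2 := hK i hi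
      refine le_trans ?_ (Real.le_norm_self _)
      rw [columnWeight, mul_one_div, le_div_iff₀ (by positivity)]
      linarith
  have hG : ‖pushforward p hp (pullback p hp v)‖ ≤ δ + 1 / 3 * ‖v‖ := by
    rw [norm_pushforward_apply]
    have h1 : pullback p hp v = (pullback p hp v - z • v) + z • v := by abel
    rw [h1]
    refine (norm_add_le _ _).trans (add_le_add hb ?_)
    rw [norm_smul]
    exact mul_le_mul_of_nonneg_right hz (norm_nonneg _)
  have h1 := norm_add_le (v - pushforward p hp (pullback p hp v)) (pushforward p hp (pullback p hp v))
  rw [sub_add_cancel] at h1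
  have h2 := mul_le_mul_of_nonneg_left hD hK0.le
  nlinarith

theorem triOp_bounded_below (hcol : ∀ n, (p n).unpair.1 = n.unpair.1) {K : ℝ} (hK0 : 0 < K)
    (hK : ∀ i, i ∉ Set.range p → (i.unpair.1 : ℝ) + 1 ≤ K) (b : Bool) {z : ℂ} (hz : ‖z‖ ≤ 1 / 3)
    (w : L2) : (21 / 2 + 3 / 2 * (1 + 15 * K))⁻¹ * ‖w‖ ≤ ‖(triOp p hp b - algebraMap ℂ Op z) w‖ := by
  rw [inv_mul_le_iff₀ (by positivity)]
  have h0 : (triOp p hp b - algebraMap ℂ Op z) w = triOp p hp b w - z • w := by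
    rw [sub_apply, Algebra.algebraMap_eq_smul_one, smul_apply, one_apply_eq_self]
  have ha : ‖pushforward p hp (coord b w) + columnOp (coord (!b) w) - z • coord b w‖ ≤
      ‖(triOp p hp b - algebraMap ℂ Op z) w‖ := by
    rw [← coord_triOp, ← map_smul, ← map_sub, h0]
    exact norm_coord_apply_le _ _
  have hb : ‖pullback p hp (coord (!b) w) - z • coord (!b) w‖ ≤
      ‖(triOp p hp b - algebraMap ℂ Op z) w‖ := by
    rw [← coord_not_triOp, ← map_smul, ← map_sub, h0]
    exact norm_coord_apply_le _ _
  linarith [norm_le_coord_add b w, norm_fst_le hp hcol hz ha hb,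
    norm_snd_le hp hcol hK hz ha hb hK0]

/-- The adjoint is the same operator with the two summands exchanged, so one estimate bounds both
from below. -/
theorem isUnit_triOp_sub (hcol : ∀ n, (p n).unpair.1 = n.unpair.1) {K : ℝ} (hK0 : 0 < K)
    (hK : ∀ i, i ∉ Set.range p → (i.unpair.1 : ℝ) + 1 ≤ K) (b : Bool) {z : ℂ} (hz : ‖z‖ ≤ 1 / 3) :
    IsUnit (triOp p hp b - algebraMap ℂ Op z) := by
  refine isUnit_of_bounded_below (by positivity) (triOp_bounded_below hp hcol hK0 hK b hz)
    fun w => ?_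
  rw [adjoint_sub_algebraMap, adjoint_triOp]
  exact triOp_bounded_below hp hcol hK0 hK _ (by rwa [RCLike.norm_conj]) w

theorem le_norm_of_mem_spectrum_triOp (hcol : ∀ n, (p n).unpair.1 = n.unpair.1) {K : ℝ}
    (hK0 : 0 < K) (hK : ∀ i, i ∉ Set.range p → (i.unpair.1 : ℝ) + 1 ≤ K) (b : Bool) {s : ℝ}
    (hs : 0 < s) {z : ℂ} (hz : z ∈ spectrum ℂ ((s : ℂ) • triOp p hp b)) : s / 3 ≤ ‖z‖ := by
  by_contra hlt
  push Not at hlt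
  have hs0 : (s : ℂ) ≠ 0 := by exact_mod_cast hs.ne'
  have h1 := isUnit_triOp_sub hp hcol hK0 hK b (z := z / s) (by
    rw [norm_div, Complex.norm_real, Real.norm_of_nonneg hs.le, div_le_iff₀ hs]
    linarith)
  refine hz (isUnit_sub_algebraMap_iff.1 ?_)
  have h2 : (s : ℂ) • triOp p hp b - algebraMap ℂ Op z =
      algebraMap ℂ Op s * (triOp p hp b - algebraMap ℂ Op (z / s)) := by
    rw [mul_sub, ← map_mul, mul_div_cancel₀ _ hs0, Algebra.smul_def]
  rw [h2]
  exact ((isUnit_iff_ne_zero.2 hs0).map (algebraMap ℂ Op)).mul h1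

/-- A missed e_i in column k is annihilated by V*, and D shrinks it to norm 1/(k+1). As k is
arbitrary, no bounded inverse exists. -/
theorem zero_mem_spectrum_triOp (h : ∀ k : ℕ, ∃ i, i ∉ Set.range p ∧ i.unpair.1 = k) (b : Bool)
    (s : ℂ) : (0 : ℂ) ∈ spectrum ℂ (s • triOp p hp b) := by
  intro h0
  have hu := isUnit_sub_algebraMap_iff.2 h0
  rw [map_zero, sub_zero] at hu
  set C := ‖Ring.inverse (s • triOp p hp b)‖ * ‖s‖ with hC
  obtain ⟨k, hk⟩ := exists_nat_gt C
  obtain ⟨i, hi, hik⟩ := h k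
  have h1 : (s • triOp p hp b) (incl (!b) (basisVec i)) =
      (s * columnWeight i) • incl b (basisVec i) := by
    rw [smul_apply, triOp_incl_not, pullback_basisVec_of_notMem hp hi, map_zero, add_zero,
      columnOp_basisVec, map_smul, smul_smul]
  have h2 : Ring.inverse (s • triOp p hp b) ((s • triOp p hp b) (incl (!b) (basisVec i))) =
      incl (!b) (basisVec i) := by
    rw [← mul_apply_eq_comp, Ring.inverse_mul_cancel _ hu, one_apply_eq_self]
  have h3 := (Ring.inverse (s • triOp p hp b)).le_opNorm
    ((s • triOp p hp b) (incl (!b) (basisVec i)))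
  rw [h2, h1, norm_smul, norm_incl_apply, norm_incl_apply, norm_basisVec, mul_one, norm_mul,
    ← mul_assoc, ← hC, Complex.norm_real, Real.norm_of_nonneg (columnWeight_pos i).le, columnWeight,
    hik, mul_one_div, le_div_iff₀ (by positivity)] at h3
  linarith

end triOp

theorem locallyConstantEntries_triOp {X : Type*} [TopologicalSpace X] {p : X → ℕ → ℕ}
    (hp : ∀ x, Function.Injective (p x)) (h : ∀ j, IsLocallyConstant fun x => p x j) (b : Bool) :
    LocallyConstantEntries fun x => triOp (p x) (hp x) b := by
  have h1 := (locallyConstantEntries_pushforward hp h).adjoint.sandwich (injective_half (!b))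
    (injective_half (!b))
  simp only [adjoint_pushforward] at h1
  exact (((locallyConstantEntries_pushforward hp h).sandwich _ _).add
    (locallyConstantEntries_const _)).add h1

/-- The `k`-th column of the array in which each column is the maximum of the columns up to it. -/
def maxColumn (x : ℕ → ℕ → Bool) (k : ℕ) (j : ℕ) : Bool := decide (∃ i ≤ k, x i j = true)

/-- The injection that acts on each column of the array of natural numbers. -/
def useNextColumns (x : ℕ → ℕ → Bool) (n : ℕ) : ℕ :=
  Nat.pair n.unpair.1 (useNext (maxColumn x n.unpair.1) n.unpair.2)

theorem unpair_useNextColumns (x : ℕ → ℕ → Bool) (n : ℕ) :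
    (useNextColumns x n).unpair.1 = n.unpair.1 := by
  simp [useNextColumns]

theorem injective_useNextColumns (x : ℕ → ℕ → Bool) : Function.Injective (useNextColumns x) := by
  intro m n h
  obtain ⟨h1, h2⟩ := Nat.pair_eq_pair.1 h
  rw [h1] at h2
  rw [← Nat.pair_unpair m, ← Nat.pair_unpair n, h1, injective_useNext _ h2]

theorem mem_range_useNextColumns (x : ℕ → ℕ → Bool) (k i : ℕ) :
    Nat.pair k i ∈ Set.range (useNextColumns x) ↔ i ∈ Set.range (useNext (maxColumn x k)) := by
  constructor
  · rintro ⟨n, hn⟩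
    obtain ⟨rfl, h2⟩ := Nat.pair_eq_pair.1 hn
    exact ⟨_, h2⟩
  · rintro ⟨j, rfl⟩
    exact ⟨Nat.pair k j, by simp [useNextColumns]⟩

theorem isLocallyConstant_useNextColumns (n : ℕ) :
    IsLocallyConstant fun x => useNextColumns x n := by
  refine isLocallyConstant_of_agree (I := Set.Iic n.unpair) (Set.finite_Iic n.unpair)
    (c := fun q x => x q.1 q.2) (fun q => continuous_apply_apply q.1 q.2) fun x y h => ?_
  rw [useNextColumns, useNextColumns, useNext_congr fun j hj => ?_]
  have h1 : ∀ i ≤ n.unpair.1, x i j = y i j := fun i hi => h (i, j) ⟨hi, hj⟩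
  simp only [maxColumn, decide_eq_decide]
  exact ⟨fun ⟨i, hi, h⟩ => ⟨i, hi, h1 i hi ▸ h⟩, fun ⟨i, hi, h⟩ => ⟨i, hi, (h1 i hi).symm ▸ h⟩⟩

/-- Taking maxima over the preceding columns makes one column with infinitely many ones complete all
later columns. Missing indices then lie in columns up to k, and the disc of radius s/3 is free of
spectrum. If all columns are eventually zero, every column misses an index and 0 is spectral. -/
theorem not_isTower_two_specMap {Ω : Set Op} {s : ℝ} (hs : 0 < s)
    (hΩ : ∀ A : Op, ‖A‖ ≤ 3 * s → A ∈ Ω)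
    (Γ : List ℕ → Ω → TopologicalSpace.NonemptyCompacts ℂ) :
    ¬ IsTower (IsGeneralAlgorithm (matrixEvals Ω)) (fun A => specMap A.1) 2 Γ := by
  have hinj := injective_useNextColumns
  have hmem : ∀ x, (s : ℂ) • triOp (useNextColumns x) (hinj x) false ∈ Ω := fun x => hΩ _ (by
    rw [norm_smul, Complex.norm_real, Real.norm_of_nonneg hs.le, mul_comm]
    exact mul_le_mul_of_nonneg_right (norm_triOp_le _ _) hs.le)
  have hloc : LocallyConstantEntries fun x : ℕ → ℕ → Bool =>
      (s : ℂ) • triOp (useNextColumns x) (hinj x) false :=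
    (locallyConstantEntries_triOp hinj isLocallyConstant_useNextColumns false).smul _
  refine not_isTower_two (a := fun x => ⟨_, hmem x⟩)
    (fun φ hφ => hloc.isLocallyConstant_eval (a := fun x => ⟨_, hmem x⟩) (f := id) (Or.inl hφ))
    (continuous_infDist_nonemptyCompacts 0) (α := 0) (β := s / 3)
    (by positivity) (fun x hx => ?_) (fun x hx => ?_) Γ
  · refine (Metric.infDist_zero_of_mem (zero_mem_spectrum_triOp _ (fun k => ?_) _ _)).le
    have hfin : ∀ k, ∃ n, ∀ j ≥ n, ∀ i ≤ k, x i j = false := by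
      intro k
      choose n hn using hx
      refine ⟨(Finset.range (k + 1)).sup n, fun j hj i hi => hn i j (le_trans ?_ hj)⟩
      exact Finset.le_sup (Finset.mem_range.2 (Nat.lt_succ_of_le hi))
    obtain ⟨n, hn⟩ := hfin k
    obtain ⟨i, hi⟩ := exists_notMem_range_useNext (x := maxColumn x k) ⟨n, fun j hj => by
      simp only [maxColumn, decide_eq_false_iff_not, not_exists, not_and, Bool.not_eq_true]
      exact hn j hj⟩
    exact ⟨Nat.pair k i, by rwa [mem_range_useNextColumns], by simp⟩
  · obtain ⟨k, hk⟩ := hx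
    refine (Metric.le_infDist (TopologicalSpace.NonemptyCompacts.nonempty _)).2 fun z hz => ?_
    rw [dist_zero_left]
    refine le_norm_of_mem_spectrum_triOp _ (unpair_useNextColumns x) (K := k + 1) (by positivity)
      (fun i hi => ?_) false hs hz
    rw [← Nat.pair_unpair i, mem_range_useNextColumns] at hi
    have h1 : i.unpair.1 ≤ k := by
      by_contra hlt
      push Not at hlt
      refine hi (surjective_useNext (fun n => ?_) _)
      obtain ⟨j, hj, hxj⟩ := hk n
      exact ⟨j, hj, by simpa [maxColumn] using ⟨k, hlt.le, hxj⟩⟩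
    have : (i.unpair.1 : ℝ) ≤ k := by exact_mod_cast h1
    linarith

/-! ### Partial sums of the harmonic series -/

/-- The partial sums of the harmonic series. -/
noncomputable def harm (n : ℕ) : ℝ := ∑ d ∈ Finset.range n, ((d : ℝ) + 1)⁻¹

theorem harm_mono {m n : ℕ} (h : m ≤ n) : harm m ≤ harm n :=
  Finset.sum_le_sum_of_subset_of_nonneg (Finset.range_mono h) fun i _ _ => by positivity

theorem one_le_harm {n : ℕ} (hn : 0 < n) : 1 ≤ harm n := by
  have := harm_mono (Nat.succ_le_of_lt hn)
  simpa [harm] using this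

theorem tendsto_harm : Tendsto harm atTop atTop := by
  refine Real.tendsto_sum_range_one_div_nat_succ_atTop.congr fun n => ?_
  simp [harm]

theorem sum_harm_sub (n : ℕ) : ∑ t ∈ Finset.range n, (harm n - harm t) = n := by
  induction n with
  | zero => simp
  | succ n ih =>
    have h : harm (n + 1) = harm n + ((n : ℝ) + 1)⁻¹ := Finset.sum_range_succ _ _
    have h1 : ∀ t, harm (n + 1) - harm t = (harm n - harm t) + ((n : ℝ) + 1)⁻¹ := fun t => by
      rw [h]; ring
    simp only [h1]
    rw [Finset.sum_range_succ, Finset.sum_add_distrib, ih]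
    simp
    field_simp
    ring

/-- With a = 1/(n+1), the step from n to n+1 adds 2an + a = 2 - a. So H_n - H_t is bounded in mean
square although H_n → ∞, which produces the approximate eigenvectors below. -/
theorem sum_sq_harm_sub_le (n : ℕ) : ∑ t ∈ Finset.range n, (harm n - harm t) ^ 2 ≤ 2 * n := by
  induction n with
  | zero => simp
  | succ n ih =>
    have h : harm (n + 1) = harm n + ((n : ℝ) + 1)⁻¹ := Finset.sum_range_succ _ _
    set a := ((n : ℝ) + 1)⁻¹ with ha
    have ha1 : a * ((n : ℝ) + 1) = 1 := by rw [ha]; field_simp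
    have ha0 : 0 < a := by rw [ha]; positivity
    have h1 : ∀ t, (harm (n + 1) - harm t) ^ 2 =
        (harm n - harm t) ^ 2 + (2 * a * (harm n - harm t) + a ^ 2) := fun t => by
      rw [h]; ring
    simp only [h1]
    rw [Finset.sum_range_succ, Finset.sum_add_distrib, Finset.sum_add_distrib, ← Finset.mul_sum,
      sum_harm_sub]
    simp only [Finset.sum_const, Finset.card_range, nsmul_eq_mul, sub_self]
    have h2 : (n : ℝ) * a ^ 2 + a ^ 2 = a := by
      calc (n : ℝ) * a ^ 2 + a ^ 2 = a * (a * (n + 1)) := by ring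
        _ = a := by rw [ha1, mul_one]
    have h3 : 2 * a * n = 2 - 2 * a := by linarith
    push_cast
    linarith

theorem sum_inv_sq_le (r n : ℕ) :
    ∑ d ∈ Finset.range n, (((d + r : ℕ) : ℝ) + 1)⁻¹ ^ 2 ≤ 2 * ((r : ℝ) + 1)⁻¹ := by
  have h : ∑ d ∈ Finset.range n, (((d + r : ℕ) : ℝ) + 1)⁻¹ ^ 2 ≤
      2 * ((r : ℝ) + 1)⁻¹ - 2 * (((n + r : ℕ) : ℝ) + 1)⁻¹ := by
    induction n with
    | zero => simp
    | succ n ih =>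
      rw [Finset.sum_range_succ]
      have h1 : (((n + r : ℕ) : ℝ) + 1)⁻¹ ^ 2 ≤
          2 * (((n + r : ℕ) : ℝ) + 1)⁻¹ - 2 * (((n + 1 + r : ℕ) : ℝ) + 1)⁻¹ := by
        have h2 : ((n + 1 + r : ℕ) : ℝ) = ((n + r : ℕ) : ℝ) + 1 := by push_cast; ring
        rw [h2]
        set y : ℝ := ((n + r : ℕ) : ℝ) with hy
        have hy0 : 0 ≤ y := Nat.cast_nonneg _
        rw [← sub_nonneg]
        have : 2 * (y + 1)⁻¹ - 2 * (y + 1 + 1)⁻¹ - (y + 1)⁻¹ ^ 2 =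
            y / ((y + 1) ^ 2 * (y + 1 + 1)) := by
          field_simp
          ring
        rw [this]
        positivity
      linarith
  have : (0 : ℝ) ≤ 2 * (((n + r : ℕ) : ℝ) + 1)⁻¹ := by positivity
  linarith

/-! ### A block diagonal operator with strictly lower triangular blocks -/

/-- The natural numbers are divided into consecutive blocks, the block `l` of the length `2 ^ l`. -/
def level (t : ℕ) : ℕ := Nat.log 2 (t + 1)

theorem level_eq_iff {t l : ℕ} : level t = l ↔ 2 ^ l ≤ t + 1 ∧ t + 1 < 2 * 2 ^ l := by
  rw [level, Nat.log_eq_iff (Or.inr ⟨one_lt_two, Nat.succ_ne_zero t⟩), pow_succ']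

theorem level_mono {s t : ℕ} (h : s ≤ t) : level s ≤ level t := Nat.log_mono_right (by omega)

theorem le_level {l t : ℕ} (h : 2 ^ l ≤ t + 1) : l ≤ level t := Nat.le_log_of_pow_le one_lt_two h

theorem tendsto_level : Tendsto level atTop atTop := by
  refine tendsto_atTop.2 fun b => eventually_atTop.2 ⟨2 ^ b, fun t ht => le_level (by omega)⟩

/-- The entries of the operator: in the blocks that are switched on by `x`, Toeplitz matrices whose
symbol is a normalized partial sum of the logarithm. -/
noncomputable def kern (x : ℕ → Bool) (i j : ℕ) : ℝ :=
  if j < i ∧ level i = level j ∧ x (level i) = true then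
    (harm (2 ^ level i))⁻¹ * (((i - 1 - j : ℕ) : ℝ) + 1)⁻¹ else 0

theorem harm_pow_pos (l : ℕ) : 0 < harm (2 ^ l) :=
  zero_lt_one.trans_le (one_le_harm (by positivity))

theorem kern_nonneg (x : ℕ → Bool) (i j : ℕ) : 0 ≤ kern x i j := by
  rw [kern]
  split_ifs
  · have := harm_pow_pos (level i)
    positivity
  · exact le_rfl

theorem kern_of_le (x : ℕ → Bool) {i j : ℕ} (h : i ≤ j) : kern x i j = 0 :=
  if_neg fun h' => absurd h'.1 (not_lt.2 h)

/-- Two indices of block l differ by less than 2^l, so each row and column is dominated by a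
Toeplitz sequence of total mass at most 1. -/
theorem kern_le (x : ℕ → Bool) {i j l : ℕ} (hl : level i = l ∨ level j = l) : kern x i j ≤
    if j < i ∧ i - 1 - j < 2 ^ l then (harm (2 ^ l))⁻¹ * (((i - 1 - j : ℕ) : ℝ) + 1)⁻¹ else 0 := by
  rw [kern]
  have hpos := harm_pow_pos l
  split_ifs with h1 h2 h2
  · have : level i = l := by
      rcases hl with h | h
      · exact h
      · rw [h1.2.1, h]
    rw [this]
  · exfalso
    obtain ⟨h3, h4, -⟩ := h1
    have h5 : level i = l ∧ level j = l := by
      rcases hl with h | h <;> constructor <;> omega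
    rw [level_eq_iff, level_eq_iff] at h5
    omega
  · positivity
  · exact le_rfl

theorem sum_range_ite_harm_le (m n : ℕ) :
    ∑ d ∈ Finset.range m, (if d < n then (harm n)⁻¹ * ((d : ℝ) + 1)⁻¹ else 0) ≤ 1 := by
  rw [← Finset.sum_filter]
  have h0 : 0 ≤ harm n := Finset.sum_nonneg fun d _ => by positivity
  calc _ ≤ ∑ d ∈ Finset.range n, (harm n)⁻¹ * ((d : ℝ) + 1)⁻¹ := by
        refine Finset.sum_le_sum_of_subset_of_nonneg (fun d hd => ?_) fun d _ _ => by positivity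
        exact Finset.mem_range.2 (Finset.mem_filter.1 hd).2
    _ = (harm n)⁻¹ * harm n := by rw [← Finset.mul_sum, harm]
    _ ≤ 1 := inv_mul_le_one

theorem sum_kern_row_le (x : ℕ → Bool) (i : ℕ) : ∑ j ∈ Finset.range i, kern x i j ≤ 1 := by
  refine le_trans (Finset.sum_le_sum fun j hj => kern_le x (Or.inl rfl))
    (le_trans (le_of_eq ?_) (sum_range_ite_harm_le i (2 ^ level i)))
  rw [← Finset.sum_range_reflect (fun d : ℕ => if d < 2 ^ level i then
    (harm (2 ^ level i))⁻¹ * ((d : ℝ) + 1)⁻¹ else 0) i]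
  refine Finset.sum_congr rfl fun j hj => ?_
  simp [Finset.mem_range.1 hj]

theorem sum_kern_col_le (x : ℕ → Bool) (j m : ℕ) : ∑ i ∈ Finset.range m, kern x i j ≤ 1 := by
  have h : ∑ i ∈ Finset.range m, kern x i j ≤ ∑ i ∈ Finset.range (j + 1 + m), kern x i j :=
    Finset.sum_le_sum_of_subset_of_nonneg (Finset.range_mono (by omega))
      fun i _ _ => kern_nonneg x i j
  refine h.trans ?_
  rw [Finset.sum_range_add, Finset.sum_eq_zero fun i hi => kern_of_le x
    (Nat.lt_succ_iff.1 (Finset.mem_range.1 hi)), zero_add]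
  refine le_trans (Finset.sum_le_sum fun i hi => kern_le x (Or.inr rfl))
    (le_trans (le_of_eq ?_) (sum_range_ite_harm_le m (2 ^ level j)))
  refine Finset.sum_congr rfl fun d _ => ?_
  have h1 : j < j + 1 + d := by omega
  have h2 : j + 1 + d - 1 - j = d := by omega
  rw [h2]
  simp [h1]

/-- The product of the matrix `kern x` with a sequence. -/
noncomputable def kernSum (x : ℕ → Bool) (u : ℕ → ℂ) (i : ℕ) : ℂ :=
  ∑ j ∈ Finset.range i, (kern x i j : ℂ) * u j

theorem norm_sq_kernSum_le (x : ℕ → Bool) (u : ℕ → ℂ) (i : ℕ) :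
    ‖kernSum x u i‖ ^ 2 ≤ ∑ j ∈ Finset.range i, kern x i j * ‖u j‖ ^ 2 := by
  have h1 : ‖kernSum x u i‖ ≤ ∑ j ∈ Finset.range i, kern x i j * ‖u j‖ := by
    refine (norm_sum_le _ _).trans (le_of_eq (Finset.sum_congr rfl fun j _ => ?_))
    rw [norm_mul, Complex.norm_real, Real.norm_of_nonneg (kern_nonneg x i j)]
  calc ‖kernSum x u i‖ ^ 2 ≤ (∑ j ∈ Finset.range i, kern x i j * ‖u j‖) ^ 2 := by gcongr
    _ ≤ (∑ j ∈ Finset.range i, kern x i j) * ∑ j ∈ Finset.range i, kern x i j * ‖u j‖ ^ 2 :=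
      Finset.sum_sq_le_sum_mul_sum_of_sq_le_mul _ (fun j _ => kern_nonneg x i j)
        (fun j _ => mul_nonneg (kern_nonneg x i j) (by positivity)) fun j _ => le_of_eq (by ring)
    _ ≤ _ := mul_le_of_le_one_left
        (Finset.sum_nonneg fun j _ => mul_nonneg (kern_nonneg x i j) (by positivity))
        (sum_kern_row_le x i)

/-- Schur's test: the entries are nonnegative with row and column sums at most 1. -/
theorem sum_norm_sq_kernSum_le (x : ℕ → Bool) (u : L2) (m : ℕ) :
    ∑ i ∈ Finset.range m, ‖kernSum x u i‖ ^ 2 ≤ ‖u‖ ^ 2 := by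
  calc _ ≤ ∑ i ∈ Finset.range m, ∑ j ∈ Finset.range m, kern x i j * ‖u j‖ ^ 2 := by
        refine Finset.sum_le_sum fun i hi => (norm_sq_kernSum_le x u i).trans ?_
        refine Finset.sum_le_sum_of_subset_of_nonneg
          (Finset.range_mono (Finset.mem_range.1 hi).le) fun j _ _ =>
            mul_nonneg (kern_nonneg x i j) (by positivity)
    _ = ∑ j ∈ Finset.range m, (∑ i ∈ Finset.range m, kern x i j) * ‖u j‖ ^ 2 := by
        rw [Finset.sum_comm]
        exact Finset.sum_congr rfl fun j _ => (Finset.sum_mul _ _ _).symm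
    _ ≤ ∑ j ∈ Finset.range m, ‖u j‖ ^ 2 := by
        refine Finset.sum_le_sum fun j _ => mul_le_of_le_one_left (by positivity) ?_
        exact sum_kern_col_le x j m
    _ ≤ ‖u‖ ^ 2 := by
        rw [← norm_sq_proj]
        exact pow_le_pow_left₀ (norm_nonneg _) (norm_proj_apply_le m u) 2

/-- The operator with the matrix `kern x`. -/
noncomputable def kernOp (x : ℕ → Bool) : Op :=
  LinearMap.mkContinuous
    { toFun := fun u => ⟨kernSum x u, memℓp_gen (by
        simpa using summable_of_sum_range_le (fun i => by positivity)
          (sum_norm_sq_kernSum_le x u))⟩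
      map_add' := fun u v => by
        ext i
        show kernSum x (u + v : L2) i = kernSum x u i + kernSum x v i
        simp [kernSum, mul_add, Finset.sum_add_distrib]
      map_smul' := fun c u => by
        ext i
        simp [kernSum, Finset.mul_sum, mul_left_comm] } 1 (fun u => by
        rw [one_mul]
        refine le_of_sq_le_sq ?_ (norm_nonneg _)
        rw [norm_sq_eq_tsum]
        exact Real.tsum_le_of_sum_range_le (fun i => by positivity) (sum_norm_sq_kernSum_le x u))

theorem kernOp_apply (x : ℕ → Bool) (u : L2) (i : ℕ) :
    kernOp x u i = ∑ j ∈ Finset.range i, (kern x i j : ℂ) * u j := rfl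

theorem norm_kernOp_le (x : ℕ → Bool) : ‖kernOp x‖ ≤ 1 :=
  LinearMap.mkContinuous_norm_le _ zero_le_one _

theorem one_sub_proj_apply_apply (m : ℕ) (u : L2) (i : ℕ) :
    (1 - proj m) u i = if i < m then 0 else u i := by
  rw [sub_apply, one_apply_eq_self, lp.coeFn_sub, Pi.sub_apply, proj_apply_apply]
  split_ifs <;> simp

theorem proj_mul_kernOp_mul (x : ℕ → Bool) (t : ℕ) :
    proj (t + 1) * kernOp x * (1 - proj t) = 0 := by
  ext u i
  rw [mul_apply_eq_comp, mul_apply_eq_comp, proj_apply_apply, kernOp_apply]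
  split_ifs with hi
  · refine Finset.sum_eq_zero fun j hj => ?_
    rw [one_sub_proj_apply_apply, if_pos, mul_zero]
    have := Finset.mem_range.1 hj
    omega
  · rfl

/-- The squared Hilbert–Schmidt norm of the corner at t, with h the harmonic sum of its block. Row t
contributes at most 2h⁻², row t+r+1 at most 2h⁻²/(r+1), and r < 2^level runs through a sum equal to
h. Normalising by h thus makes the corners small as the blocks grow. -/
theorem sum_sq_kern_le (x : ℕ → Bool) (t m : ℕ) :
    ∑ i ∈ Finset.range m, ∑ j ∈ Finset.range (t + 1), kern x (t + i) j ^ 2 ≤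
      4 * (harm (2 ^ level t))⁻¹ := by
  set h := harm (2 ^ level t) with hh
  have hpos : 0 < h := harm_pow_pos _
  have h1 : 1 ≤ h := one_le_harm (by positivity)
  have hrow0 : ∑ j ∈ Finset.range (t + 1), kern x t j ^ 2 ≤ h⁻¹ ^ 2 * 2 := by
    rw [Finset.sum_range_succ, kern_of_le x le_rfl, zero_pow two_ne_zero, add_zero]
    calc _ ≤ ∑ j ∈ Finset.range t, h⁻¹ ^ 2 * (((t - 1 - j : ℕ) : ℝ) + 1)⁻¹ ^ 2 := by
          refine Finset.sum_le_sum fun j _ => ?_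
          rw [← mul_pow]
          refine pow_le_pow_left₀ (kern_nonneg x t j) ((kern_le x (Or.inl rfl)).trans ?_) 2
          split_ifs
          · exact le_rfl
          · positivity
      _ = h⁻¹ ^ 2 * ∑ j ∈ Finset.range t, (((j + 0 : ℕ) : ℝ) + 1)⁻¹ ^ 2 := by
          rw [← Finset.mul_sum,
            ← Finset.sum_range_reflect (fun j : ℕ => (((j + 0 : ℕ) : ℝ) + 1)⁻¹ ^ 2) t]
          rfl
      _ ≤ h⁻¹ ^ 2 * 2 := by
          have := sum_inv_sq_le 0 t
          simp only [Nat.cast_zero, zero_add, inv_one, mul_one] at this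
          gcongr
  have hrow : ∀ r, ∑ j ∈ Finset.range (t + 1), kern x (t + (r + 1)) j ^ 2 ≤
      h⁻¹ ^ 2 * (2 * if r < 2 ^ level t then ((r : ℝ) + 1)⁻¹ else 0) := by
    intro r
    by_cases hr : level (t + (r + 1)) = level t
    · have hr' : r < 2 ^ level t := by
        have h2 := (level_eq_iff (t := t)).1 rfl
        have h3 := level_eq_iff.1 hr
        omega
      rw [if_pos hr']
      calc _ ≤ ∑ j ∈ Finset.range (t + 1),
            h⁻¹ ^ 2 * (((t + 1 - 1 - j + r : ℕ) : ℝ) + 1)⁻¹ ^ 2 := by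
            refine Finset.sum_le_sum fun j hj => ?_
            rw [← mul_pow]
            refine pow_le_pow_left₀ (kern_nonneg x _ j) ((kern_le x (Or.inl hr)).trans ?_) 2
            have hj' := Finset.mem_range.1 hj
            have h4 : t + (r + 1) - 1 - j = t + 1 - 1 - j + r := by omega
            rw [h4]
            split_ifs
            · exact le_rfl
            · positivity
        _ = h⁻¹ ^ 2 * ∑ j ∈ Finset.range (t + 1), (((j + r : ℕ) : ℝ) + 1)⁻¹ ^ 2 := by
            rw [← Finset.mul_sum,
              ← Finset.sum_range_reflect (fun j : ℕ => (((j + r : ℕ) : ℝ) + 1)⁻¹ ^ 2) (t + 1)]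
        _ ≤ _ := by
            have := sum_inv_sq_le r (t + 1)
            gcongr
    · rw [Finset.sum_eq_zero]
      · split_ifs <;> positivity
      intro j hj
      have hj' : level j ≤ level t := level_mono (Nat.lt_succ_iff.1 (Finset.mem_range.1 hj))
      have ht' : level t ≤ level (t + (r + 1)) := level_mono (by omega)
      rw [kern, if_neg, zero_pow two_ne_zero]
      rintro ⟨-, h2, -⟩
      omega
  have hm : ∑ i ∈ Finset.range m, ∑ j ∈ Finset.range (t + 1), kern x (t + i) j ^ 2 ≤
      ∑ i ∈ Finset.range (m + 1), ∑ j ∈ Finset.range (t + 1), kern x (t + i) j ^ 2 :=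
    Finset.sum_le_sum_of_subset_of_nonneg (Finset.range_mono (Nat.le_succ m))
      fun i _ _ => Finset.sum_nonneg fun j _ => by positivity
  refine hm.trans ?_
  rw [Finset.sum_range_succ', add_zero]
  have h5 : ∑ r ∈ Finset.range m, (if r < 2 ^ level t then ((r : ℝ) + 1)⁻¹ else 0) ≤ h := by
    have := sum_range_ite_harm_le m (2 ^ level t)
    simp only [← mul_ite_zero] at this
    rwa [← Finset.mul_sum, ← hh, inv_mul_le_one₀ hpos] at this
  calc _ ≤ ∑ r ∈ Finset.range m,
        (h⁻¹ ^ 2 * (2 * if r < 2 ^ level t then ((r : ℝ) + 1)⁻¹ else 0)) + h⁻¹ ^ 2 * 2 := by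
        gcongr with r _
        exact hrow r
    _ ≤ h⁻¹ ^ 2 * (2 * h) + h⁻¹ ^ 2 * (2 * h) := by
        rw [← Finset.mul_sum, ← Finset.mul_sum]
        gcongr
        linarith
    _ = 4 * h⁻¹ := by
        field_simp
        ring

theorem kernOp_apply_of_support (x : ℕ → Bool) {u : L2} {n : ℕ} (hu : ∀ j, n ≤ j → u j = 0) (i : ℕ) :
    kernOp x u i = ∑ j ∈ Finset.range n, (kern x i j : ℂ) * u j := by
  have h : ∀ m, (∀ j, m ≤ j → (kern x i j : ℂ) * u j = 0) →
      ∑ j ∈ Finset.range m, (kern x i j : ℂ) * u j =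
        ∑ j ∈ Finset.range (max i n), (kern x i j : ℂ) * u j ∨ max i n < m := fun m hm => by
    rcases le_or_gt m (max i n) with hle | hlt
    · refine Or.inl (Finset.sum_subset (Finset.range_mono hle) fun j _ hj => hm j ?_)
      simpa using hj
    · exact Or.inr hlt
  rw [kernOp_apply, (h i fun j hj => by rw [kern_of_le x hj, Complex.ofReal_zero, zero_mul]).resolve_right
    (not_lt.2 (le_max_left _ _)), (h n fun j hj => by rw [hu j hj, mul_zero]).resolve_right
    (not_lt.2 (le_max_right _ _))]

theorem norm_corner_kernOp_le (x : ℕ → Bool) (t : ℕ) :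
    ‖(1 - proj t) * kernOp x * proj (t + 1)‖ ≤ √(4 * (harm (2 ^ level t))⁻¹) := by
  refine ContinuousLinearMap.opNorm_le_bound _ (Real.sqrt_nonneg _) fun u => ?_
  set y := ((1 - proj t) * kernOp x * proj (t + 1)) u with hy
  have hpos := harm_pow_pos (level t)
  have hy1 : ∀ i, i < t → y i = 0 := fun i hi => by
    rw [hy, mul_apply_eq_comp, mul_apply_eq_comp, one_sub_proj_apply_apply, if_pos hi]
  have hy2 : ∀ r, ‖y (t + r)‖ ^ 2 ≤
      (∑ j ∈ Finset.range (t + 1), kern x (t + r) j ^ 2) * ‖u‖ ^ 2 := fun r => by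
    have h1 : y (t + r) = ∑ j ∈ Finset.range (t + 1), (kern x (t + r) j : ℂ) * u j := by
      rw [hy, mul_apply_eq_comp, mul_apply_eq_comp, one_sub_proj_apply_apply, if_neg (by omega),
        kernOp_apply_of_support x (n := t + 1) fun j hj => by
          rw [proj_apply_apply, if_neg (not_lt.2 hj)]]
      refine Finset.sum_congr rfl fun j hj => ?_
      rw [proj_apply_apply, if_pos (Finset.mem_range.1 hj)]
    have h2 : ‖y (t + r)‖ ≤ ∑ j ∈ Finset.range (t + 1), kern x (t + r) j * ‖u j‖ := by
      rw [h1]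
      refine (norm_sum_le _ _).trans (le_of_eq (Finset.sum_congr rfl fun j _ => ?_))
      rw [norm_mul, Complex.norm_real, Real.norm_of_nonneg (kern_nonneg x _ j)]
    calc _ ≤ (∑ j ∈ Finset.range (t + 1), kern x (t + r) j * ‖u j‖) ^ 2 := by gcongr
      _ ≤ (∑ j ∈ Finset.range (t + 1), kern x (t + r) j ^ 2) *
          ∑ j ∈ Finset.range (t + 1), ‖u j‖ ^ 2 := Finset.sum_mul_sq_le_sq_mul_sq _ _ _
      _ ≤ _ := by
        refine mul_le_mul_of_nonneg_left ?_ (Finset.sum_nonneg fun j _ => by positivity)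
        rw [← norm_sq_proj]
        exact pow_le_pow_left₀ (norm_nonneg _) (norm_proj_apply_le _ u) 2
  refine le_of_sq_le_sq ?_ (by positivity)
  rw [mul_pow, Real.sq_sqrt (by positivity), norm_sq_eq_tsum]
  refine Real.tsum_le_of_sum_range_le (fun i => by positivity) fun m => ?_
  calc _ ≤ ∑ i ∈ Finset.range (t + m), ‖y i‖ ^ 2 :=
        Finset.sum_le_sum_of_subset_of_nonneg (Finset.range_mono (by omega))
          fun i _ _ => by positivity
    _ = ∑ r ∈ Finset.range m, ‖y (t + r)‖ ^ 2 := by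
        rw [Finset.sum_range_add, Finset.sum_eq_zero fun i hi => ?_, zero_add]
        rw [hy1 i (Finset.mem_range.1 hi), norm_zero, zero_pow two_ne_zero]
    _ ≤ (∑ r ∈ Finset.range m, ∑ j ∈ Finset.range (t + 1), kern x (t + r) j ^ 2) * ‖u‖ ^ 2 := by
        rw [Finset.sum_mul]
        exact Finset.sum_le_sum fun r _ => hy2 r
    _ ≤ _ := by
        gcongr
        exact sum_sq_kern_le x t m

theorem tendsto_corner_bound :
    Tendsto (fun t => √(4 * (harm (2 ^ level t))⁻¹)) atTop (𝓝 0) := by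
  have h1 : Tendsto (fun t => harm (2 ^ level t)) atTop atTop :=
    tendsto_harm.comp ((tendsto_pow_atTop_atTop_of_one_lt one_lt_two).comp tendsto_level)
  have h2 := (h1.inv_tendsto_atTop.const_mul 4).sqrt
  simpa using h2

/-! ### The operator on a sparse set of basis vectors -/

/-- Each term is taken so far out that f has already passed the previous one. For p t < m ≤ p (t+1),
f m then exceeds all p i with i < t: at most one sparse index is left behind, however slowly f
grows. -/
theorem exists_sparse {f : ℕ → ℕ} (hf : Tendsto f atTop atTop) :
    ∃ p : ℕ → ℕ, StrictMono p ∧ ∀ t m, p (t + 1) ≤ m → p t < f m := by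
  have h : ∀ a, ∃ k, ∀ m ≥ k, a < f m := fun a =>
    eventually_atTop.1 (hf.eventually (eventually_gt_atTop a))
  choose g hg using h
  let p : ℕ → ℕ := fun t => Nat.rec 0 (fun _ a => max (a + 1) (g a)) t
  have hp : ∀ t, p (t + 1) = max (p t + 1) (g (p t)) := fun t => rfl
  refine ⟨p, strictMono_nat_of_lt_succ fun t => ?_, fun t m hm => hg _ _ ?_⟩
  · rw [hp]
    exact lt_of_lt_of_le (Nat.lt_succ_self _) (le_max_left _ _)
  · rw [hp] at hm
    exact (le_max_right _ _).trans hm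

/-- The compression of `kernOp x` moved to the basis vectors with numbers in the range of `p`. -/
noncomputable def sparseOp (p : ℕ → ℕ) (hp : Function.Injective p) (x : ℕ → Bool) : Op :=
  pushforward p hp * kernOp x * pullback p hp

theorem norm_sparseOp_le {p : ℕ → ℕ} (hp : Function.Injective p) (x : ℕ → Bool) :
    ‖sparseOp p hp x‖ ≤ 1 := by
  calc _ ≤ ‖pushforward p hp‖ * ‖kernOp x‖ * ‖pullback p hp‖ :=
        (norm_mul_le _ _).trans (by gcongr; exact norm_mul_le _ _)
    _ ≤ 1 * 1 * 1 := by
      gcongr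
      exacts [norm_pushforward_le hp, norm_kernOp_le x, norm_pullback_le hp]
    _ = 1 := by ring

theorem pullback_mul_proj {p : ℕ → ℕ} (hp : StrictMono p) {t m : ℕ} (h : m ≤ p t) :
    pullback p hp.injective * proj m = proj t * pullback p hp.injective * proj m := by
  ext u i
  rw [mul_assoc, mul_apply_eq_comp, mul_apply_eq_comp, mul_apply_eq_comp, proj_apply_apply]
  split_ifs with hi
  · rfl
  · rw [pullback_apply, proj_apply_apply, if_neg]
    have := hp.monotone (not_lt.1 hi)
    omega

theorem pullback_mul_one_sub_proj {p : ℕ → ℕ} (hp : StrictMono p) {t m : ℕ}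
    (h : ∀ i < t, p i < m) :
    pullback p hp.injective * (1 - proj m) =
      (1 - proj t) * pullback p hp.injective * (1 - proj m) := by
  ext u i
  rw [mul_assoc, mul_apply_eq_comp, mul_apply_eq_comp, mul_apply_eq_comp, one_sub_proj_apply_apply]
  split_ifs with hi
  · rw [pullback_apply, one_sub_proj_apply_apply, if_pos (h i hi)]
  · rfl

theorem one_sub_proj_mul_self (m : ℕ) : (1 - proj m) * (1 - proj m) = 1 - proj m := by
  rw [mul_sub, mul_one, sub_mul 1 (proj m) (proj m), one_mul, proj_mul_proj, min_self, sub_self,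
    sub_zero]

theorem adjoint_one_sub_proj (m : ℕ) :
    ContinuousLinearMap.adjoint (1 - proj m) = 1 - proj m := by
  rw [map_sub, isSelfAdjoint_proj, ← ContinuousLinearMap.star_eq_adjoint, star_one]

theorem proj_mul_pushforward {p : ℕ → ℕ} (hp : StrictMono p) {t m : ℕ} (h : m ≤ p t) :
    proj m * pushforward p hp.injective = proj m * pushforward p hp.injective * proj t := by
  have := congrArg star (pullback_mul_proj hp h)
  simpa only [star_mul, ContinuousLinearMap.star_eq_adjoint, isSelfAdjoint_proj, adjoint_pullback,
    ← mul_assoc] using this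

theorem one_sub_proj_mul_pushforward {p : ℕ → ℕ} (hp : StrictMono p) {t m : ℕ}
    (h : ∀ i < t, p i < m) :
    (1 - proj m) * pushforward p hp.injective =
      (1 - proj m) * pushforward p hp.injective * (1 - proj t) := by
  have := congrArg star (pullback_mul_one_sub_proj hp h)
  rw [star_mul, star_mul, star_mul] at this
  simpa only [ContinuousLinearMap.star_eq_adjoint, adjoint_one_sub_proj, adjoint_pullback,
    ← mul_assoc] using this

/-- P_m sees only the first t+1 sparse indices and 1 - P_k removes at least the first t. One corner
reduces to the small corner of `kernOp x`, the other to a block that vanishes by strict lower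
triangularity. -/
theorem corner_sparseOp {p : ℕ → ℕ} (hp : StrictMono p) (x : ℕ → Bool) {t m k : ℕ}
    (h1 : m ≤ p (t + 1)) (h2 : ∀ i < t, p i < k) :
    ‖(1 - proj k) * sparseOp p hp.injective x * proj m‖ ≤ √(4 * (harm (2 ^ level t))⁻¹) ∧
      proj m * sparseOp p hp.injective x * (1 - proj k) = 0 := by
  constructor
  · have h3 : (1 - proj k) * sparseOp p hp.injective x * proj m =
        ((1 - proj k) * pushforward p hp.injective) *
          ((1 - proj t) * kernOp x * proj (t + 1)) * (pullback p hp.injective * proj m) := by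
      calc _ = ((1 - proj k) * pushforward p hp.injective) * kernOp x *
            (pullback p hp.injective * proj m) := by simp only [sparseOp, mul_assoc]
        _ = _ := by
          rw [one_sub_proj_mul_pushforward hp h2, pullback_mul_proj hp h1]
          simp only [mul_assoc]
          have h4 : ∀ T : Op, (1 - proj t) * ((1 - proj t) * T) = (1 - proj t) * T := fun T => by
            rw [← mul_assoc, one_sub_proj_mul_self]
          have h5 : ∀ T : Op, proj (t + 1) * (proj (t + 1) * T) = proj (t + 1) * T := fun T => by
            rw [← mul_assoc, proj_mul_proj, min_self]
          rw [h4, h5]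
    rw [h3]
    have h6 : ‖(1 - proj k) * pushforward p hp.injective‖ ≤ 1 :=
      (norm_mul_le _ _).trans (mul_le_one₀ (norm_one_sub_proj_le k) (norm_nonneg _)
        (norm_pushforward_le _))
    have h7 : ‖pullback p hp.injective * proj m‖ ≤ 1 :=
      (norm_mul_le _ _).trans (mul_le_one₀ (norm_pullback_le _) (norm_nonneg _) (norm_proj_le m))
    calc _ ≤ ‖(1 - proj k) * pushforward p hp.injective‖ *
          ‖(1 - proj t) * kernOp x * proj (t + 1)‖ * ‖pullback p hp.injective * proj m‖ :=
          (norm_mul_le _ _).trans (by gcongr; exact norm_mul_le _ _)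
      _ ≤ 1 * √(4 * (harm (2 ^ level t))⁻¹) * 1 := by
          gcongr
          exact norm_corner_kernOp_le x t
      _ = _ := by ring
  · calc _ = (proj m * pushforward p hp.injective) * kernOp x *
          (pullback p hp.injective * (1 - proj k)) := by simp only [sparseOp, mul_assoc]
      _ = (proj m * pushforward p hp.injective) * (proj (t + 1) * kernOp x * (1 - proj t)) *
          (pullback p hp.injective * (1 - proj k)) := by
          rw [proj_mul_pushforward hp h1, pullback_mul_one_sub_proj hp h2]
          simp only [mul_assoc]
          have h4 : ∀ T : Op, (1 - proj t) * ((1 - proj t) * T) = (1 - proj t) * T := fun T => by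
            rw [← mul_assoc, one_sub_proj_mul_self]
          have h5 : ∀ T : Op, proj (t + 1) * (proj (t + 1) * T) = proj (t + 1) * T := fun T => by
            rw [← mul_assoc, proj_mul_proj, min_self]
          rw [h4, h5]
      _ = 0 := by rw [proj_mul_kernOp_mul, mul_zero, zero_mul]

theorem smul_sparseOp_mem_dispersionOps {f : ℕ → ℕ} {p : ℕ → ℕ} (hp : StrictMono p)
    (hfp : ∀ t m, p (t + 1) ≤ m → p t < f m) (x : ℕ → Bool) (s : ℂ) :
    s • sparseOp p hp.injective x ∈ dispersionOps f := by
  have hlim := tendsto_corner_bound.const_mul ‖s‖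
  rw [mul_zero] at hlim
  refine squeeze_zero_norm (a := fun m =>
    max ‖(1 - proj (f m)) * (s • sparseOp p hp.injective x) * proj m‖
      ‖proj m * (s • sparseOp p hp.injective x) * (1 - proj (f m))‖)
    (fun m => by rw [Real.norm_of_nonneg (by positivity)]) ?_
  rw [Metric.tendsto_atTop]
  intro η hη
  obtain ⟨t₀, ht₀⟩ := eventually_atTop.1 (hlim.eventually (gt_mem_nhds hη))
  refine ⟨p t₀ + 1, fun m hm => ?_⟩
  -- The least such k is t + 1, so p t < m ≤ p (t+1).
  have hex : ∃ k, m ≤ p k := ⟨m, hp.le_apply⟩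
  obtain ⟨t, ht⟩ : ∃ t, Nat.find hex = t + 1 := by
    refine Nat.exists_eq_succ_of_ne_zero fun h => ?_
    have h1 := Nat.find_spec hex
    rw [h] at h1
    have := hp.monotone (Nat.zero_le t₀)
    omega
  have h1 : m ≤ p (t + 1) := ht ▸ Nat.find_spec hex
  have h2 : p t < m := not_le.1 (Nat.find_min hex (by omega))
  have h3 : t₀ ≤ t := by
    by_contra hlt
    have := hp.monotone (show t + 1 ≤ t₀ by omega)
    omega
  obtain ⟨h4, h5⟩ := corner_sparseOp hp x (k := f m) h1 fun i hi =>
    hfp i m ((hp.monotone (show i + 1 ≤ t from hi)).trans h2.le)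
  rw [mul_smul_comm, mul_smul_comm, smul_mul_assoc, smul_mul_assoc, h5, smul_zero, norm_zero,
    max_eq_left (norm_nonneg _), dist_zero_right, norm_norm, norm_smul]
  exact (mul_le_mul_of_nonneg_left h4 (norm_nonneg s)).trans_lt (ht₀ t h3)

theorem locallyConstantEntries_sparseOp {p : ℕ → ℕ} (hp : Function.Injective p) :
    LocallyConstantEntries fun x => sparseOp p hp x := by
  refine LocallyConstantEntries.sandwich (fun i j => ?_) hp hp
  have h : ∀ x, inner ℂ (basisVec i) (kernOp x (basisVec j)) = (kern x i j : ℂ) := fun x => by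
    rw [inner_basisVec, kernOp_apply_of_support x (n := j + 1) fun k hk => by
      rw [basisVec_apply, if_neg (by omega)], Finset.sum_eq_single j]
    · rw [basisVec_apply, if_pos rfl, mul_one]
    · intro k _ hk
      rw [basisVec_apply, if_neg hk, mul_zero]
    · intro hj
      exact absurd (Finset.self_mem_range_succ j) hj
  simp only [h]
  refine isLocallyConstant_of_agree (Set.finite_singleton (level i)) (fun l => continuous_apply l)
    fun x y hxy => ?_
  rw [kern, kern, hxy _ rfl]

/-- Finitely many active blocks give a compact operator, so a nonzero spectral point would be an
eigenvalue; strict lower triangularity makes an eigenvector vanish coordinate by coordinate. -/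
theorem spectrum_smul_sparseOp_subset {p : ℕ → ℕ} (hp : Function.Injective p) {x : ℕ → Bool}
    (hx : ∃ n, ∀ j ≥ n, x j = false) (s : ℂ) :
    spectrum ℂ (s • sparseOp p hp x) ⊆ {0} := by
  obtain ⟨l, hl⟩ := hx
  have hcomp : IsCompactOperator (s • sparseOp p hp x) := by
    have h1 : proj (2 ^ l) * kernOp x = kernOp x := by
      ext u i
      rw [mul_apply_eq_comp, proj_apply_apply]
      split_ifs with hi
      · rfl
      · rw [kernOp_apply]
        refine (Finset.sum_eq_zero fun j _ => ?_).symm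
        have h2 : l ≤ level i := le_level (by omega)
        rw [kern, if_neg, Complex.ofReal_zero, zero_mul]
        rw [hl _ h2]
        simp
    have h3 : s • sparseOp p hp x =
        (s • pushforward p hp) * proj (2 ^ l) * (kernOp x * pullback p hp) := by
      rw [sparseOp]
      conv_lhs => rw [← h1]
      simp only [mul_assoc, smul_mul_assoc]
    rw [h3]
    exact ((isCompactOperator_proj (2 ^ l)).clm_comp (s • pushforward p hp)).comp_clm
      (kernOp x * pullback p hp)
  intro μ hμ
  by_contra hμ0
  obtain ⟨v, hv⟩ := (hcomp.hasEigenvalue_iff_mem_spectrum hμ0).2 hμ |>.exists_hasEigenvector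
  have hAv : s • sparseOp p hp x v = μ • v := hv.apply_eq_smul
  have hz : pullback p hp v = 0 := by
    have h1 : μ • pullback p hp v = s • kernOp x (pullback p hp v) := by
      rw [← map_smul, ← hAv, map_smul, sparseOp, mul_apply_eq_comp, mul_apply_eq_comp,
        pullback_pushforward]
    ext i
    induction i using Nat.strong_induction_on with
    | _ i ih =>
      have h2 : μ * pullback p hp v i = s * kernOp x (pullback p hp v) i :=
        congrArg (fun w : L2 => w i) h1
      rw [kernOp_apply, Finset.sum_eq_zero fun j hj => by
        rw [ih j (Finset.mem_range.1 hj)]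
        exact mul_zero _, mul_zero] at h2
      exact (mul_eq_zero.1 h2).resolve_left hμ0
  rw [sparseOp, mul_apply_eq_comp, mul_apply_eq_comp, hz, map_zero, map_zero, smul_zero] at hAv
  exact hv.2 ((smul_eq_zero.1 hAv.symm).resolve_left hμ0)

/-- The indicator function of a block. -/
noncomputable def blockVec (l : ℕ) : L2 :=
  ∑ r ∈ Finset.range (2 ^ l), basisVec (2 ^ l - 1 + r)

theorem blockVec_apply (l i : ℕ) : blockVec l i = if level i = l then 1 else 0 := by
  have hl : 0 < 2 ^ l := by positivity
  rw [blockVec, sum_apply_L2]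
  simp only [basisVec_apply]
  split_ifs with h
  · rw [level_eq_iff] at h
    rw [Finset.sum_eq_single (i + 1 - 2 ^ l)]
    · exact if_pos (by omega)
    · intro r _ hr
      exact if_neg (by omega)
    · intro hr
      rw [Finset.mem_range] at hr
      omega
  · refine Finset.sum_eq_zero fun r hr => if_neg fun h' => h ?_
    rw [level_eq_iff]
    have := Finset.mem_range.1 hr
    omega

theorem norm_sq_of_block {l : ℕ} {u : L2} (hu : ∀ i, level i ≠ l → u i = 0) :
    ‖u‖ ^ 2 = ∑ r ∈ Finset.range (2 ^ l), ‖u (2 ^ l - 1 + r)‖ ^ 2 := by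
  have hl : 0 < 2 ^ l := by positivity
  have h1 : proj (2 ^ l - 1 + 2 ^ l) u = u := by
    ext i
    rw [proj_apply_apply]
    split_ifs with hi
    · rfl
    · rw [hu i fun h => ?_]
      rw [level_eq_iff] at h
      omega
  rw [← h1, norm_sq_proj, h1, Finset.sum_range_add, Finset.sum_eq_zero fun i hi => ?_, zero_add]
  rw [hu i fun h => ?_, norm_zero, zero_pow two_ne_zero]
  rw [level_eq_iff] at h
  have := Finset.mem_range.1 hi
  omega

theorem level_add {l r : ℕ} (hr : r < 2 ^ l) : level (2 ^ l - 1 + r) = l := by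
  rw [level_eq_iff]
  omega

theorem norm_sq_blockVec (l : ℕ) : ‖blockVec l‖ ^ 2 = 2 ^ l := by
  rw [norm_sq_of_block (l := l) fun i hi => by rw [blockVec_apply, if_neg hi]]
  rw [Finset.sum_congr rfl fun r hr => by
    rw [blockVec_apply, if_pos (level_add (Finset.mem_range.1 hr)), norm_one, one_pow]]
  simp

theorem kernOp_blockVec_apply {x : ℕ → Bool} {l : ℕ} (hx : x l = true) {r : ℕ} (hr : r < 2 ^ l) :
    kernOp x (blockVec l) (2 ^ l - 1 + r) = ((harm (2 ^ l))⁻¹ * harm r : ℝ) := by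
  have hl : 0 < 2 ^ l := by positivity
  rw [kernOp_apply, Finset.sum_range_add, Finset.sum_eq_zero fun i hi => ?_, zero_add, harm.eq_def r,
    ← Finset.sum_range_reflect, Finset.mul_sum, Complex.ofReal_sum]
  · refine Finset.sum_congr rfl fun q hq => ?_
    have hq' := Finset.mem_range.1 hq
    have hqr : r - 1 - q < 2 ^ l := by omega
    rw [blockVec_apply, if_pos (level_add hqr), mul_one, kern, if_pos, level_add hr]
    · have : 2 ^ l - 1 + r - 1 - (2 ^ l - 1 + (r - 1 - q)) = q := by omega
      rw [this]
    · rw [level_add hr, level_add hqr]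
      exact ⟨by omega, rfl, hx⟩
  · rw [blockVec_apply, if_neg, mul_zero]
    rw [level_eq_iff]
    have := Finset.mem_range.1 hi
    omega

/-- At position r of the block the difference is (H_r - H_n)/H_n with n = 2^l. Relative to
‖`blockVec l`‖² = n the bound is 2/H_n² → 0, so the block vectors are approximate eigenvectors for
1. -/
theorem norm_sq_kernOp_blockVec_sub_le {x : ℕ → Bool} {l : ℕ} (hx : x l = true) :
    ‖kernOp x (blockVec l) - blockVec l‖ ^ 2 ≤ 2 * (harm (2 ^ l))⁻¹ ^ 2 * 2 ^ l := by
  have hpos := harm_pow_pos l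
  rw [norm_sq_of_block (l := l) fun i hi => ?_]
  · calc _ = ∑ r ∈ Finset.range (2 ^ l), (harm (2 ^ l))⁻¹ ^ 2 * (harm (2 ^ l) - harm r) ^ 2 := by
          refine Finset.sum_congr rfl fun r hr => ?_
          have hr' := Finset.mem_range.1 hr
          rw [lp.coeFn_sub, Pi.sub_apply, kernOp_blockVec_apply hx hr', blockVec_apply,
            if_pos (level_add hr'), ← Complex.ofReal_one, ← Complex.ofReal_sub, Complex.norm_real,
            Real.norm_eq_abs, sq_abs]
          field_simp
          ring
      _ ≤ (harm (2 ^ l))⁻¹ ^ 2 * (2 * (2 ^ l : ℕ)) := by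
          rw [← Finset.mul_sum]
          gcongr
          exact sum_sq_harm_sub_le _
      _ = _ := by push_cast; ring
  · rw [lp.coeFn_sub, Pi.sub_apply, blockVec_apply, if_neg hi, sub_zero, kernOp_apply]
    refine Finset.sum_eq_zero fun j _ => ?_
    rw [blockVec_apply, kern]
    by_cases h : level j = l
    · rw [if_neg fun h' => hi (h'.2.1.trans h), Complex.ofReal_zero, zero_mul]
    · rw [if_neg h, mul_zero]

/-- A bounded inverse would bound the harmonic sums of all active blocks by a constant, but they are
unbounded. -/
theorem mem_spectrum_smul_sparseOp {p : ℕ → ℕ} (hp : Function.Injective p) {x : ℕ → Bool}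
    (hx : ∀ n, ∃ j ≥ n, x j = true) (s : ℂ) : s ∈ spectrum ℂ (s • sparseOp p hp x) := by
  intro h
  have hu := isUnit_sub_algebraMap_iff.2 h
  set T := s • sparseOp p hp x - algebraMap ℂ Op s with hT
  set C := ‖Ring.inverse T‖ * ‖s‖ with hC
  have hC0 : 0 ≤ C := by positivity
  have hb : ∀ l, x l = true → harm (2 ^ l) ^ 2 ≤ 2 * C ^ 2 := by
    intro l hl
    have hpos := harm_pow_pos l
    have h1 : T (pushforward p hp (blockVec l)) =
        s • pushforward p hp (kernOp x (blockVec l) - blockVec l) := by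
      rw [hT, sub_apply, smul_apply, Algebra.algebraMap_eq_smul_one, smul_apply, one_apply_eq_self,
        sparseOp, mul_apply_eq_comp, mul_apply_eq_comp, pullback_pushforward, map_sub, smul_sub]
    have h2 : Ring.inverse T (T (pushforward p hp (blockVec l))) = pushforward p hp (blockVec l) := by
      rw [← mul_apply_eq_comp, Ring.inverse_mul_cancel _ hu, one_apply_eq_self]
    have h3 := (Ring.inverse T).le_opNorm (T (pushforward p hp (blockVec l)))
    rw [h2, h1, norm_smul, norm_pushforward_apply, norm_pushforward_apply, ← mul_assoc, ← hC] at h3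
    have h4 : ‖blockVec l‖ ^ 2 ≤ C ^ 2 * (2 * (harm (2 ^ l))⁻¹ ^ 2 * 2 ^ l) := by
      refine (pow_le_pow_left₀ (norm_nonneg _) h3 2).trans ?_
      rw [mul_pow]
      gcongr
      exact norm_sq_kernOp_blockVec_sub_le hl
    rw [norm_sq_blockVec] at h4
    have h5 : (1 : ℝ) ≤ 2 * C ^ 2 * (harm (2 ^ l))⁻¹ ^ 2 := by
      have h6 : (0 : ℝ) < 2 ^ l := by positivity
      refine le_of_mul_le_mul_right ?_ h6
      linarith
    rw [inv_pow, ← div_eq_mul_inv, le_div_iff₀ (by positivity), one_mul] at h5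
    exact h5
  have hlim : Tendsto (fun l : ℕ => harm (2 ^ l)) atTop atTop :=
    tendsto_harm.comp (tendsto_pow_atTop_atTop_of_one_lt one_lt_two)
  obtain ⟨n, hn⟩ := eventually_atTop.1 (hlim.eventually (eventually_gt_atTop (2 * C + 1)))
  obtain ⟨l, hl, hxl⟩ := hx n
  have h1 := hb l hxl
  have h2 := hn l hl
  nlinarith

theorem not_isTower_one_specMap {f : ℕ → ℕ} (hf : Tendsto f atTop atTop) {Ω : Set Op} {s : ℝ}
    (hs : 0 < s) (hΩ : ∀ A ∈ dispersionOps f, ‖A‖ ≤ s → A ∈ Ω)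
    (Γ : List ℕ → Ω → TopologicalSpace.NonemptyCompacts ℂ) :
    ¬ IsTower (IsGeneralAlgorithm (matrixEvals Ω ∪ constEvals Ω f)) (fun A => specMap A.1) 1 Γ := by
  obtain ⟨p, hp, hfp⟩ := exists_sparse hf
  have hmem : ∀ x, (s : ℂ) • sparseOp p hp.injective x ∈ Ω := fun x =>
    hΩ _ (smul_sparseOp_mem_dispersionOps hp hfp x s) (by
      rw [norm_smul, Complex.norm_real, Real.norm_of_nonneg hs.le]
      exact mul_le_of_le_one_right hs.le (norm_sparseOp_le _ x))
  have hloc : LocallyConstantEntries fun x : ℕ → Bool => (s : ℂ) • sparseOp p hp.injective x :=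
    (locallyConstantEntries_sparseOp hp.injective).smul _
  refine not_isTower_one (a := fun x => ⟨_, hmem x⟩)
    (fun φ hφ => hloc.isLocallyConstant_eval (a := fun x => ⟨_, hmem x⟩) hφ)
    -- The sign is reversed because here infinitely many ones put s into the spectrum.
    (continuous_infDist_nonemptyCompacts s).neg (α := -s) (β := 0)
    (by linarith) (fun x hx => ?_) (fun x hx => ?_) Γ
  · refine neg_le_neg ((Metric.le_infDist (TopologicalSpace.NonemptyCompacts.nonempty _)).2
      fun z hz => ?_)
    have hz0 : z = 0 := spectrum_smul_sparseOp_subset hp.injective hx s hz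
    rw [hz0, dist_zero_right, Complex.norm_real]
    exact Real.le_norm_self s
  · exact (neg_eq_zero.2
      (Metric.infDist_zero_of_mem (mem_spectrum_smul_sparseOp hp.injective hx s))).ge

/-! ### The indices for classes containing all small operators of their kind -/

theorem sci_of_small_bounded {Ω : Set Op} {s : ℝ} (hs : 0 < s) (hΩ : ∀ A : Op, ‖A‖ ≤ s → A ∈ Ω)
    (N : ℕ) {ε : ℝ} (hε : 0 < ε) :
    SCIG (matrixProblem Ω specMap) = 3 ∧ SCIA (matrixProblem Ω specMap) = 3 ∧
      SCIG (matrixProblem Ω (pseudospecMap N hε)) = 2 ∧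
      SCIA (matrixProblem Ω (pseudospecMap N hε)) = 2 := by
  have h3 : SCIG (matrixProblem Ω specMap) = (2 + 1 : ℕ) ∧
      SCIA (matrixProblem Ω specMap) = (2 + 1 : ℕ) :=
    sci_eq_of_no_tower one_le_two
      (exists_tower_specMap fun δ hδ => exists_tower_pseudospecMap subset_rfl 0 hδ)
      -- The division by 3 compensates the norm bound 3 for `triOp`; likewise the division by 2
      -- below for `swapOp`.
      (not_isTower_two_specMap (s := s / 3) (by positivity) fun A hA => hΩ A (by linarith))
  have h2 : SCIG (matrixProblem Ω (pseudospecMap N hε)) = (1 + 1 : ℕ) ∧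
      SCIA (matrixProblem Ω (pseudospecMap N hε)) = (1 + 1 : ℕ) :=
    sci_eq_of_no_tower le_rfl (exists_tower_pseudospecMap subset_rfl N hε)
      (not_isTower_one_pseudospecMap (s := s / 2) (by positivity) (fun A hA => hΩ A (by linarith))
        N hε)
  exact ⟨h3.1, h3.2, h2.1, h2.2⟩

theorem smul_basisProj_mem {Ω : Set Op} {s : ℝ} (hs : 0 < s)
    (hΩ : ∀ A ∈ compactOps, ‖A‖ ≤ s → A ∈ Ω) (m : ℕ) : (s : ℂ) • basisProj m ∈ Ω := by
  refine hΩ _ ((isCompactOperator_basisProj m).smul (s : ℂ)) ?_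
  rw [norm_smul, Complex.norm_real, Real.norm_of_nonneg hs.le]
  exact mul_le_of_le_one_right hs.le (norm_basisProj_le m)

theorem zero_mem_of_small_compact {Ω : Set Op} {s : ℝ} (hs : 0 < s)
    (hΩ : ∀ A ∈ compactOps, ‖A‖ ≤ s → A ∈ Ω) : (0 : Op) ∈ Ω :=
  hΩ 0 isCompactOperator_zero (by rw [norm_zero]; exact hs.le)

theorem sci_of_small_dispersion {f : ℕ → ℕ} (hf : Tendsto f atTop atTop) {Ω : Set Op}
    (hsub : Ω ⊆ dispersionOps f) {s : ℝ} (hs : 0 < s)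
    (hΩ : ∀ A ∈ dispersionOps f, ‖A‖ ≤ s → A ∈ Ω) (N : ℕ) {ε : ℝ} (hε : 0 < ε) :
    SCIG (matrixProblemWith f Ω specMap) = 2 ∧ SCIA (matrixProblemWith f Ω specMap) = 2 ∧
      SCIG (matrixProblemWith f Ω (pseudospecMap N hε)) = 1 ∧
      SCIA (matrixProblemWith f Ω (pseudospecMap N hε)) = 1 := by
  have hc : ∀ A ∈ compactOps, ‖A‖ ≤ s → A ∈ Ω := fun A hA =>
    hΩ A (compactOps_subset_dispersionOps hf hA)
  have h2 : SCIG (matrixProblemWith f Ω specMap) = (1 + 1 : ℕ) ∧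
      SCIA (matrixProblemWith f Ω specMap) = (1 + 1 : ℕ) :=
    sci_eq_of_no_tower le_rfl (exists_tower_specMap fun δ hδ =>
      exists_tower_pseudospecMap_of_dispersion hsub Set.subset_union_left 0 hδ)
      (not_isTower_one_specMap hf hs hΩ)
  have h1 : SCIG (matrixProblemWith f Ω (pseudospecMap N hε)) = 1 ∧
      SCIA (matrixProblemWith f Ω (pseudospecMap N hε)) = 1 :=
    sci_eq_one (exists_tower_pseudospecMap_of_dispersion hsub Set.subset_union_left N hε)
      (not_isGeneralAlgorithm_of_basisProj subset_rfl (zero_mem_of_small_compact hs hc)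
        (smul_basisProj_mem hs hc) fun m => pseudospecMap_smul_basisProj_ne hs m N hε)
  exact ⟨h2.1, h2.2, h1.1, h1.2⟩

theorem sci_of_small_compact {Ω : Set Op} (hsub : Ω ⊆ compactOps) {s : ℝ} (hs : 0 < s)
    (hΩ : ∀ A ∈ compactOps, ‖A‖ ≤ s → A ∈ Ω) (N : ℕ) {ε : ℝ} (hε : 0 < ε) :
    SCIG (matrixProblem Ω specMap) = 1 ∧ SCIA (matrixProblem Ω specMap) = 1 ∧
      SCIG (matrixProblem Ω (pseudospecMap N hε)) = 1 ∧
      SCIA (matrixProblem Ω (pseudospecMap N hε)) = 1 := by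
  have h0 := zero_mem_of_small_compact hs hΩ
  have h1 : SCIG (matrixProblem Ω specMap) = 1 ∧ SCIA (matrixProblem Ω specMap) = 1 :=
    sci_eq_one (exists_tower_specMap_of_compact hsub subset_rfl)
      (not_isGeneralAlgorithm_of_basisProj (f := id) Set.subset_union_left h0
        (smul_basisProj_mem hs hΩ) (specMap_smul_basisProj_ne hs))
  have h2 : SCIG (matrixProblem Ω (pseudospecMap N hε)) = 1 ∧
      SCIA (matrixProblem Ω (pseudospecMap N hε)) = 1 :=
    -- Compact operators have dispersion bounded by the identity, so no values of f are involved.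
    sci_eq_one (exists_tower_pseudospecMap_of_dispersion
      (hsub.trans (compactOps_subset_dispersionOps tendsto_id)) subset_rfl N hε)
      (not_isGeneralAlgorithm_of_basisProj (f := id) Set.subset_union_left h0
        (smul_basisProj_mem hs hΩ) fun m => pseudospecMap_smul_basisProj_ne hs m N hε)
  exact ⟨h1.1, h1.2, h2.1, h2.2⟩

end TowerSCI

theorem mainTheorem1 (f : ℕ → ℕ) (hf : Tendsto f atTop atTop) (N : ℕ) (ε : ℝ) (hε : 0 < ε) :
    (SCIG (matrixProblem boundedOps specMap) = 3 ∧
     SCIA (matrixProblem boundedOps specMap) = 3 ∧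
     SCIG (matrixProblem boundedOps (pseudospecMap N hε)) = 2 ∧
     SCIA (matrixProblem boundedOps (pseudospecMap N hε)) = 2 ∧
     SCIG (matrixProblemWith f (dispersionOps f) specMap) = 2 ∧
     SCIA (matrixProblemWith f (dispersionOps f) specMap) = 2 ∧
     SCIG (matrixProblemWith f (dispersionOps f) (pseudospecMap N hε)) = 1 ∧
     SCIA (matrixProblemWith f (dispersionOps f) (pseudospecMap N hε)) = 1 ∧
     SCIG (matrixProblem compactOps specMap) = 1 ∧
     SCIA (matrixProblem compactOps specMap) = 1 ∧
     SCIG (matrixProblem compactOps (pseudospecMap N hε)) = 1 ∧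
     SCIA (matrixProblem compactOps (pseudospecMap N hε)) = 1) ∧
    ∀ M : ℝ, 0 < M →
     (SCIG (matrixProblem (normBounded boundedOps M) specMap) = 3 ∧
      SCIA (matrixProblem (normBounded boundedOps M) specMap) = 3 ∧
      SCIG (matrixProblem (normBounded boundedOps M) (pseudospecMap N hε)) = 2 ∧
      SCIA (matrixProblem (normBounded boundedOps M) (pseudospecMap N hε)) = 2 ∧
      SCIG (matrixProblemWith f (normBounded (dispersionOps f) M) specMap) = 2 ∧
      SCIA (matrixProblemWith f (normBounded (dispersionOps f) M) specMap) = 2 ∧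
      SCIG (matrixProblemWith f (normBounded (dispersionOps f) M) (pseudospecMap N hε)) = 1 ∧
      SCIA (matrixProblemWith f (normBounded (dispersionOps f) M) (pseudospecMap N hε)) = 1 ∧
      SCIG (matrixProblem (normBounded compactOps M) specMap) = 1 ∧
      SCIA (matrixProblem (normBounded compactOps M) specMap) = 1 ∧
      SCIG (matrixProblem (normBounded compactOps M) (pseudospecMap N hε)) = 1 ∧
      SCIA (matrixProblem (normBounded compactOps M) (pseudospecMap N hε)) = 1) := by
  -- The lower bounds use operators of arbitrarily small norm only, so the full classes and their
  -- norm-bounded parts are treated alike.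
  have key : ∀ (Ω₁ Ω₂ Ω₃ : Set Op) (s : ℝ), 0 < s → (∀ A : Op, ‖A‖ ≤ s → A ∈ Ω₁) →
      Ω₂ ⊆ dispersionOps f → (∀ A ∈ dispersionOps f, ‖A‖ ≤ s → A ∈ Ω₂) →
      Ω₃ ⊆ compactOps → (∀ A ∈ compactOps, ‖A‖ ≤ s → A ∈ Ω₃) → _ :=
    fun _ _ _ s hs h1 h2 h3 h4 h5 => And.intro (sci_of_small_bounded hs h1 N hε)
      (And.intro (sci_of_small_dispersion hf h2 hs h3 N hε) (sci_of_small_compact h4 hs h5 N hε))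
  refine ⟨?_, fun M hM => ?_⟩
  · simpa only [and_assoc] using key boundedOps (dispersionOps f) compactOps 1 one_pos
      (fun _ _ => trivial) subset_rfl (fun _ h _ => h) subset_rfl (fun _ h _ => h)
  · simpa only [and_assoc] using key (normBounded boundedOps M) (normBounded (dispersionOps f) M)
      (normBounded compactOps M) M hM (fun _ h => ⟨trivial, h⟩) (fun _ h => h.1)
      (fun _ h h' => ⟨h, h'⟩) (fun _ h => h.1) (fun _ h h' => ⟨h, h'⟩)
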